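/- Let $(V,V_+,v)$ and $(W,W_+,w)$ be complete order unit spaces: $V$ and $W$ are real vector spaces partially ordered by proper cones $V_+$, $W_+$, the orders are archimedean, $v$ and $w$ are order units, and $V$, $W$ are Banach spaces for the order unit norms $\lVert\cdot\rVert_v$, $\lVert\cdot\rVert_w$. Here, for an order unit $u$, $\lVert z\rVert_u := \inf\{\lambda>0 : -\lambda u\le z\le \lambda u\}$. Let $C=\{x\in V: \varepsilon v\le x \text{ for some }\varepsilon>0\}$ and $D=\{z\in W: \varepsilon w\le z\text{ for some }\varepsilon>0\}$ be the open cones, and put $m(x,y):=\sup\{\lambda>0:\lambda y\le x\}$ on each of them. Let $\Phi\colon C\to D$ be a gauge-reversing bijection, i.e. a bijection with $m(\Phi(x),\Phi(y))=m(y,x)$ for all $x,y\in C$ (equivalently, an order-anti-isomorphism that is homogeneous of degree $-1$). Then for each $x\in C$ there is a unique isomorphism of order unit spaces (a linear bijection $V\to W$ mapping $V_+$ onto $W_+$ and $x$ to $\Phi(x)$) $$-D\Phi(x)\colon (V,V_+,x)\to(W,W_+,\Phi(x))$$ such that for all $y\in V_+$ $$\lVert \Phi(x+y)-\Phi(x)-D\Phi(x)(y)\rVert_{\Phi(x)}\le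 \lVert y\rVert_x^2 .$$ Moreover, for every $y\in V_+$, $D\Phi(x)(y)$ is the one-sided Gateaux derivative of $\Phi$ at $x$ in the direction $y$, i.e. $x+\mu y\in C$ for all sufficiently small $\mu>0$ and $$\lim_{\mu\downarrow 0}\mu^{-1}\lVert \Phi(x+\mu y)-\Phi(x)-\mu D\Phi(x)(y)\rVert_w=0 .$$ -/

import Mathlib

open Filter Topology

noncomputable section

namespace OrderUnit

/-- `(V, V₊, v)` is an order unit space, where `V₊ = {x | 0 ≤ x}`. The ordered vector space axioms
(equivalently: `V₊` is a proper cone) are the instance arguments; the fields say that the order is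
archimedean and that `v` is an order unit. -/
structure IsOrderUnitSpace {V : Type*} [AddCommGroup V] [PartialOrder V] [IsOrderedAddMonoid V]
    [Module ℝ V] [IsOrderedModule ℝ V] (v : V) : Prop where
  archimedean : ∀ x : V, (∃ b : V, ∀ t : ℝ, 0 ≤ t → t • x ≤ b) → x ≤ 0
  exists_le_smul : ∀ x : V, ∃ t : ℝ, 0 < t ∧ x ≤ t • v

variable {V : Type*} [AddCommGroup V] [PartialOrder V] [Module ℝ V]
variable {W : Type*} [AddCommGroup W] [PartialOrder W] [Module ℝ W]

/-- The order unit norm `‖x‖_v`. -/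
def orderUnitNorm (v x : V) : ℝ :=
  sInf {t : ℝ | 0 < t ∧ -(t • v) ≤ x ∧ x ≤ t • v}

/-- `V` is complete for the order unit norm `‖·‖_v`: every Cauchy sequence converges. -/
def IsCompleteFor (v : V) : Prop :=
  ∀ u : ℕ → V,
    (∀ ε : ℝ, 0 < ε → ∃ N : ℕ, ∀ i j : ℕ, N ≤ i → N ≤ j → orderUnitNorm v (u i - u j) < ε) →
    ∃ a : V, Tendsto (fun n => orderUnitNorm v (u n - a)) atTop (𝓝 0)

/-- The open cone `V₊°` of `(V, V₊, v)`. -/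
def openCone (v : V) : Set V :=
  {x : V | ∃ ε : ℝ, 0 < ε ∧ ε • v ≤ x}

/-- The gauge function `m(x, y) = sup {t > 0 | t y ≤ x}`. -/
def mGauge (x y : V) : ℝ :=
  sSup {t : ℝ | 0 < t ∧ t • y ≤ x}

/-- `Φ` restricts to a gauge-reversing bijection from `C` onto `D`
(values of `Φ` outside `C` are irrelevant). -/
structure IsGaugeReversingBijection (Φ : V → W) (C : Set V) (D : Set W) : Prop where
  bijOn : Set.BijOn Φ C D
  gauge_map : ∀ x ∈ C, ∀ y ∈ C, mGauge (Φ x) (Φ y) = mGauge y x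

/-- The linear bijection `T` is an isomorphism of order unit spaces `(V, V₊, v) → (W, W₊, w)`. -/
structure IsOrderUnitIso (T : V ≃ₗ[ℝ] W) (v : V) (w : W) : Prop where
  map_nonneg_iff : ∀ y : V, 0 ≤ T y ↔ 0 ≤ y
  map_unit : T v = w

/-- `q` is the (one-sided) Gateaux derivative at `x` in the direction `p` of `f`, regarded as a
function on `F` with values in `(W, ‖·‖_w)`. -/
def HasGateauxDerivAt (w : W) (f : V → W) (F : Set V) (x p : V) (q : W) : Prop :=
  (∀ᶠ μ : ℝ in 𝓝[>] 0, x + μ • p ∈ F) ∧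
    Tendsto (fun μ : ℝ => μ⁻¹ * orderUnitNorm w (f (x + μ • p) - f x - μ • q)) (𝓝[>] 0) (𝓝 0)

end OrderUnit

end

/-! The model is inversion on the cone of a Jordan algebra. There minus the derivative at `x` is
`P(x)⁻¹`, with `P` the quadratic representation, and Hua's identity `(x⁻¹ - (x + y)⁻¹)⁻¹ = x + P(x)
y⁻¹` holds. The proof recovers this identity for an abstract `Φ` with inverse `Ψ`. If `T = -DΦ(x)`
and `r = Ψ (Φ x - Φ (x + y)) - x`, then `Φ r = T y` for every order unit `y`
(`map_inv_sub_eq_taylorMap`). Hence `Φ (x + y) - Φ x + T y = Φ r - Φ (x + r) ≥ 0`. If `y ≤ s x`,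
then `Φ r = T y ≤ s Φ x`, so `x ≤ s r`, and the difference is at most `s Φ r ≤ s² Φ x`. This is the
estimate with constant 1 (`obound_taylor`). Uniqueness and the Gateaux derivative follow from it by
scaling `y`.

Existence of a derivative, with a crude constant, comes from `midpoint`: Väisälä's argument shows
that `Φ` preserves the midpoint of `a ≤ b ≤ (1 + l) a` up to `O(l²)`. So dyadic difference quotients
converge, and their limit is additive on the cone.

For Hua's identity, compose `Φ` with the inverse of its derivative at `e`. The result is a self-map
`S` that fixes `e` and has derivative `-1` there. Its odd iterates satisfy the same Taylor bounds
with the same constants, which forces `S ∘ S = id` near `e` (`involutive_near`). Put `P(p) = -DS(S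
p)`. For `b` near `e` the map `q ↦ P(b) (S q)` is again of this kind at `b`, and differentiating its
involutivity gives the fundamental identity `P(P(b) q) = P(b) P(q) P(b)`. It makes `P` first `C¹`,
then smooth.

The derivatives of `p ↦ P(p) z` lie in a closed space of order derivations. The operators obtained
by fixing two arguments of its third derivative at `e` also kill `e`, so they generate isometries.
An infinitesimal Mazur–Ulam theorem (`bilin_eq_zero_of_exp_contraction`) then makes the third
derivative vanish. So `P` is quadratic along lines, which is used as `reflection_identity`. That
identity makes `t⁻¹ Φ (Ψ (Φ x - Φ (x + t y)) - x)` independent of `t > 0`, and its limit at `0` is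
`T y`. -/

open Filter Topology

set_option linter.unusedSectionVars false

noncomputable section

namespace GaugeReversal
open OrderUnit (orderUnitNorm IsCompleteFor)

/-! ### Order units, order intervals and order unit norms -/

section Order

variable {V : Type*} [AddCommGroup V] [PartialOrder V] [IsOrderedAddMonoid V] [Module ℝ V]
  [IsOrderedModule ℝ V]

/-- `x` is an order unit of the ordered vector space `V`. -/
def IsUnitElt (x : V) : Prop := ∀ y : V, ∃ t : ℝ, 0 < t ∧ y ≤ t • x

/-- `h` lies in the order interval `[-t x, t x]`. -/
def OBound (x : V) (t : ℝ) (h : V) : Prop := -(t • x) ≤ h ∧ h ≤ t • x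

/-- The order of `V` is archimedean, and `V` is complete for all its order unit norms. -/
class CompleteOrder (V : Type*) [AddCommGroup V] [PartialOrder V] [Module ℝ V] : Prop where
  archimedean : ∀ x : V, (∃ b : V, ∀ t : ℝ, 0 ≤ t → t • x ≤ b) → x ≤ 0
  complete : ∀ x : V, IsUnitElt x → IsCompleteFor x

theorem IsUnitElt.nonneg {x : V} (hx : IsUnitElt x) : 0 ≤ x := by
  obtain ⟨t, ht, h⟩ := hx (-x)
  have h1 : 0 ≤ (1 + t) • x := by
    rw [add_smul, one_smul]; exact neg_le_iff_add_nonneg'.mp h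
  have h2 : 0 ≤ (1 + t)⁻¹ • ((1 + t) • x) := smul_nonneg (by positivity) h1
  rwa [smul_smul, inv_mul_cancel₀ (by positivity), one_smul] at h2

theorem smul_le_smul_iff_pos {c : ℝ} (hc : 0 < c) {a b : V} : c • a ≤ c • b ↔ a ≤ b := by
  constructor
  · intro h
    have := smul_le_smul_of_nonneg_left h (inv_nonneg.mpr hc.le)
    rwa [smul_smul, smul_smul, inv_mul_cancel₀ hc.ne', one_smul, one_smul] at this
  · intro h; exact smul_le_smul_of_nonneg_left h hc.le

theorem IsUnitElt.mono {x y : V} {t : ℝ} (hx : IsUnitElt x) (ht : 0 < t) (h : x ≤ t • y) :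
    IsUnitElt y := by
  intro z
  obtain ⟨s, hs, hz⟩ := hx z
  refine ⟨s * t, by positivity, hz.trans ?_⟩
  rw [mul_smul]; exact smul_le_smul_of_nonneg_left h hs.le

theorem IsUnitElt.of_le {x y : V} (hx : IsUnitElt x) (h : x ≤ y) : IsUnitElt y :=
  hx.mono one_pos (by simpa using h)

theorem IsUnitElt.smul {x : V} {c : ℝ} (hx : IsUnitElt x) (hc : 0 < c) : IsUnitElt (c • x) :=
  hx.mono (t := c⁻¹) (by positivity) (by rw [smul_smul, inv_mul_cancel₀ hc.ne', one_smul])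

theorem IsUnitElt.add {x y : V} (hx : IsUnitElt x) (hy : 0 ≤ y) : IsUnitElt (x + y) :=
  hx.of_le (le_add_of_nonneg_right hy)

theorem OBound.add {x h k : V} {s t : ℝ} (h1 : OBound x s h) (h2 : OBound x t k) :
    OBound x (s + t) (h + k) := by
  refine ⟨?_, ?_⟩
  · rw [add_smul, neg_add]; exact add_le_add h1.1 h2.1
  · rw [add_smul]; exact add_le_add h1.2 h2.2

theorem OBound.neg {x h : V} {t : ℝ} (h1 : OBound x t h) : OBound x t (-h) :=
  ⟨neg_le_neg h1.2, by simpa using neg_le_neg h1.1⟩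

theorem OBound.sub {x h k : V} {s t : ℝ} (h1 : OBound x s h) (h2 : OBound x t k) :
    OBound x (s + t) (h - k) := by
  rw [sub_eq_add_neg]; exact h1.add h2.neg

theorem OBound.smul_nonneg {x h : V} {t c : ℝ} (hc : 0 ≤ c) (h1 : OBound x t h) :
    OBound x (c * t) (c • h) := by
  refine ⟨?_, ?_⟩
  · rw [mul_smul, ← smul_neg]; exact smul_le_smul_of_nonneg_left h1.1 hc
  · rw [mul_smul]; exact smul_le_smul_of_nonneg_left h1.2 hc

theorem OBound.smul {x h : V} {t : ℝ} (c : ℝ) (h1 : OBound x t h) :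
    OBound x (|c| * t) (c • h) := by
  rcases le_total 0 c with hc | hc
  · rw [abs_of_nonneg hc]; exact h1.smul_nonneg hc
  · rw [abs_of_nonpos hc]
    have := (h1.smul_nonneg (neg_nonneg.mpr hc)).neg
    rwa [neg_smul, neg_neg] at this

theorem OBound.mono {x h : V} {s t : ℝ} (hx : 0 ≤ x) (h1 : OBound x s h) (hst : s ≤ t) :
    OBound x t h := by
  have h2 : s • x ≤ t • x := smul_le_smul_of_nonneg_right hst hx
  exact ⟨(neg_le_neg h2).trans h1.1, h1.2.trans h2⟩

theorem OBound.change {x y h : V} {s t c : ℝ} (h1 : OBound x s h) (hxy : x ≤ c • y) (hs : 0 ≤ s)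
    (hy : 0 ≤ y) (hst : s * c ≤ t) : OBound y t h := by
  have h2 : s • x ≤ (s * c) • y := by
    rw [mul_smul]; exact smul_le_smul_of_nonneg_left hxy hs
  exact OBound.mono hy ⟨(neg_le_neg h2).trans h1.1, h1.2.trans h2⟩ hst

theorem OBound.of_nonneg {x h : V} {t : ℝ} (h0 : 0 ≤ h) (h1 : h ≤ t • x) : OBound x t h :=
  ⟨(neg_nonpos.mpr (h0.trans h1)).trans h0, h1⟩

theorem OBound.le_add {x a b : V} {t : ℝ} (h : OBound x t (a - b)) : a ≤ b + t • x := by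
  simpa [add_comm] using sub_le_iff_le_add.mp h.2

theorem OBound.symm {x a b : V} {t : ℝ} (h : OBound x t (a - b)) : OBound x t (b - a) := by
  simpa using h.neg

theorem OBound.of_le {x a b : V} {t : ℝ} (h1 : a ≤ b + t • x) (h2 : b ≤ a + t • x) :
    OBound x t (a - b) :=
  ⟨by rw [neg_le, neg_sub]; exact sub_le_iff_le_add'.mpr h2, sub_le_iff_le_add'.mpr h1⟩

theorem IsUnitElt.exists_bound {x : V} (hx : IsUnitElt x) (h : V) :
    ∃ t : ℝ, 0 < t ∧ OBound x t h := by
  obtain ⟨s, hs, h1⟩ := hx h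
  obtain ⟨t, ht, h2⟩ := hx (-h)
  refine ⟨max s t, lt_max_of_lt_left hs, ?_, ?_⟩
  · rw [neg_le]
    exact h2.trans (smul_le_smul_of_nonneg_right (le_max_right _ _) hx.nonneg)
  · exact h1.trans (smul_le_smul_of_nonneg_right (le_max_left _ _) hx.nonneg)

variable [CompleteOrder V]

theorem IsUnitElt.le_of_forall {x y z : V} (hx : IsUnitElt x)
    (h : ∀ ε : ℝ, 0 < ε → y ≤ z + ε • x) : y ≤ z := by
  rw [← sub_nonpos]
  refine CompleteOrder.archimedean _ ⟨x, fun t ht => ?_⟩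
  rcases ht.eq_or_lt with rfl | ht
  · rw [zero_smul]; exact hx.nonneg
  · have h1 : y - z ≤ t⁻¹ • x := sub_le_iff_le_add'.mpr (h _ (by positivity))
    have := smul_le_smul_of_nonneg_left h1 ht.le
    rwa [smul_smul, mul_inv_cancel₀ ht.ne', one_smul] at this

theorem OBound.of_forall {x h : V} {t : ℝ} (hx : IsUnitElt x)
    (H : ∀ ε : ℝ, 0 < ε → OBound x (t + ε) h) : OBound x t h := by
  refine ⟨hx.le_of_forall fun ε hε => ?_, hx.le_of_forall fun ε hε => ?_⟩
  · have := (H ε hε).1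
    rw [add_smul, neg_add] at this
    simpa using add_le_add_left this (ε • x)
  · have := (H ε hε).2
    rwa [add_smul] at this

theorem eq_of_obound_zero {x a b : V} (h : OBound x 0 (a - b)) : a = b := by
  have h1 := h.1; have h2 := h.2
  simp only [zero_smul, neg_zero] at h1 h2
  exact sub_eq_zero.mp (le_antisymm h2 h1)

theorem eq_of_forall_obound {x a b : V} (hx : IsUnitElt x)
    (H : ∀ ε : ℝ, 0 < ε → OBound x ε (a - b)) : a = b :=
  eq_of_obound_zero (OBound.of_forall hx fun ε hε => by simpa using H ε hε)

/-- The archimedean property makes the infimum attained. From here on norm estimates are order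
estimates. -/
theorem orderUnitNorm_le_iff {x h : V} {t : ℝ} (hx : IsUnitElt x) (ht : 0 ≤ t) :
    orderUnitNorm x h ≤ t ↔ OBound x t h := by
  have hbdd : BddBelow {t : ℝ | 0 < t ∧ -(t • x) ≤ h ∧ h ≤ t • x} := ⟨0, fun s hs => hs.1.le⟩
  constructor
  · intro H
    refine OBound.of_forall hx fun ε hε => ?_
    obtain ⟨s, hs, hh⟩ := hx.exists_bound h
    obtain ⟨r, hr, hrt⟩ := exists_lt_of_csInf_lt (s := {t : ℝ | 0 < t ∧ -(t • x) ≤ h ∧ h ≤ t • x})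
      ⟨s, hs, hh⟩ (lt_of_le_of_lt H (lt_add_of_pos_right t hε))
    exact OBound.mono hx.nonneg ⟨hr.2.1, hr.2.2⟩ hrt.le
  · intro H
    refine le_of_forall_pos_le_add fun ε hε => csInf_le hbdd ⟨by positivity, ?_⟩
    exact H.mono hx.nonneg (by linarith)

theorem orderUnitNorm_nonneg (x h : V) : 0 ≤ orderUnitNorm x h :=
  Real.sInf_nonneg fun _ ht => ht.1.le

theorem obound_orderUnitNorm {x : V} (hx : IsUnitElt x) (h : V) :
    OBound x (orderUnitNorm x h) h :=
  (orderUnitNorm_le_iff hx (orderUnitNorm_nonneg x h)).mp le_rfl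

theorem orderUnitNorm_smul {x : V} (hx : IsUnitElt x) (c : ℝ) (h : V) :
    orderUnitNorm x (c • h) = |c| * orderUnitNorm x h := by
  have key : ∀ (c : ℝ) (h : V), orderUnitNorm x (c • h) ≤ |c| * orderUnitNorm x h := by
    intro c h
    rw [orderUnitNorm_le_iff hx (mul_nonneg (abs_nonneg c) (orderUnitNorm_nonneg x h))]
    exact (obound_orderUnitNorm hx h).smul c
  refine le_antisymm (key c h) ?_
  rcases eq_or_ne c 0 with rfl | hc
  · simpa using orderUnitNorm_nonneg x _
  · have := key c⁻¹ (c • h)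
    rw [smul_smul, inv_mul_cancel₀ hc, one_smul, abs_inv] at this
    have h2 : 0 < |c| := abs_pos.mpr hc
    rw [inv_mul_eq_div, le_div_iff₀ h2] at this
    simpa [mul_comm] using this

/-- The order unit norm of `x` as a norm on `V`. -/
abbrev unitNormed (x : V) (hx : IsUnitElt x) : NormedAddCommGroup V :=
  letI : Norm V := ⟨orderUnitNorm x⟩
  NormedAddCommGroup.ofCore (𝕜 := ℝ)
    { norm_nonneg := orderUnitNorm_nonneg x
      norm_smul := fun c h => orderUnitNorm_smul hx c h
      norm_triangle := fun h k => by
        refine (orderUnitNorm_le_iff hx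
          (add_nonneg (orderUnitNorm_nonneg x h) (orderUnitNorm_nonneg x k))).mpr ?_
        exact (obound_orderUnitNorm hx h).add (obound_orderUnitNorm hx k)
      norm_eq_zero_iff := fun h => by
        constructor
        · intro h0
          have := (orderUnitNorm_le_iff hx le_rfl).mp (le_of_eq h0)
          exact eq_of_obound_zero (x := x) (by simpa using this)
        · rintro rfl
          refine le_antisymm ((orderUnitNorm_le_iff hx le_rfl).mpr ?_) (orderUnitNorm_nonneg x 0)
          simp [OBound] }

/-- The normed space structure of the order unit norm of `x`. -/
abbrev unitNormedSpace (x : V) (hx : IsUnitElt x) :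
    @NormedSpace ℝ V _ (unitNormed x hx).toSeminormedAddCommGroup :=
  letI := unitNormed x hx
  { (inferInstance : Module ℝ V) with
    norm_smul_le := fun c h => by
      exact (orderUnitNorm_smul hx c h).le }

end Order

/-! ### Order unit norms as Banach space norms -/

section Normed

/-- The norm of `V` is the order unit norm of `e`. -/
structure IsUnitNorm {V : Type*} [NormedAddCommGroup V] [NormedSpace ℝ V] [PartialOrder V]
    (e : V) : Prop where
  unit : IsUnitElt e
  norm_le_iff : ∀ (h : V) (t : ℝ), 0 ≤ t → (‖h‖ ≤ t ↔ OBound e t h)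

/-- Lets a proof install the norm of whichever order unit is the current base point, so that
constants do not depend on that point. -/
theorem isUnitNorm_unitNormed {V : Type*} [AddCommGroup V] [PartialOrder V] [IsOrderedAddMonoid V]
    [Module ℝ V] [IsOrderedModule ℝ V] [CompleteOrder V] (x : V) (hx : IsUnitElt x) :
    @IsUnitNorm V (unitNormed x hx) (unitNormedSpace x hx) _ x :=
  letI := unitNormed x hx
  letI := unitNormedSpace x hx
  { unit := hx
    norm_le_iff := fun _ _ ht => orderUnitNorm_le_iff hx ht }

variable {V : Type*} [NormedAddCommGroup V] [NormedSpace ℝ V] [PartialOrder V]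
  [IsOrderedAddMonoid V] [IsOrderedModule ℝ V] [CompleteOrder V] {e : V}

theorem IsUnitNorm.norm_eq (he : IsUnitNorm e) (h : V) : ‖h‖ = orderUnitNorm e h :=
  le_antisymm
    ((he.norm_le_iff _ _ (orderUnitNorm_nonneg e h)).mpr (obound_orderUnitNorm he.unit h))
    ((orderUnitNorm_le_iff he.unit (norm_nonneg h)).mpr
      ((he.norm_le_iff _ _ (norm_nonneg h)).mp le_rfl))

theorem IsUnitNorm.completeSpace (he : IsUnitNorm e) : CompleteSpace V := by
  refine Metric.complete_of_cauchySeq_tendsto fun u hu => ?_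
  obtain ⟨a, ha⟩ := CompleteOrder.complete e he.unit u (fun ε hε => by
    obtain ⟨N, hN⟩ := Metric.cauchySeq_iff.mp hu ε hε
    refine ⟨N, fun i j hi hj => ?_⟩
    rw [← he.norm_eq, ← dist_eq_norm]
    exact hN i hi j hj)
  refine ⟨a, tendsto_iff_norm_sub_tendsto_zero.mpr ?_⟩
  simpa only [he.norm_eq] using ha

theorem IsUnitNorm.obound (he : IsUnitNorm e) {h : V} {t : ℝ} (ht : ‖h‖ ≤ t) : OBound e t h :=
  (he.norm_le_iff _ _ ((norm_nonneg h).trans ht)).mp ht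

theorem IsUnitNorm.norm_le (he : IsUnitNorm e) {h : V} {t : ℝ} (ht : 0 ≤ t) (hb : OBound e t h) :
    ‖h‖ ≤ t :=
  (he.norm_le_iff _ _ ht).mpr hb

theorem IsUnitNorm.isClosed_nonneg (he : IsUnitNorm e) : IsClosed {h : V | 0 ≤ h} := by
  refine isClosed_of_closure_subset fun h hh => ?_
  refine he.unit.le_of_forall fun ε hε => ?_
  obtain ⟨k, hk, hd⟩ := Metric.mem_closure_iff.mp hh ε hε
  rw [dist_eq_norm] at hd
  have h1 := (he.obound hd.le).1
  have h2 : (0 : V) ≤ k := hk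
  rw [neg_le_iff_add_nonneg] at h1
  have : (h + ε • e) = (h - k + ε • e) + k := by abel
  rw [this]; exact add_nonneg h1 h2

theorem IsUnitNorm.orderClosedTopology (he : IsUnitNorm e) : OrderClosedTopology V where
  isClosed_le' := by
    have : {p : V × V | p.1 ≤ p.2} = (fun p : V × V => p.2 - p.1) ⁻¹' {h : V | 0 ≤ h} := by
      ext p; simp
    rw [this]
    exact he.isClosed_nonneg.preimage (by fun_prop)

end Normed

end GaugeReversal

/-! ### Gauge-reversing maps and approximate preservation of midpoints -/

namespace GaugeReversal
open OrderUnit (orderUnitNorm IsCompleteFor)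

/-- Väisälä's doubling argument: a bi-Lipschitz bijection of a bounded set that is symmetric about
`z` displaces `z` by little. -/
theorem displacement_center_le {V : Type*} [NormedAddCommGroup V] [NormedSpace ℝ V] {I : Set V}
    {z : V} {D : ℝ} (hz : z ∈ I) (hI : ∀ p ∈ I, z + z - p ∈ I)
    (hD : ∀ p ∈ I, ∀ q ∈ I, ‖p - q‖ ≤ D) (n : ℕ) :
    ∀ (L : ℝ) (g g' : V → V), 1 ≤ L → (∀ p ∈ I, g p ∈ I) → (∀ p ∈ I, g' p ∈ I) →
      (∀ p ∈ I, g' (g p) = p) → (∀ p ∈ I, g (g' p) = p) →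
      (∀ p ∈ I, ∀ q ∈ I, ‖g p - g q‖ ≤ L * ‖p - q‖) →
      (∀ p ∈ I, ∀ q ∈ I, ‖g' p - g' q‖ ≤ L * ‖p - q‖) →
      L * (2 ^ n * ‖g z - z‖) ≤ L ^ (2 ^ n) * D := by
  induction n with
  | zero =>
    intro L g g' hL hg hg' h1 h2 h3 h4
    simpa using mul_le_mul_of_nonneg_left (hD _ (hg z hz) z hz) (by linarith)
  | succ n ih =>
    intro L g g' hL hg hg' h1 h2 h3 h4
    have hL0 : 0 ≤ L := by linarith
    have hψ : ∀ p q : V, ‖(z + z - p) - (z + z - q)‖ = ‖p - q‖ := fun p q => by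
      rw [sub_sub_sub_cancel_left, norm_sub_rev]
    have hzz : z + z - z = z := by abel
    -- With `ψ` the point reflection in `z`, pass from `g` to `ψ g' ψ g`. The Lipschitz constant is
    -- squared, while by `hdouble` the displacement of `z` doubles up to a factor `L`.
    have key := ih (L ^ 2) (fun p => z + z - g' (z + z - g p)) (fun p => g' (z + z - g (z + z - p)))
      (one_le_pow₀ hL) (fun p hp => hI _ (hg' _ (hI _ (hg p hp))))
      (fun p hp => hg' _ (hI _ (hg _ (hI p hp))))
      (fun p hp => by
        simp only [sub_sub_cancel]
        rw [h2 _ (hI _ (hg p hp)), sub_sub_cancel, h1 p hp])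
      (fun p hp => by
        rw [h2 _ (hI _ (hg _ (hI p hp))), sub_sub_cancel, h1 _ (hI p hp), sub_sub_cancel])
      (fun p hp q hq => by
        rw [hψ]
        refine (h4 _ (hI _ (hg p hp)) _ (hI _ (hg q hq))).trans ?_
        rw [hψ, sq, mul_assoc]
        exact mul_le_mul_of_nonneg_left (h3 p hp q hq) hL0)
      (fun p hp q hq => by
        refine (h4 _ (hI _ (hg _ (hI p hp))) _ (hI _ (hg _ (hI q hq)))).trans ?_
        rw [hψ, sq, mul_assoc]
        refine mul_le_mul_of_nonneg_left ((h3 _ (hI p hp) _ (hI q hq)).trans ?_) hL0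
        rw [hψ])
    have hdouble : 2 * ‖g z - z‖ ≤ L * ‖(z + z - g' (z + z - g z)) - z‖ := by
      have e1 : ‖(z + z - g' (z + z - g z)) - z‖ = ‖g' (z + z - g z) - z‖ := by
        have : (z + z - g' (z + z - g z)) - z = -(g' (z + z - g z) - z) := by abel
        rw [this, norm_neg]
      have e2 := h3 _ (hg' _ (hI _ (hg z hz))) z hz
      rw [h2 _ (hI _ (hg z hz))] at e2
      have e3 : z + z - g z - g z = (-2 : ℝ) • (g z - z) := by
        rw [neg_smul, two_smul]; abel
      rw [e3, norm_smul] at e2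
      rw [e1]
      simpa using e2
    calc L * (2 ^ (n + 1) * ‖g z - z‖) = (L * 2 ^ n) * (2 * ‖g z - z‖) := by ring
      _ ≤ (L * 2 ^ n) * (L * ‖(z + z - g' (z + z - g z)) - z‖) :=
        mul_le_mul_of_nonneg_left hdouble (by positivity)
      _ = L ^ 2 * (2 ^ n * ‖(z + z - g' (z + z - g z)) - z‖) := by ring
      _ ≤ (L ^ 2) ^ (2 ^ n) * D := key
      _ = L ^ (2 ^ (n + 1)) * D := by rw [← pow_mul, pow_succ 2 n, mul_comm 2]

variable {V W : Type*} [AddCommGroup V] [PartialOrder V] [IsOrderedAddMonoid V] [Module ℝ V]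
  [IsOrderedModule ℝ V] [CompleteOrder V] [AddCommGroup W] [PartialOrder W]
  [IsOrderedAddMonoid W] [Module ℝ W] [IsOrderedModule ℝ W] [CompleteOrder W]

/-- `Φ` and `Ψ` are inverse gauge-reversing bijections between the order units of `V` and `W`. -/
structure GaugeReversing (Φ : V → W) (Ψ : W → V) : Prop where
  map_unit : ∀ {x : V}, IsUnitElt x → IsUnitElt (Φ x)
  inv_unit : ∀ {y : W}, IsUnitElt y → IsUnitElt (Ψ y)
  left_inv : ∀ {x : V}, IsUnitElt x → Ψ (Φ x) = x
  right_inv : ∀ {y : W}, IsUnitElt y → Φ (Ψ y) = y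
  smul_le_iff : ∀ {x y : V} {t : ℝ}, IsUnitElt x → IsUnitElt y → 0 < t →
    (t • Φ y ≤ Φ x ↔ t • x ≤ y)

namespace GaugeReversing

variable {Φ : V → W} {Ψ : W → V}

theorem symm (h : GaugeReversing Φ Ψ) : GaugeReversing Ψ Φ where
  map_unit := h.inv_unit
  inv_unit := h.map_unit
  left_inv := h.right_inv
  right_inv := h.left_inv
  smul_le_iff := fun {x y t} hx hy ht => by
    rw [← h.smul_le_iff (h.inv_unit hy) (h.inv_unit hx) ht, h.right_inv hx, h.right_inv hy]

theorem antitone (h : GaugeReversing Φ Ψ) {x y : V} (hx : IsUnitElt x) (hxy : x ≤ y) :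
    Φ y ≤ Φ x := by
  have := (h.smul_le_iff hx (hx.of_le hxy) one_pos).mpr (by simpa using hxy)
  simpa using this

theorem map_smul (h : GaugeReversing Φ Ψ) {x : V} (hx : IsUnitElt x) {c : ℝ} (hc : 0 < c) :
    Φ (c • x) = c⁻¹ • Φ x := by
  apply le_antisymm
  · rw [← smul_le_smul_iff_pos hc, smul_smul, mul_inv_cancel₀ hc.ne', one_smul]
    exact (h.smul_le_iff hx (hx.smul hc) hc).mpr le_rfl
  · refine (h.smul_le_iff (hx.smul hc) hx (inv_pos.mpr hc)).mpr ?_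
    rw [smul_smul, inv_mul_cancel₀ hc.ne', one_smul]

/-- Since `a ≤ q`, one has `p ≤ q + s a ≤ (1 + s) q`. Reversal gives `Φ q ≤ (1 + s) Φ p`, and `Φ p ≤
Φ a`. -/
theorem lipschitz (h : GaugeReversing Φ Ψ) {a p q : V} {s : ℝ} (ha : IsUnitElt a) (hp : a ≤ p)
    (hq : a ≤ q) (hs : 0 ≤ s) (hb : OBound a s (p - q)) : OBound (Φ a) s (Φ p - Φ q) := by
  have key : ∀ {p q : V}, a ≤ p → a ≤ q → OBound a s (p - q) → Φ q ≤ Φ p + s • Φ a := by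
    intro p q hp hq hb
    have hpu := ha.of_le hp
    have hqu := ha.of_le hq
    have h1 : p ≤ (1 + s) • q := by
      rw [add_smul, one_smul]
      exact hb.le_add.trans (add_le_add_right (smul_le_smul_of_nonneg_left hq hs) q)
    have h2 : (1 + s)⁻¹ • p ≤ q := by
      rw [← smul_le_smul_iff_pos (c := 1 + s) (by positivity), smul_smul,
        mul_inv_cancel₀ (by positivity), one_smul]
      exact h1
    have h3 := (h.smul_le_iff hpu hqu (by positivity)).mpr h2
    rw [← smul_le_smul_iff_pos (c := 1 + s) (by positivity), smul_smul,
      mul_inv_cancel₀ (by positivity), one_smul, add_smul, one_smul] at h3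
    exact h3.trans (add_le_add_right (smul_le_smul_of_nonneg_left (h.antitone ha hp) hs) _)
  exact OBound.of_le (key hq hp hb.symm) (key hp hq hb)

/-- The point reflections of `[a, b]` and of `[Φ b, Φ a]`, linked by `Φ` and `Ψ`, give a self-map
`g` of `[a, b]` that sends the midpoint `z` to `Ψ (Φ a + Φ b - Φ z)`. It is bi-Lipschitz with
constant `(1 + l)²` on a set of diameter at most `l`, so the doubling argument moves `z` by only
`O(l²)`. -/
theorem midpoint (h : GaugeReversing Φ Ψ) {a b : V} {l : ℝ} (ha : IsUnitElt a) (hab : a ≤ b)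
    (hb : b ≤ (1 + l) • a) (hl : 0 < l) (hl1 : l ≤ 1) :
    OBound (Φ a) (8 * l ^ 2)
      (Φ ((2⁻¹ : ℝ) • (a + b)) - (2⁻¹ : ℝ) • (Φ a + Φ b)) := by
  have hbu := ha.of_le hab
  have hua := h.map_unit ha
  have hub := h.map_unit hbu
  have hba : Φ b ≤ Φ a := h.antitone ha hab
  have hab' : Φ a ≤ (1 + l) • Φ b := by
    have : (1 + l)⁻¹ • b ≤ a := by
      rw [← smul_le_smul_iff_pos (c := 1 + l) (by positivity), smul_smul,
        mul_inv_cancel₀ (by positivity), one_smul]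
      exact hb
    have h3 := (h.smul_le_iff hbu ha (by positivity)).mpr this
    rwa [← smul_le_smul_iff_pos (c := 1 + l) (by positivity), smul_smul,
      mul_inv_cancel₀ (by positivity), one_smul] at h3
  have hnorm := isUnitNorm_unitNormed a ha
  let _ := unitNormed a ha
  let _ := unitNormedSpace a ha
  set z : V := (2⁻¹ : ℝ) • (a + b) with hz_def
  have hzz : z + z = a + b := by
    rw [hz_def, ← two_smul ℝ, smul_smul]; norm_num
  have hrefl : ∀ p ∈ Set.Icc a b, a + b - p ∈ Set.Icc a b := fun p hp =>
    ⟨by have := sub_le_sub_left hp.2 (a + b); simpa using this,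
     by have := sub_le_sub_left hp.1 (a + b); simpa using this⟩
  have hrefl' : ∀ p ∈ Set.Icc (Φ b) (Φ a), Φ a + Φ b - p ∈ Set.Icc (Φ b) (Φ a) := fun p hp =>
    ⟨by have := sub_le_sub_left hp.2 (Φ a + Φ b); simpa using this,
     by have := sub_le_sub_left hp.1 (Φ a + Φ b); simpa using this⟩
  have hΦI : ∀ p ∈ Set.Icc a b, Φ p ∈ Set.Icc (Φ b) (Φ a) := fun p hp =>
    ⟨h.antitone (ha.of_le hp.1) hp.2, h.antitone ha hp.1⟩
  have hΨI : ∀ p ∈ Set.Icc (Φ b) (Φ a), Ψ p ∈ Set.Icc a b := fun p hp => by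
    refine ⟨?_, ?_⟩
    · have := h.symm.antitone (hub.of_le hp.1) hp.2
      rwa [h.left_inv ha] at this
    · have := h.symm.antitone hub hp.1
      rwa [h.left_inv hbu] at this
  have hzI : z ∈ Set.Icc a b := by
    constructor
    · have : a = (2⁻¹ : ℝ) • (a + a) := by rw [← two_smul ℝ, smul_smul]; norm_num
      rw [this, hz_def]
      exact smul_le_smul_of_nonneg_left (add_le_add_right hab a) (by norm_num)
    · have : b = (2⁻¹ : ℝ) • (b + b) := by rw [← two_smul ℝ, smul_smul]; norm_num
      rw [this, hz_def]
      exact smul_le_smul_of_nonneg_left (add_le_add_left hab b) (by norm_num)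
  have hlipΦ : ∀ p ∈ Set.Icc a b, ∀ q ∈ Set.Icc a b, OBound (Φ a) ‖p - q‖ (Φ p - Φ q) :=
    fun p hp q hq => h.lipschitz ha hp.1 hq.1 (norm_nonneg _) (hnorm.obound le_rfl)
  have hlipΨ : ∀ p ∈ Set.Icc (Φ b) (Φ a), ∀ q ∈ Set.Icc (Φ b) (Φ a), ∀ s : ℝ, 0 ≤ s →
      OBound (Φ a) s (p - q) → ‖Ψ p - Ψ q‖ ≤ (1 + l) ^ 2 * s := by
    intro p hp q hq s hs hpq
    have h1 : OBound (Φ b) ((1 + l) * s) (p - q) :=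
      hpq.change hab' hs hub.nonneg (by rw [mul_comm])
    have h2 := h.symm.lipschitz hub hp.1 hq.1 (by positivity) h1
    rw [h.left_inv hbu] at h2
    refine hnorm.norm_le (by positivity) (h2.change hb (by positivity) ha.nonneg ?_)
    apply le_of_eq; ring
  set g : V → V := fun p => Ψ (Φ a + Φ b - Φ (a + b - p)) with hg
  set g' : V → V := fun p => a + b - Ψ (Φ a + Φ b - Φ p) with hg'
  have hgI : ∀ p ∈ Set.Icc a b, g p ∈ Set.Icc a b := fun p hp =>
    hΨI _ (hrefl' _ (hΦI _ (hrefl p hp)))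
  have hg'I : ∀ p ∈ Set.Icc a b, g' p ∈ Set.Icc a b := fun p hp =>
    hrefl _ (hΨI _ (hrefl' _ (hΦI p hp)))
  have hu' : ∀ p ∈ Set.Icc (Φ b) (Φ a), IsUnitElt p := fun p hp => hub.of_le hp.1
  have hu : ∀ p ∈ Set.Icc a b, IsUnitElt p := fun p hp => ha.of_le hp.1
  -- With `2 ^ n` of the order of `l⁻¹`, the constant `(1 + l) ^ (2 * 2 ^ n)` stays below `e² ≤ 8`,
  -- while the displacement bound gains a factor of order `l`.
  obtain ⟨n, hn1, hn2⟩ := exists_nat_pow_near (x := l⁻¹) (y := 2) (one_le_inv_iff₀.mpr ⟨hl, hl1⟩)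
    one_lt_two
  have key := displacement_center_le (I := Set.Icc a b) (z := z) (D := l) hzI
    (fun p hp => by rw [hzz]; exact hrefl p hp)
    (fun p hp q hq => by
      have hup : ∀ p ∈ Set.Icc a b, ∀ q ∈ Set.Icc a b, p ≤ q + l • a := fun p hp q hq => by
        refine hp.2.trans (hb.trans ?_)
        rw [add_smul, one_smul]
        exact add_le_add_left hq.1 _
      exact hnorm.norm_le hl.le (OBound.of_le (hup p hp q hq) (hup q hq p hp))) n ((1 + l) ^ 2) g g'
    (one_le_pow₀ (by linarith)) hgI hg'I
    (fun p hp => by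
      simp only [hg, hg']
      rw [h.right_inv (hu' _ (hrefl' _ (hΦI _ (hrefl p hp)))), sub_sub_cancel,
        h.left_inv (hu _ (hrefl p hp)), sub_sub_cancel])
    (fun p hp => by
      simp only [hg, hg']
      rw [sub_sub_cancel, h.right_inv (hu' _ (hrefl' _ (hΦI p hp))), sub_sub_cancel,
        h.left_inv (hu p hp)])
    (fun p hp q hq => by
      refine hlipΨ _ (hrefl' _ (hΦI _ (hrefl p hp))) _ (hrefl' _ (hΦI _ (hrefl q hq))) _
        (norm_nonneg _) ?_
      rw [sub_sub_sub_cancel_left]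
      have := hlipΦ _ (hrefl q hq) _ (hrefl p hp)
      rwa [sub_sub_sub_cancel_left] at this)
    (fun p hp q hq => by
      simp only [hg']
      rw [sub_sub_sub_cancel_left]
      have := hlipΨ _ (hrefl' _ (hΦI q hq)) _ (hrefl' _ (hΦI p hp)) ‖p - q‖ (norm_nonneg _)
        (by rw [sub_sub_sub_cancel_left]; exact hlipΦ p hp q hq)
      exact this)
  have hpow : ((1 + l) ^ 2) ^ (2 ^ n) ≤ 8 := by
    have h2n : l * 2 ^ n ≤ 1 := by
      have := mul_le_mul_of_nonneg_left hn1 hl.le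
      rwa [mul_inv_cancel₀ hl.ne'] at this
    calc ((1 + l) ^ 2) ^ (2 ^ n) = (1 + l) ^ (2 * 2 ^ n) := by rw [← pow_mul]
      _ ≤ (Real.exp l) ^ (2 * 2 ^ n) :=
        pow_le_pow_left₀ (by positivity) (by linarith [Real.add_one_le_exp l]) _
      _ = Real.exp (2 * (l * 2 ^ n)) := by
        rw [← Real.exp_nat_mul]; congr 1; push_cast; ring
      _ ≤ Real.exp 2 := Real.exp_le_exp.mpr (by linarith)
      _ = Real.exp 1 ^ 2 := by rw [← Real.exp_nat_mul]; norm_num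
      _ ≤ 2.7182818286 ^ 2 := pow_le_pow_left₀ (Real.exp_pos 1).le Real.exp_one_lt_d9.le 2
      _ ≤ 8 := by norm_num
  have hd : ‖g z - z‖ ≤ 16 * l ^ 2 := by
    have hL1 : (1 : ℝ) ≤ (1 + l) ^ 2 := one_le_pow₀ (by linarith)
    have h0 : 0 ≤ 2 ^ n * ‖g z - z‖ := by positivity
    have h1 : 2 ^ n * ‖g z - z‖ ≤ 8 * l := by
      calc 2 ^ n * ‖g z - z‖ ≤ (1 + l) ^ 2 * (2 ^ n * ‖g z - z‖) := le_mul_of_one_le_left h0 hL1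
        _ ≤ ((1 + l) ^ 2) ^ (2 ^ n) * l := key
        _ ≤ 8 * l := mul_le_mul_of_nonneg_right hpow hl.le
    have h2 : 1 < 2 * l * 2 ^ n := by
      have := mul_lt_mul_of_pos_left hn2 hl
      rw [mul_inv_cancel₀ hl.ne', pow_succ] at this
      linarith
    nlinarith [norm_nonneg (g z - z)]
  have hgz : g z = Ψ (Φ a + Φ b - Φ z) := by
    simp only [hg]; rw [← hzz, add_sub_cancel_right]
  have hfin := (hlipΦ _ (hgI z hzI) z hzI).mono hua.nonneg hd
  rw [hgz, h.right_inv (hu' _ (hrefl' _ (hΦI z hzI)))] at hfin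
  have := hfin.smul_nonneg (c := 2⁻¹) (by norm_num)
  have e : (2⁻¹ : ℝ) • (Φ a + Φ b - Φ z - Φ z) = (2⁻¹ : ℝ) • (Φ a + Φ b) - Φ z := by
    rw [sub_sub, smul_sub, ← two_smul ℝ (Φ z), smul_smul]; norm_num
  rw [e] at this
  exact (this.mono hua.nonneg (by linarith)).symm

/-- For `l ≥ 1` nothing has to be proved beyond the fact that both vectors lie in `[0, Φ a]`; for `l
= 0` the segment is a point. -/
theorem midpoint_le (h : GaugeReversing Φ Ψ) {a b : V} {l : ℝ} (ha : IsUnitElt a) (hab : a ≤ b)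
    (hb : b ≤ (1 + l) • a) (hl : 0 ≤ l) :
    OBound (Φ a) (8 * l ^ 2)
      (Φ ((2⁻¹ : ℝ) • (a + b)) - (2⁻¹ : ℝ) • (Φ a + Φ b)) := by
  have hua := (h.map_unit ha).nonneg
  have half : ∀ w : W, (2⁻¹ : ℝ) • (w + w) = w := fun w => by
    rw [← two_smul ℝ, smul_smul]; norm_num
  have half' : ∀ w : V, (2⁻¹ : ℝ) • (w + w) = w := fun w => by
    rw [← two_smul ℝ, smul_smul]; norm_num
  rcases hl.eq_or_lt with rfl | hl
  · have : b = a := le_antisymm (by simpa using hb) hab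
    rw [this, half, half', sub_self]
    simp [OBound]
  rcases le_total l 1 with hl1 | hl1
  · exact h.midpoint ha hab hb hl hl1
  · have hb0 : 0 ≤ Φ b := (h.map_unit (ha.of_le hab)).nonneg
    have hba := h.antitone ha hab
    have haz : a ≤ (2⁻¹ : ℝ) • (a + b) := by
      conv_lhs => rw [← half' a]
      exact smul_le_smul_of_nonneg_left (add_le_add_right hab a) (by norm_num)
    have hz := h.antitone ha haz
    have hz0 := (h.map_unit (ha.of_le haz)).nonneg
    refine OBound.mono (s := 1) hua (OBound.of_le ?_ ?_) (by nlinarith)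
    · rw [one_smul]
      exact hz.trans (le_add_of_nonneg_left (_root_.smul_nonneg (by norm_num) (add_nonneg hua hb0)))
    · rw [one_smul]
      refine le_trans ?_ (le_add_of_nonneg_left hz0)
      conv_rhs => rw [← half (Φ a)]
      exact smul_le_smul_of_nonneg_left (add_le_add_right hba _) (by norm_num)

end GaugeReversing
end GaugeReversal

/-! ### The derivative and a second-order Taylor estimate with crude constant -/

namespace GaugeReversal
open OrderUnit (orderUnitNorm IsCompleteFor)

section Normed

variable {V W : Type*} [NormedAddCommGroup V] [NormedSpace ℝ V] [PartialOrder V]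
  [IsOrderedAddMonoid V] [IsOrderedModule ℝ V] [CompleteOrder V]
  [NormedAddCommGroup W] [NormedSpace ℝ W] [PartialOrder W]
  [IsOrderedAddMonoid W] [IsOrderedModule ℝ W] [CompleteOrder W]

theorem eq_zero_of_forall_norm_le_geometric {w : W} {C : ℝ} (h : ∀ n : ℕ, ‖w‖ ≤ C / 2 ^ n) :
    w = 0 := by
  have : Tendsto (fun n : ℕ => C / 2 ^ n) atTop (𝓝 0) :=
    tendsto_const_nhds.div_atTop (tendsto_pow_atTop_atTop_of_one_lt one_lt_two)
  exact norm_le_zero_iff.mp (ge_of_tendsto' this h)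

theorem IsUnitNorm.norm_unit_le {e : V} (he : IsUnitNorm e) : ‖e‖ ≤ 1 :=
  he.norm_le zero_le_one (OBound.of_nonneg he.unit.nonneg (by rw [one_smul]))

theorem IsUnitNorm.le_norm_smul {e : V} (he : IsUnitNorm e) (h : V) : h ≤ ‖h‖ • e :=
  (he.obound le_rfl).2

/-- A nonexpansive additive map on the positive cone extends to a continuous linear map. -/
theorem exists_extension_of_cone {x : V} (hx : IsUnitNorm x) (T : V → W)
    (hadd : ∀ y z, 0 ≤ y → 0 ≤ z → T (y + z) = T y + T z)
    (hlip : ∀ y z, 0 ≤ y → 0 ≤ z → ‖T y - T z‖ ≤ ‖y - z‖) :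
    ∃ L : V →L[ℝ] W, (∀ y, 0 ≤ y → L y = T y) ∧ ∀ h, ‖L h‖ ≤ ‖h‖ := by
  have hp : ∀ h : V, 0 ≤ h + ‖h‖ • x := fun h => by
    have := (hx.obound (le_refl ‖h‖)).1
    rwa [neg_le_iff_add_nonneg] at this
  have hn : ∀ h : V, 0 ≤ ‖h‖ • x := fun h => smul_nonneg (norm_nonneg h) hx.unit.nonneg
  set E : V → W := fun h => T (h + ‖h‖ • x) - T (‖h‖ • x) with hE
  have hEeq : ∀ h a b : V, 0 ≤ a → 0 ≤ b → h = a - b → E h = T a - T b := by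
    intro h a b ha hb hab
    have : (h + ‖h‖ • x) + b = a + ‖h‖ • x := by rw [hab]; abel
    have h1 := congrArg T this
    rw [hadd _ _ (hp h) hb, hadd _ _ ha (hn h)] at h1
    rw [hE]
    rw [sub_eq_sub_iff_add_eq_add, h1]
  have hE0 : ∀ y, 0 ≤ y → E y = T y := by
    intro y hy
    have h0 : T 0 = 0 := by simpa using hadd 0 0 le_rfl le_rfl
    rw [hEeq y y 0 hy le_rfl (by simp), h0, sub_zero]
  have hElip : ∀ h, ‖E h‖ ≤ ‖h‖ := by
    intro h
    refine (hlip _ _ (hp h) (hn h)).trans ?_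
    rw [add_sub_cancel_right]
  have hEadd : ∀ a b, E (a + b) = E a + E b := by
    intro a b
    rw [hEeq (a + b) ((a + ‖a‖ • x) + (b + ‖b‖ • x)) (‖a‖ • x + ‖b‖ • x)
      (add_nonneg (hp a) (hp b)) (add_nonneg (hn a) (hn b)) (by abel),
      hadd _ _ (hp a) (hp b), hadd _ _ (hn a) (hn b)]
    simp only [hE]; abel
  let A : V →+ W := AddMonoidHom.mk' E hEadd
  have hcont : Continuous A := by
    refine AddMonoidHomClass.continuous_of_bound A 1 fun h => ?_
    rw [one_mul]; exact hElip h
  exact ⟨A.toRealLinearMap hcont, fun y hy => hE0 y hy, fun h => hElip h⟩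

namespace GaugeReversing

variable {Φ : V → W} {Ψ : W → V} {x : V}

/-- `midpoint_le` on the segment from `x` to `x + 2⁻ⁿ y` bounds the difference of consecutive dyadic
quotients by `16 ‖y‖² / 2ⁿ`. Summing from `n = 0` gives the constant 32. -/
theorem exists_cone_derivative (h : GaugeReversing Φ Ψ) (hx : IsUnitNorm x)
    (hu : IsUnitNorm (Φ x)) :
    ∃ T : V → W, (∀ y, 0 ≤ y → Tendsto
      (fun n : ℕ => (2 ^ n : ℝ) • (Φ x - Φ (x + ((2 ^ n)⁻¹ : ℝ) • y))) atTop (𝓝 (T y))) ∧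
      ∀ y, 0 ≤ y → ‖Φ x - Φ (x + y) - T y‖ ≤ 32 * ‖y‖ ^ 2 := by
  have := hu.completeSpace
  have key : ∀ y : V, 0 ≤ y → ∃ t : W, Tendsto
      (fun n : ℕ => (2 ^ n : ℝ) • (Φ x - Φ (x + ((2 ^ n)⁻¹ : ℝ) • y))) atTop (𝓝 t) ∧
      ‖Φ x - Φ (x + y) - t‖ ≤ 32 * ‖y‖ ^ 2 := by
    intro y hy
    set s : ℕ → W := fun n : ℕ => (2 ^ n : ℝ) • (Φ x - Φ (x + ((2 ^ n)⁻¹ : ℝ) • y)) with hs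
    have hstep : ∀ n, dist (s n) (s (n + 1)) ≤ 32 * ‖y‖ ^ 2 / 2 / 2 ^ n := by
      intro n
      set k : V := ((2 ^ n)⁻¹ : ℝ) • y with hk
      have hk0 : 0 ≤ k := _root_.smul_nonneg (by positivity) hy
      have hkn : ‖k‖ = (2 ^ n)⁻¹ * ‖y‖ := by
        rw [hk, norm_smul, Real.norm_of_nonneg (by positivity)]
      have hm := h.midpoint_le (a := x) (b := x + k) (l := ‖k‖) hx.unit
        (le_add_of_nonneg_right hk0)
        (by rw [add_smul, one_smul]; exact add_le_add_right (hx.le_norm_smul k) x) (norm_nonneg _)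
      have e1 : (2⁻¹ : ℝ) • (x + (x + k)) = x + ((2 ^ (n + 1))⁻¹ : ℝ) • y := by
        rw [hk, ← add_assoc, ← two_smul ℝ x, smul_add, smul_smul, smul_smul, pow_succ, mul_inv,
          mul_comm (2⁻¹ : ℝ) (2 ^ n)⁻¹]
        norm_num
      rw [e1] at hm
      have hm' := hu.norm_le (by positivity) hm
      have e2 : s n - s (n + 1) = (2 ^ (n + 1) : ℝ) •
          (Φ (x + ((2 ^ (n + 1))⁻¹ : ℝ) • y) - (2⁻¹ : ℝ) • (Φ x + Φ (x + k))) := by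
        simp only [hs, ← hk, smul_sub, smul_add, smul_smul, pow_succ]
        have : (2 : ℝ) ^ n * 2 * 2⁻¹ = 2 ^ n := by ring
        rw [this, mul_two, add_smul]
        abel
      rw [dist_eq_norm, e2, norm_smul, Real.norm_of_nonneg (by positivity)]
      refine (mul_le_mul_of_nonneg_left hm' (by positivity)).trans (le_of_eq ?_)
      rw [hkn, pow_succ]
      field_simp
      ring
    obtain ⟨t, ht⟩ := cauchySeq_tendsto_of_complete (cauchySeq_of_le_geometric_two hstep)
    refine ⟨t, ht, ?_⟩
    have := dist_le_of_le_geometric_two_of_tendsto₀ hstep ht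
    rw [dist_eq_norm] at this
    simpa [hs] using this
  choose! T hT1 hT2 using key
  exact ⟨T, hT1, hT2⟩

theorem exists_derivative_normed (h : GaugeReversing Φ Ψ) (hx : IsUnitNorm x)
    (hu : IsUnitNorm (Φ x)) :
    ∃ T : V →L[ℝ] W, T x = Φ x ∧ (∀ y, 0 ≤ y → 0 ≤ T y) ∧ (∀ k, ‖T k‖ ≤ ‖k‖) ∧
      ∀ y, 0 ≤ y → ‖Φ x - Φ (x + y) - T y‖ ≤ 32 * ‖y‖ ^ 2 := by
  obtain ⟨T, hT, hest⟩ := h.exists_cone_derivative hx hu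
  have hsc : ∀ (n : ℕ) {y : V}, 0 ≤ y → 0 ≤ ((2 ^ n)⁻¹ : ℝ) • y := fun n y hy =>
    _root_.smul_nonneg (by positivity) hy
  have hnsc : ∀ (n : ℕ) (y : V), ‖((2 ^ n)⁻¹ : ℝ) • y‖ = (2 ^ n)⁻¹ * ‖y‖ := fun n y => by
    rw [norm_smul, Real.norm_of_nonneg (by positivity)]
  have hlip : ∀ y z, 0 ≤ y → 0 ≤ z → ‖T y - T z‖ ≤ ‖y - z‖ := by
    intro y z hy hz
    refine le_of_tendsto' ((hT y hy).sub (hT z hz)).norm fun n => ?_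
    rw [← smul_sub, sub_sub_sub_cancel_left, norm_smul, Real.norm_of_nonneg (by positivity)]
    have h1 := h.lipschitz (a := x) (p := x + ((2 ^ n)⁻¹ : ℝ) • z) (q := x + ((2 ^ n)⁻¹ : ℝ) • y)
      (s := (2 ^ n)⁻¹ * ‖y - z‖) hx.unit (le_add_of_nonneg_right (hsc n hz))
      (le_add_of_nonneg_right (hsc n hy)) (by positivity)
      (hx.obound (by
        rw [add_sub_add_left_eq_sub, ← smul_sub, hnsc, norm_sub_rev]))
    have h2 := hu.norm_le (by positivity) h1
    calc (2 ^ n : ℝ) * _ ≤ 2 ^ n * ((2 ^ n)⁻¹ * ‖y - z‖) :=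
          mul_le_mul_of_nonneg_left h2 (by positivity)
      _ = ‖y - z‖ := by rw [← mul_assoc, mul_inv_cancel₀ (by positivity), one_mul]
  -- The points `y`, `y + z`, `y + 2z` are equally spaced. At scale `2⁻ⁿ` the midpoint error is
  -- `O(4⁻ⁿ)`, so after multiplication by `2ⁿ` it still tends to zero.
  have hjensen : ∀ y z, 0 ≤ y → 0 ≤ z →
      T (y + z) - (2⁻¹ : ℝ) • (T y + T (y + (2 : ℝ) • z)) = 0 := by
    intro y z hy hz
    have hz2 : 0 ≤ (2 : ℝ) • z := _root_.smul_nonneg (by norm_num) hz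
    have hlim := ((hT (y + z) (add_nonneg hy hz)).sub
      (((hT y hy).add (hT (y + (2 : ℝ) • z) (add_nonneg hy hz2))).const_smul (2⁻¹ : ℝ))).norm
    have hlim0 : Tendsto (fun n : ℕ => 8 * ‖(2 : ℝ) • z‖ ^ 2 / 2 ^ n) atTop (𝓝 0) :=
      tendsto_const_nhds.div_atTop (tendsto_pow_atTop_atTop_of_one_lt one_lt_two)
    refine norm_le_zero_iff.mp (le_of_tendsto_of_tendsto' hlim hlim0 fun n => ?_)
    set a : V := x + ((2 ^ n)⁻¹ : ℝ) • y with ha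
    set k : V := ((2 ^ n)⁻¹ : ℝ) • ((2 : ℝ) • z) with hk
    have hxa : x ≤ a := le_add_of_nonneg_right (hsc n hy)
    have hk0 : 0 ≤ k := hsc n hz2
    have hm := h.midpoint_le (a := a) (b := a + k) (l := ‖k‖) (hx.unit.of_le hxa)
      (le_add_of_nonneg_right hk0)
      (by
        rw [add_smul, one_smul]
        refine add_le_add_right ((hx.le_norm_smul k).trans ?_) a
        exact smul_le_smul_of_nonneg_left hxa (norm_nonneg _)) (norm_nonneg _)
    have hm' := hu.norm_le (by positivity) (hm.change (c := 1)
      (by rw [one_smul]; exact h.antitone hx.unit hxa) (by positivity) hu.unit.nonneg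
      (le_of_eq (mul_one _)))
    have e1 : (2⁻¹ : ℝ) • (a + (a + k)) = x + ((2 ^ n)⁻¹ : ℝ) • (y + z) := by
      have : a + (a + k) = (2 : ℝ) • (x + ((2 ^ n)⁻¹ : ℝ) • (y + z)) := by
        rw [ha, hk, smul_comm _ (2 : ℝ) z, two_smul, two_smul, smul_add]; abel
      rw [this, smul_smul]; norm_num
    have e2 : a + k = x + ((2 ^ n)⁻¹ : ℝ) • (y + (2 : ℝ) • z) := by
      rw [ha, hk, smul_add, add_assoc]
    rw [e1, e2] at hm'
    have e3 : (2 ^ n : ℝ) • (Φ x - Φ (x + ((2 ^ n)⁻¹ : ℝ) • (y + z))) -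
        (2⁻¹ : ℝ) • ((2 ^ n : ℝ) • (Φ x - Φ (x + ((2 ^ n)⁻¹ : ℝ) • y)) +
          (2 ^ n : ℝ) • (Φ x - Φ (x + ((2 ^ n)⁻¹ : ℝ) • (y + (2 : ℝ) • z)))) =
        -((2 ^ n : ℝ) • (Φ (x + ((2 ^ n)⁻¹ : ℝ) • (y + z)) -
          (2⁻¹ : ℝ) • (Φ a + Φ (x + ((2 ^ n)⁻¹ : ℝ) • (y + (2 : ℝ) • z))))) := by
      rw [← ha]; module
    rw [e3, norm_neg, norm_smul, Real.norm_of_nonneg (by positivity)]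
    refine (mul_le_mul_of_nonneg_left hm' (by positivity)).trans (le_of_eq ?_)
    rw [hk, hnsc]
    field_simp
  have hT0 : T 0 = 0 := by
    refine tendsto_nhds_unique (hT 0 le_rfl) ?_
    simp
  have hdouble : ∀ z, 0 ≤ z → T ((2 : ℝ) • z) = (2 : ℝ) • T z := by
    intro z hz
    have := hjensen 0 z le_rfl hz
    rw [hT0, zero_add, zero_add, zero_add, sub_eq_zero] at this
    rw [this, smul_smul]; norm_num
  have hstep : ∀ y z, 0 ≤ y → 0 ≤ z → T (y + (2 : ℝ) • z) - T y = (2 : ℝ) • (T (y + z) - T y) := by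
    intro y z hy hz
    rw [sub_eq_zero.mp (hjensen y z hy hz)]
    module
  have hpos2 : ∀ (n : ℕ) {z : V}, 0 ≤ z → 0 ≤ (2 ^ n : ℝ) • z := fun n z hz =>
    _root_.smul_nonneg (by positivity) hz
  have hpow : ∀ n : ℕ, ∀ z, 0 ≤ z → T ((2 ^ n : ℝ) • z) = (2 ^ n : ℝ) • T z := by
    intro n
    induction n with
    | zero => intro z _; simp
    | succ n ih =>
      intro z hz
      rw [pow_succ', mul_smul, hdouble _ (hpos2 n hz), ih z hz, mul_smul]
  have hpow' : ∀ n : ℕ, ∀ y z, 0 ≤ y → 0 ≤ z →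
      T (y + (2 ^ n : ℝ) • z) - T y = (2 ^ n : ℝ) • (T (y + z) - T y) := by
    intro n
    induction n with
    | zero => intro y z _ _; simp
    | succ n ih =>
      intro y z hy hz
      rw [pow_succ', mul_smul, hstep _ _ hy (hpos2 n hz), ih y z hy hz, mul_smul]
  -- Scaling turns `T (y + z) - T y` into `T (2⁻ⁿ y + z) - 2⁻ⁿ T y`, which tends to `T z` because
  -- `T` is nonexpansive.
  have hadd : ∀ y z, 0 ≤ y → 0 ≤ z → T (y + z) = T y + T z := by
    intro y z hy hz
    have : T (y + z) - T y - T z = 0 := by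
      refine eq_zero_of_forall_norm_le_geometric (C := ‖y‖ + ‖T y‖) fun n => ?_
      have h1 := hpow' n y z hy hz
      have e : y + (2 ^ n : ℝ) • z = (2 ^ n : ℝ) • (((2 ^ n)⁻¹ : ℝ) • y + z) := by
        rw [smul_add, smul_smul, mul_inv_cancel₀ (by positivity), one_smul]
      rw [e, hpow n _ (add_nonneg (hsc n hy) hz)] at h1
      have h2 : T (y + z) - T y = T (((2 ^ n)⁻¹ : ℝ) • y + z) - ((2 ^ n)⁻¹ : ℝ) • T y := by
        have := congrArg (fun w => ((2 ^ n)⁻¹ : ℝ) • w) h1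
        simp only [smul_sub, smul_smul] at this
        rw [inv_mul_cancel₀ (by positivity), one_smul, one_smul, one_smul] at this
        exact this.symm
      rw [h2, sub_right_comm]
      have h3 := hlip _ z (add_nonneg (hsc n hy) hz) hz
      rw [add_sub_cancel_right, hnsc] at h3
      refine (norm_sub_le _ _).trans ?_
      rw [norm_smul, Real.norm_of_nonneg (by positivity), add_div, div_eq_inv_mul, div_eq_inv_mul]
      linarith
    rw [sub_sub, sub_eq_zero] at this
    exact this
  obtain ⟨L, hL1, hL2⟩ := exists_extension_of_cone hx T hadd hlip
  have hcl := hu.orderClosedTopology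
  refine ⟨L, ?_, fun y hy => ?_, hL2, fun y hy => by rw [hL1 y hy]; exact hest y hy⟩
  · rw [hL1 x hx.unit.nonneg]
    refine tendsto_nhds_unique (hT x hx.unit.nonneg) ?_
    have e : ∀ n : ℕ, (2 ^ n : ℝ) • (Φ x - Φ (x + ((2 ^ n)⁻¹ : ℝ) • x)) =
        (1 + 1 / 2 ^ n : ℝ)⁻¹ • Φ x := by
      intro n
      have : x + ((2 ^ n)⁻¹ : ℝ) • x = (1 + 1 / 2 ^ n : ℝ) • x := by
        rw [add_smul, one_smul, one_div]
      rw [this, h.map_smul hx.unit (by positivity)]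
      match_scalars
      field_simp
      ring
    simp only [e]
    have h1 : Tendsto (fun n : ℕ => (1 / 2 ^ n : ℝ)) atTop (𝓝 0) :=
      tendsto_const_nhds.div_atTop (tendsto_pow_atTop_atTop_of_one_lt one_lt_two)
    have h2 := ((h1.const_add 1).inv₀ (by norm_num)).smul_const (Φ x)
    simpa using h2
  · rw [hL1 y hy]
    refine ge_of_tendsto' (hT y hy) fun n => ?_
    refine _root_.smul_nonneg (by positivity) (sub_nonneg.mpr ?_)
    exact h.antitone hx.unit (le_add_of_nonneg_right (hsc n hy))

/-- Homogeneity reduces an arbitrary direction to a positive one: `x + k = c (x + y)` with `c = 1 -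
‖k‖` and `y ≥ 0`. The three error terms add up to less than `309 ‖k‖²`; 400 is a round bound. -/
theorem exists_taylor_normed (h : GaugeReversing Φ Ψ) (hx : IsUnitNorm x)
    (hu : IsUnitNorm (Φ x)) :
    ∃ T : V →L[ℝ] W, T x = Φ x ∧ (∀ y, 0 ≤ y → 0 ≤ T y) ∧
      ∀ k, ‖k‖ ≤ 1 / 4 → ‖Φ (x + k) - Φ x + T k‖ ≤ 400 * ‖k‖ ^ 2 := by
  obtain ⟨T, hTx, hTpos, hTn, hest⟩ := h.exists_derivative_normed hx hu
  refine ⟨T, hTx, hTpos, fun k hk => ?_⟩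
  set l := ‖k‖ with hl
  have hl0 : 0 ≤ l := norm_nonneg k
  set c := 1 - l with hc
  have hc0 : 3 / 4 ≤ c := by linarith
  have hcpos : 0 < c := by linarith
  set y : V := c⁻¹ • (k + l • x) with hy
  have hkl : 0 ≤ k + l • x := by
    have := (hx.obound (le_refl ‖k‖)).1
    rwa [neg_le_iff_add_nonneg] at this
  have hy0 : 0 ≤ y := _root_.smul_nonneg (by positivity) hkl
  have hxk : x + k = c • (x + y) := by
    rw [hy, smul_add, smul_smul, mul_inv_cancel₀ hcpos.ne', one_smul, hc]
    module
  have hcinv : c⁻¹ ≤ 4 / 3 := by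
    rw [inv_le_comm₀ hcpos (by norm_num)]; norm_num; linarith
  have hcinv0 : 0 ≤ c⁻¹ := by positivity
  have hyn : ‖y‖ ≤ 8 / 3 * l := by
    rw [hy, norm_smul, Real.norm_of_nonneg hcinv0]
    have h1 : ‖k + l • x‖ ≤ 2 * l := by
      refine (norm_add_le _ _).trans ?_
      rw [norm_smul, Real.norm_of_nonneg hl0]
      have := mul_le_mul_of_nonneg_left hx.norm_unit_le hl0
      linarith
    calc c⁻¹ * ‖k + l • x‖ ≤ 4 / 3 * (2 * l) := mul_le_mul hcinv h1 (norm_nonneg _) (by norm_num)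
      _ = _ := by ring
  have hTy : T y = c⁻¹ • (T k + l • Φ x) := by
    rw [hy, _root_.map_smul, map_add, _root_.map_smul, hTx]
  have e : Φ (x + k) - Φ x + T k =
      -(c⁻¹ • (Φ x - Φ (x + y) - T y)) + (c⁻¹ - 1 - c⁻¹ * c⁻¹ * l) • Φ x
        + (1 - c⁻¹ * c⁻¹) • T k := by
    rw [hxk, h.map_smul (hx.unit.add hy0) hcpos, hTy]
    module
  have e1 : c⁻¹ - 1 - c⁻¹ * c⁻¹ * l = -(c⁻¹ * c⁻¹ * l ^ 2) := by
    have : l = 1 - c := by rw [hc]; ring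
    rw [this]; field_simp; ring
  have e2 : 1 - c⁻¹ * c⁻¹ = -(c⁻¹ * c⁻¹ * (2 * l - l ^ 2)) := by
    have : l = 1 - c := by rw [hc]; ring
    rw [this]; field_simp; ring
  have hcc : c⁻¹ * c⁻¹ ≤ 16 / 9 := by nlinarith
  have hcc0 : 0 ≤ c⁻¹ * c⁻¹ := by positivity
  have hl2 : 0 ≤ 2 * l - l ^ 2 := by nlinarith
  have n1 : ‖c⁻¹ • (Φ x - Φ (x + y) - T y)‖ ≤ 4 / 3 * (32 * (8 / 3 * l) ^ 2) := by
    rw [norm_smul, Real.norm_of_nonneg hcinv0]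
    refine mul_le_mul hcinv ((hest y hy0).trans ?_) (norm_nonneg _) (by norm_num)
    have := pow_le_pow_left₀ (norm_nonneg y) hyn 2
    linarith
  have n2 : ‖(c⁻¹ - 1 - c⁻¹ * c⁻¹ * l) • Φ x‖ ≤ 16 / 9 * l ^ 2 * 1 := by
    rw [e1, norm_smul, norm_neg, Real.norm_of_nonneg (by positivity)]
    exact mul_le_mul (mul_le_mul_of_nonneg_right hcc (by positivity)) hu.norm_unit_le
      (norm_nonneg _) (by positivity)
  have n3 : ‖(1 - c⁻¹ * c⁻¹) • T k‖ ≤ 16 / 9 * (2 * l) * l := by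
    rw [e2, norm_smul, norm_neg, Real.norm_of_nonneg (by positivity)]
    refine mul_le_mul (mul_le_mul hcc (by nlinarith) hl2 (by norm_num)) (hTn k)
      (norm_nonneg _) (by positivity)
  rw [e]
  refine (norm_add_le _ _).trans ?_
  refine (add_le_add_left (norm_add_le _ _) _).trans ?_
  rw [norm_neg]
  nlinarith

end GaugeReversing
end Normed

variable {V W : Type*} [AddCommGroup V] [PartialOrder V] [IsOrderedAddMonoid V] [Module ℝ V]
  [IsOrderedModule ℝ V] [CompleteOrder V] [AddCommGroup W] [PartialOrder W]
  [IsOrderedAddMonoid W] [Module ℝ W] [IsOrderedModule ℝ W] [CompleteOrder W]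
  {Φ : V → W} {Ψ : W → V} {x : V}

theorem GaugeReversing.exists_taylor (h : GaugeReversing Φ Ψ) (hx : IsUnitElt x) :
    ∃ T : V →ₗ[ℝ] W, T x = Φ x ∧ (∀ y, 0 ≤ y → 0 ≤ T y) ∧
      ∀ (k : V) (l : ℝ), 0 ≤ l → l ≤ 1 / 4 → OBound x l k →
        OBound (Φ x) (400 * l ^ 2) (Φ (x + k) - Φ x + T k) := by
  have hu := h.map_unit hx
  have hxn := isUnitNorm_unitNormed x hx
  have hun := isUnitNorm_unitNormed (Φ x) hu
  let _ := unitNormed x hx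
  let _ := unitNormedSpace x hx
  let _ := unitNormed (Φ x) hu
  let _ := unitNormedSpace (Φ x) hu
  obtain ⟨T, h1, h2, h3⟩ := h.exists_taylor_normed hxn hun
  refine ⟨T.toLinearMap, h1, h2, fun k l hl hl4 hk => ?_⟩
  have hkl := hxn.norm_le hl hk
  exact hun.obound ((h3 k (hkl.trans hl4)).trans
    (mul_le_mul_of_nonneg_left (pow_le_pow_left₀ (norm_nonneg _) hkl 2) (by norm_num)))

/-- `T` is minus the derivative of `Φ` at `x`, with a quantitative error term. -/
structure IsTaylorMap (Φ : V → W) (x : V) (T : V →ₗ[ℝ] W) : Prop where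
  map_self : T x = Φ x
  map_nonneg : ∀ y, 0 ≤ y → 0 ≤ T y
  estimate : ∀ (k : V) (l : ℝ), 0 ≤ l → l ≤ 1 / 4 → OBound x l k →
    OBound (Φ x) (400 * l ^ 2) (Φ (x + k) - Φ x + T k)

open Classical in
/-- Minus the derivative of `Φ` at `x`, or `0` if there is none. -/
def taylorMap (Φ : V → W) (x : V) : V →ₗ[ℝ] W :=
  if h : ∃ T : V →ₗ[ℝ] W, IsTaylorMap Φ x T then h.choose else 0

theorem GaugeReversing.isTaylorMap_taylorMap (h : GaugeReversing Φ Ψ) (hx : IsUnitElt x) :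
    IsTaylorMap Φ x (taylorMap Φ x) := by
  obtain ⟨T, h1, h2, h3⟩ := h.exists_taylor hx
  have hex : ∃ T : V →ₗ[ℝ] W, IsTaylorMap Φ x T := ⟨T, h1, h2, h3⟩
  rw [taylorMap, dif_pos hex]
  exact hex.choose_spec

end GaugeReversal

/-! ### An infinitesimal Mazur–Ulam theorem -/

namespace GaugeReversal

section MazurUlam

variable {V : Type*} [NormedAddCommGroup V] [NormedSpace ℝ V] [CompleteSpace V]

theorem hasDerivAt_exp_smul_apply (A : V →L[ℝ] V) (h : V) (t : ℝ) :
    HasDerivAt (fun s : ℝ => NormedSpace.exp (s • A) h) (A (NormedSpace.exp (t • A) h)) t := by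
  have := (hasDerivAt_exp_smul_const' (𝕂 := ℝ) A t).clm_apply (hasDerivAt_const t h)
  simpa using this

/-- An operator whose infinitesimal expansion is at most `o(t)` generates contractions. -/
theorem norm_exp_smul_apply_le {A : V →L[ℝ] V}
    (hA : ∀ η : ℝ, 0 < η → ∀ᶠ t : ℝ in 𝓝[>] 0, ∀ h : V, ‖h + t • A h‖ ≤ (1 + η * t) * ‖h‖)
    {t : ℝ} (ht : 0 ≤ t) (h : V) : ‖NormedSpace.exp (t • A) h‖ ≤ ‖h‖ := by
  set f : ℝ → V := fun s => NormedSpace.exp (s • A) h with hf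
  have hd : ∀ s, HasDerivAt f (A (f s)) s := fun s => hasDerivAt_exp_smul_apply A h s
  have hcont : Continuous f := continuous_iff_continuousAt.mpr fun s => (hd s).continuousAt
  have key : ∀ ε : ℝ, 0 < ε → ‖f t‖ ≤ ‖h‖ + ε * t := by
    intro ε hε
    -- The norm need not be differentiable along the orbit, so `‖f s‖` is fenced off from the line
    -- `‖h‖ + ε s`; `hA` makes its lower right slope nonpositive.
    refine image_norm_le_of_liminf_right_slope_norm_lt_deriv_boundary (f := f) (a := 0) (b := t)
      (f' := fun _ => 0) (B := fun s => ‖h‖ + ε * s) (B' := fun _ => ε) hcont.continuousOn ?_ ?_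
      (by fun_prop) (fun s => ?_) (fun _ _ _ => hε) ⟨ht, le_rfl⟩
    · intro s _ r hr
      refine Eventually.frequently ?_
      set N := ‖f s‖ + 1 with hN
      have hN0 : 0 < N := by positivity
      have h1 : ∀ᶠ z in 𝓝[>] s, ‖f z - f s - (z - s) • A (f s)‖ ≤ r / 4 * ‖z - s‖ :=
        ((hasDerivAt_iff_isLittleO.mp (hd s)).def (by positivity : 0 < r / 4)).filter_mono
          nhdsWithin_le_nhds
      have hsub : Tendsto (fun z : ℝ => z - s) (𝓝[>] s) (𝓝[>] 0) := by
        refine tendsto_nhdsWithin_iff.mpr ⟨?_, ?_⟩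
        · have : Tendsto (fun z : ℝ => z - s) (𝓝 s) (𝓝 (s - s)) :=
            (continuous_id.sub continuous_const).tendsto s
          rw [sub_self] at this
          exact this.mono_left nhdsWithin_le_nhds
        · filter_upwards [self_mem_nhdsWithin] with z hz
          exact Set.mem_Ioi.mpr (sub_pos.mpr (Set.mem_Ioi.mp hz))
      have h2 := hsub.eventually (hA (r / (4 * N)) (by positivity))
      filter_upwards [h1, h2, self_mem_nhdsWithin] with z hz1 hz2 hz3
      have hzs : 0 < z - s := sub_pos.mpr hz3
      rw [slope_def_field, div_lt_iff₀ hzs]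
      have h3 := hz2 (f s)
      rw [Real.norm_of_nonneg hzs.le] at hz1
      have h4 : f z = (f s + (z - s) • A (f s)) + (f z - f s - (z - s) • A (f s)) := by abel
      have h5 : ‖f z‖ ≤ (1 + r / (4 * N) * (z - s)) * ‖f s‖ + r / 4 * (z - s) := by
        calc ‖f z‖ = ‖(f s + (z - s) • A (f s)) + (f z - f s - (z - s) • A (f s))‖ := by rw [← h4]
          _ ≤ _ := (norm_add_le _ _).trans (add_le_add h3 hz1)
      have h6 : r / (4 * N) * ‖f s‖ ≤ r / 4 := by
        have : r / (4 * N) * ‖f s‖ = r / 4 * (‖f s‖ / N) := by field_simp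
        rw [this]
        exact mul_le_of_le_one_right (by positivity) (by rw [div_le_one hN0]; linarith)
      have h7 : r / (4 * N) * ‖f s‖ * (z - s) ≤ r / 4 * (z - s) :=
        mul_le_mul_of_nonneg_right h6 hzs.le
      simp only [Function.comp_apply]
      nlinarith [mul_pos hr hzs]
    · simp [hf]
    · intro _
      simpa using (((hasDerivAt_id s).const_mul ε).const_add ‖h‖).hasDerivWithinAt (s := Set.Ici s)
  have hlim : Tendsto (fun ε : ℝ => ‖h‖ + ε * t) (𝓝[>] 0) (𝓝 ‖h‖) := by
    have : Tendsto (fun ε : ℝ => ‖h‖ + ε * t) (𝓝 0) (𝓝 (‖h‖ + 0 * t)) :=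
      (by fun_prop : Continuous fun ε : ℝ => ‖h‖ + ε * t).tendsto 0
    rw [zero_mul, add_zero] at this
    exact this.mono_left nhdsWithin_le_nhds
  exact ge_of_tendsto hlim (by filter_upwards [self_mem_nhdsWithin] with ε hε using key ε hε)

theorem norm_exp_smul_apply_sub_le {A : V →L[ℝ] V}
    (hA : ∀ (t : ℝ) (h : V), ‖NormedSpace.exp (t • A) h‖ ≤ ‖h‖) (t : ℝ) (h : V) :
    ‖NormedSpace.exp (t • A) h - h‖ ≤ ‖A‖ * ‖h‖ * |t| := by
  have := convex_univ.norm_image_sub_le_of_norm_hasDerivWithin_le (x := (0 : ℝ)) (y := t)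
    (f := fun s : ℝ => NormedSpace.exp (s • A) h) (C := ‖A‖ * ‖h‖)
    (fun s _ => (hasDerivAt_exp_smul_apply A h s).hasDerivWithinAt)
    (fun s _ => (A.le_opNorm _).trans (mul_le_mul_of_nonneg_left (hA s h) (norm_nonneg _)))
    (Set.mem_univ _) (Set.mem_univ _)
  simpa using this

/-- A Taylor bound for the orbit tested against one functional: only `φ ∘ A²` has to be small, not
`A`. -/
theorem abs_apply_exp_smul_sub_le {A : V →L[ℝ] V}
    (hA : ∀ (t : ℝ) (h : V), ‖NormedSpace.exp (t • A) h‖ ≤ ‖h‖) (φ : V →L[ℝ] ℝ) {η : ℝ}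
    (hφ : ∀ m, ‖φ (A (A m))‖ ≤ η * ‖m‖) (hη : 0 ≤ η) (t : ℝ) (h : V) :
    |φ (NormedSpace.exp (t • A) h) - φ h - t * φ (A h)| ≤ η * ‖h‖ * t ^ 2 := by
  have hd : ∀ s, HasDerivAt (fun s : ℝ => φ (NormedSpace.exp (s • A) h))
      (φ (A (NormedSpace.exp (s • A) h))) s := fun s =>
    φ.hasFDerivAt.comp_hasDerivAt s (hasDerivAt_exp_smul_apply A h s)
  have hd2 : ∀ s, HasDerivAt (fun s : ℝ => φ (A (NormedSpace.exp (s • A) h)))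
      (φ (A (A (NormedSpace.exp (s • A) h)))) s := fun s =>
    (φ.comp A).hasFDerivAt.comp_hasDerivAt s (hasDerivAt_exp_smul_apply A h s)
  have h1 : ∀ s : ℝ, ‖φ (A (NormedSpace.exp (s • A) h)) - φ (A h)‖ ≤ η * ‖h‖ * |s| := by
    intro s
    have := convex_univ.norm_image_sub_le_of_norm_hasDerivWithin_le (x := (0 : ℝ)) (y := s)
      (C := η * ‖h‖) (fun s _ => (hd2 s).hasDerivWithinAt)
      (fun s _ => (hφ _).trans (mul_le_mul_of_nonneg_left (hA s h) hη))
      (Set.mem_univ _) (Set.mem_univ _)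
    simpa using this
  have h2 := (convex_uIcc (0 : ℝ) t).norm_image_sub_le_of_norm_hasDerivWithin_le
    (f := fun s : ℝ => φ (NormedSpace.exp (s • A) h) - s * φ (A h))
    (f' := fun s : ℝ => φ (A (NormedSpace.exp (s • A) h)) - φ (A h)) (x := (0 : ℝ)) (y := t)
    (C := η * ‖h‖ * |t|)
    (fun s _ => by
      have := (hd s).fun_sub ((hasDerivAt_id s).mul_const (φ (A h)))
      simp only [id_eq, one_mul] at this
      exact this.hasDerivWithinAt)
    (fun s hs => (h1 s).trans (by
      refine mul_le_mul_of_nonneg_left ?_ (by positivity)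
      have := Set.abs_sub_left_of_mem_uIcc hs
      simpa using this))
    Set.left_mem_uIcc Set.right_mem_uIcc
  have h3 : η * ‖h‖ * |t| * ‖t - 0‖ = η * ‖h‖ * t ^ 2 := by
    rw [sub_zero, Real.norm_eq_abs, mul_assoc, ← sq, sq_abs]
  rw [h3] at h2
  convert h2 using 1
  rw [Real.norm_eq_abs]
  simp
  ring_nf

/-- A symmetric bilinear map, all of whose partial maps generate groups of isometries, vanishes: an
infinitesimal form of the Mazur–Ulam theorem. -/
theorem bilin_eq_zero_of_exp_contraction (B : V →L[ℝ] V →L[ℝ] V) (hsymm : ∀ h k, B h k = B k h)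
    (hexp : ∀ k h : V, ‖NormedSpace.exp (B k) h‖ ≤ ‖h‖) (h k : V) : B h k = 0 := by
  have hA : ∀ (k : V) (t : ℝ) (h : V), ‖NormedSpace.exp (t • B k) h‖ ≤ ‖h‖ := fun k t h => by
    rw [← map_smul]; exact hexp _ _
  suffices hdiag : ∀ h : V, B h h = 0 by
    have h1 := hdiag (h + k)
    simp only [map_add, add_apply, hdiag, zero_add, add_zero] at h1
    rw [hsymm k h, ← two_smul ℝ] at h1
    exact (smul_eq_zero.mp h1).resolve_left two_ne_zero
  set b := ‖B‖ with hb
  have hb0 : 0 ≤ b := norm_nonneg B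
  have hBb : ∀ k, ‖k‖ ≤ 1 → ‖B k‖ ≤ b := fun k hk =>
    (B.le_opNorm k).trans (mul_le_of_le_one_right hb0 hk)
  set S : Set ℝ := (fun h : V => ‖B h h‖) '' Metric.closedBall 0 1 with hS
  have hSb : BddAbove S := by
    refine ⟨b, ?_⟩
    rintro _ ⟨h, hh, rfl⟩
    have hh1 : ‖h‖ ≤ 1 := by simpa using hh
    exact ((B h).le_opNorm h).trans
      ((mul_le_mul (hBb h hh1) hh1 (norm_nonneg _) hb0).trans (by rw [mul_one]))
  have hSn : S.Nonempty := ⟨_, 0, by simp, rfl⟩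
  set β := sSup S with hβ
  have hle : ∀ h, ‖h‖ ≤ 1 → ‖B h h‖ ≤ β := fun h hh => le_csSup hSb ⟨h, by simpa using hh, rfl⟩
  -- Let `h` almost maximise `‖B h h‖` on the unit ball and let `φ` norm `B h h`. Near-maximality
  -- makes `φ ∘ (B h)²` of size `O(δ)`. So `φ (exp (t B h) h)` grows almost linearly, with speed at
  -- least `β - δ²`, although its modulus never exceeds 1.
  have main : ∀ t δ : ℝ, 0 < t → 0 < δ →
      t * (β - δ ^ 2) ≤ 2 + δ * (1 + 3 * b ^ 3) * t ^ 2 := by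
    intro t δ ht hδ
    obtain ⟨_, ⟨h, hh, rfl⟩, hhβ⟩ := exists_lt_of_lt_csSup hSn
      (show β - δ ^ 2 < sSup S by rw [← hβ]; linarith [pow_pos hδ 2])
    have hh1 : ‖h‖ ≤ 1 := by simpa using hh
    simp only at hhβ
    obtain ⟨φ, hφ1, hφ⟩ := exists_dual_vector'' ℝ (B h h)
    simp only [RCLike.ofReal_real_eq_id, id_eq] at hφ
    have hφn : ∀ v, |φ v| ≤ ‖v‖ := fun v =>
      (φ.le_opNorm v).trans (mul_le_of_le_one_left (norm_nonneg _) hφ1)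
    set η := δ * (1 + 3 * b ^ 3) with hη
    have hη0 : 0 ≤ η := by positivity
    have half : ∀ m, ‖m‖ ≤ 1 → φ (B h (B h m)) ≤ η := by
      intro m hm
      -- A competitor for `h` that stays in the unit ball. To first order `B k k` exceeds `B h h` by
      -- `2 δ B h (B m h)`, which by symmetry is `2 δ B h (B h m)`.
      set k := NormedSpace.exp (δ • B m) h with hk
      have hkn : ‖k‖ ≤ 1 := (hA m δ h).trans hh1
      have e : B k k = B h h + (2 : ℝ) • B h (k - h) + B (k - h) (k - h) := by
        rw [two_smul]
        simp only [map_sub, sub_apply]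
        rw [hsymm k h]; abel
      have h1 : |φ (B h k) - φ (B h h) - δ * φ (B h (B m h))| ≤ b ^ 3 * δ ^ 2 := by
        have := abs_apply_exp_smul_sub_le (hA m) (φ.comp (B h)) (η := b ^ 3) (fun v => by
          refine (hφn _).trans ?_
          have h1 := (B m).le_opNorm v
          have h2 := (B m).le_opNorm (B m v)
          have h3 := (B h).le_opNorm (B m (B m v))
          have hm' := hBb m hm
          have hh' := hBb h hh1
          calc ‖B h (B m (B m v))‖ ≤ b * (b * (b * ‖v‖)) := by
                refine h3.trans (mul_le_mul hh' (h2.trans (mul_le_mul hm' (h1.trans ?_)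
                  (norm_nonneg _) hb0)) (norm_nonneg _) hb0)
                exact mul_le_mul_of_nonneg_right hm' (norm_nonneg _)
            _ = b ^ 3 * ‖v‖ := by ring) (by positivity) δ h
        refine this.trans ?_
        have : b ^ 3 * ‖h‖ ≤ b ^ 3 := mul_le_of_le_one_right (by positivity) hh1
        exact mul_le_mul_of_nonneg_right this (by positivity)
      have h2 : ‖B (k - h) (k - h)‖ ≤ b ^ 3 * δ ^ 2 := by
        have h3 : ‖k - h‖ ≤ b * δ := by
          refine (norm_exp_smul_apply_sub_le (hA m) δ h).trans ?_
          rw [abs_of_pos hδ]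
          refine mul_le_mul_of_nonneg_right ?_ hδ.le
          exact (mul_le_of_le_one_right (norm_nonneg _) hh1).trans (hBb m hm)
        calc ‖B (k - h) (k - h)‖ ≤ b * ‖k - h‖ * ‖k - h‖ := B.le_opNorm₂ _ _
          _ ≤ b * (b * δ) * (b * δ) := by gcongr
          _ = _ := by ring
      have h4 : φ (B k k) ≤ β := (le_abs_self _).trans ((hφn _).trans (hle k hkn))
      rw [e] at h4
      simp only [map_add, map_smul, smul_eq_mul, map_sub] at h4
      have h5 := (abs_le.mp h1).1
      have h6 := (abs_le.mp ((hφn (B (k - h) (k - h))).trans h2)).1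
      simp only [map_sub, sub_apply] at h6
      have h7 : B m h = B h m := hsymm m h
      rw [h7] at h5
      have h8 : 2 * (δ * φ (B h (B h m))) ≤ δ ^ 2 + 3 * (b ^ 3 * δ ^ 2) := by
        rw [hφ] at h4 h5
        simp only [sub_apply, map_sub] at h4
        rw [hφ] at h4 h6
        linarith
      have h9 : δ * (2 * φ (B h (B h m))) ≤ δ * (δ * (1 + 3 * b ^ 3)) := by linarith
      have h10 := le_of_mul_le_mul_left h9 hδ
      rw [hη]
      linarith
    have habs : ∀ m, ‖φ (B h (B h m))‖ ≤ η * ‖m‖ := by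
      intro m
      rcases eq_or_ne m 0 with rfl | hm
      · simp
      have hm0 : 0 < ‖m‖ := norm_pos_iff.mpr hm
      have hn : ‖(‖m‖⁻¹ : ℝ) • m‖ ≤ 1 := by
        rw [norm_smul, norm_inv, norm_norm, inv_mul_cancel₀ hm0.ne']
      have h1 := half _ hn
      have h2 := half (-((‖m‖⁻¹ : ℝ) • m)) (by rwa [norm_neg])
      simp only [map_neg, map_smul, smul_eq_mul] at h1 h2
      rw [Real.norm_eq_abs, abs_le]
      rw [inv_mul_eq_div] at h1 h2
      rw [← neg_div, div_le_iff₀ hm0] at h2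
      rw [div_le_iff₀ hm0] at h1
      exact ⟨by linarith, h1⟩
    have h1 := abs_apply_exp_smul_sub_le (hA h) φ habs hη0 t h
    have h2 := (abs_le.mp ((hφn _).trans ((hA h t h).trans hh1))).2
    have h3 := (abs_le.mp ((hφn h).trans hh1)).1
    have h4 := (abs_le.mp h1).1
    rw [hφ] at h4
    have h5 : η * ‖h‖ * t ^ 2 ≤ η * t ^ 2 :=
      mul_le_mul_of_nonneg_right (mul_le_of_le_one_right hη0 hh1) (by positivity)
    have h6 : t * (β - δ ^ 2) ≤ t * ‖B h h‖ := mul_le_mul_of_nonneg_left hhβ.le ht.le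
    linarith
  have main2 : ∀ t : ℝ, 0 < t → t * β ≤ 2 := by
    intro t ht
    have l1 : Tendsto (fun δ : ℝ => t * (β - δ ^ 2)) (𝓝[>] 0) (𝓝 (t * (β - 0 ^ 2))) :=
      ((by fun_prop : Continuous fun δ : ℝ => t * (β - δ ^ 2)).tendsto 0).mono_left
        nhdsWithin_le_nhds
    have l2 : Tendsto (fun δ : ℝ => 2 + δ * (1 + 3 * b ^ 3) * t ^ 2) (𝓝[>] 0)
        (𝓝 (2 + 0 * (1 + 3 * b ^ 3) * t ^ 2)) :=
      ((by fun_prop : Continuous fun δ : ℝ => 2 + δ * (1 + 3 * b ^ 3) * t ^ 2).tendsto 0).mono_left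
        nhdsWithin_le_nhds
    have := le_of_tendsto_of_tendsto l1 l2 (by
      filter_upwards [self_mem_nhdsWithin] with δ hδ using main t δ ht hδ)
    simpa using this
  have hβ0 : β ≤ 0 := by
    by_contra hcon
    push Not at hcon
    have := main2 (4 / β) (by positivity)
    rw [div_mul_cancel₀ _ hcon.ne'] at this
    norm_num at this
  intro h
  rcases eq_or_ne h 0 with rfl | hh
  · simp
  have hh0 : 0 < ‖h‖ := norm_pos_iff.mpr hh
  have hn : ‖(‖h‖⁻¹ : ℝ) • h‖ ≤ 1 := by
    rw [norm_smul, norm_inv, norm_norm, inv_mul_cancel₀ hh0.ne']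
  have h1 := norm_le_zero_iff.mp ((hle _ hn).trans hβ0)
  simp only [map_smul, smul_apply, smul_smul] at h1
  exact (smul_eq_zero.mp h1).resolve_left (by positivity)

end MazurUlam
end GaugeReversal

/-! ### Quantitative differentiability in normed spaces -/

namespace GaugeReversal

section Analysis

variable {V E : Type*} [NormedAddCommGroup V] [NormedSpace ℝ V] [NormedAddCommGroup E]
  [NormedSpace ℝ E]

theorem hasFDerivAt_of_quadratic {f : V → E} {L : V →L[ℝ] E} {x : V} {r K : ℝ} (hr : 0 < r)
    (h : ∀ k, ‖k‖ ≤ r → ‖f (x + k) - f x - L k‖ ≤ K * ‖k‖ ^ 2) : HasFDerivAt f L x := by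
  rw [hasFDerivAt_iff_isLittleO_nhds_zero]
  have h1 : (fun k : V => f (x + k) - f x - L k) =O[𝓝 0] fun k => ‖k‖ ^ 2 := by
    refine Asymptotics.IsBigO.of_bound K ?_
    filter_upwards [Metric.closedBall_mem_nhds (0 : V) hr] with k hk
    rw [norm_pow, norm_norm]
    exact h k (by simpa using hk)
  refine h1.trans_isLittleO ?_
  have : (fun k : V => ‖k‖ ^ 2) =o[𝓝 0] fun k => ‖k‖ ^ 1 :=
    Asymptotics.isLittleO_norm_pow_norm_pow (by norm_num)
  simp only [pow_one] at this
  exact this.of_norm_right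

/-- A uniform quadratic Taylor estimate makes the derivative Lipschitz. -/
theorem norm_deriv_sub_le_of_quadratic {f : V → E} {f' : V → V →L[ℝ] E} {x : V} {r K : ℝ}
    (hK : 0 ≤ K)
    (h : ∀ p, ‖p - x‖ ≤ r → ∀ k, ‖k‖ ≤ r → ‖f (p + k) - f p - f' p k‖ ≤ K * ‖k‖ ^ 2)
    {p q : V} (hp : ‖p - x‖ ≤ r) (hq : ‖q - x‖ ≤ r) (hpq : 2 * ‖p - q‖ ≤ r) :
    ‖f' p - f' q‖ ≤ 6 * K * ‖p - q‖ := by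
  rcases eq_or_ne p q with rfl | hne
  · simp
  set d := p - q with hd
  have hd0 : 0 < ‖d‖ := norm_pos_iff.mpr (sub_ne_zero.mpr hne)
  -- Compare the expansions of `f` at `p` and at `q`, using `p + k = q + (d + k)`. With `‖k‖ = ‖d‖`
  -- the three errors are `1`, `4` and `1` times `K ‖d‖²`.
  have key : ∀ k, ‖k‖ = ‖d‖ → ‖(f' p - f' q) k‖ ≤ 6 * K * ‖d‖ * ‖d‖ := by
    intro k hk
    have hdk : ‖d + k‖ ≤ 2 * ‖d‖ := (norm_add_le _ _).trans (by rw [hk]; linarith)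
    have h1 := h p hp k (by linarith)
    have h2 := h q hq (d + k) (by linarith)
    have h3 := h q hq d (by linarith)
    have e1 : q + (d + k) = p + k := by rw [hd]; abel
    have e2 : q + d = p := by rw [hd]; abel
    rw [e1] at h2
    rw [e2] at h3
    have e : (f' p - f' q) k = -(f (p + k) - f p - f' p k) + (f (p + k) - f q - f' q (d + k))
        - (f p - f q - f' q d) := by
      rw [sub_apply, map_add]; abel
    rw [e]
    refine (norm_sub_le _ _).trans ((add_le_add_left (norm_add_le _ _) _).trans ?_)
    rw [norm_neg]
    have h4 : K * ‖d + k‖ ^ 2 ≤ K * (2 * ‖d‖) ^ 2 :=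
      mul_le_mul_of_nonneg_left (pow_le_pow_left₀ (norm_nonneg _) hdk 2) hK
    rw [hk] at h1
    nlinarith
  refine ContinuousLinearMap.opNorm_le_bound _ (by positivity) fun k => ?_
  rcases eq_or_ne k 0 with rfl | hk
  · simp
  have hk0 : 0 < ‖k‖ := norm_pos_iff.mpr hk
  have h1 := key ((‖d‖ / ‖k‖) • k) (by
    rw [norm_smul, Real.norm_of_nonneg (by positivity), div_mul_cancel₀ _ hk0.ne'])
  rw [map_smul, norm_smul, Real.norm_of_nonneg (by positivity), div_mul_eq_mul_div,
    div_le_iff₀ hk0] at h1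
  have h2 : ‖d‖ * ‖(f' p - f' q) k‖ ≤ ‖d‖ * (6 * K * ‖d‖ * ‖k‖) := by linarith
  exact le_of_mul_le_mul_left h2 hd0

/-- A Lipschitz map that is additive up to a quadratic error has a linear approximation. -/
theorem exists_linear_of_almost_additive [CompleteSpace E] {φ : V → E} {r K M : ℝ} (hr : 0 < r)
    (hK : 0 ≤ K)
    (hadd : ∀ (h k : V) (ρ : ℝ), ρ ≤ r → ‖h‖ ≤ ρ → ‖k‖ ≤ ρ →
      ‖φ (h + k) - φ h - φ k‖ ≤ K * ρ ^ 2)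
    (hlip : ∀ h, ‖h‖ ≤ r → ‖φ h‖ ≤ M * ‖h‖) :
    ∃ L : V →L[ℝ] E, ∀ h, ‖h‖ ≤ r → ‖φ h - L h‖ ≤ K * ‖h‖ ^ 2 := by
  have hnsc : ∀ (n : ℕ) (y : V), ‖((2 ^ n)⁻¹ : ℝ) • y‖ = (2 ^ n)⁻¹ * ‖y‖ := fun n y => by
    rw [norm_smul, Real.norm_of_nonneg (by positivity)]
  set s : V → ℕ → E := fun h n => (2 ^ n : ℝ) • φ (((2 ^ n)⁻¹ : ℝ) • h) with hs
  have hstep : ∀ h, ‖h‖ ≤ r → ∀ n, dist (s h n) (s h (n + 1)) ≤ K * ‖h‖ ^ 2 / 2 / 2 ^ n := by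
    intro h hh n
    set k : V := ((2 ^ (n + 1))⁻¹ : ℝ) • h with hk
    have hkk : k + k = ((2 ^ n)⁻¹ : ℝ) • h := by
      rw [hk, ← two_smul ℝ, smul_smul, pow_succ]; congr 1; field_simp
    have hkn : ‖k‖ ≤ r := by
      rw [hk, hnsc]
      refine (mul_le_of_le_one_left (norm_nonneg _) ?_).trans hh
      exact inv_le_one_of_one_le₀ (one_le_pow₀ (by norm_num))
    have h1 := hadd k k ‖k‖ hkn le_rfl le_rfl
    rw [hkk] at h1
    have e : s h n - s h (n + 1) = (2 ^ n : ℝ) • (φ (((2 ^ n)⁻¹ : ℝ) • h) - φ k - φ k) := by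
      have e1 : s h (n + 1) = (2 ^ n * 2 : ℝ) • φ k := by rw [← pow_succ]
      have e0 : s h n = (2 ^ n : ℝ) • φ (((2 ^ n)⁻¹ : ℝ) • h) := rfl
      rw [e1, e0]; module
    rw [dist_eq_norm, e, norm_smul, Real.norm_of_nonneg (by positivity)]
    refine (mul_le_mul_of_nonneg_left h1 (by positivity)).trans ?_
    rw [hk, hnsc]
    have : (2 ^ n : ℝ) * (K * (((2 : ℝ) ^ (n + 1))⁻¹ * ‖h‖) ^ 2) =
        K * ‖h‖ ^ 2 / 2 ^ n / 4 := by field_simp; ring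
    rw [this, div_right_comm (K * ‖h‖ ^ 2) 2]
    have h0 : 0 ≤ K * ‖h‖ ^ 2 / 2 ^ n := by positivity
    linarith
  have hlocal : ∀ h, ‖h‖ ≤ r → ∃ t, Tendsto (s h) atTop (𝓝 t) := fun h hh =>
    cauchySeq_tendsto_of_complete (cauchySeq_of_le_geometric_two (hstep h hh))
  have hsmall : ∀ h : V, ∀ᶠ n : ℕ in atTop, ‖((2 ^ n)⁻¹ : ℝ) • h‖ ≤ r := by
    intro h
    have : Tendsto (fun n : ℕ => ‖h‖ / 2 ^ n) atTop (𝓝 0) :=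
      tendsto_const_nhds.div_atTop (tendsto_pow_atTop_atTop_of_one_lt one_lt_two)
    filter_upwards [this.eventually (eventually_le_nhds hr)] with n hn
    rwa [hnsc, inv_mul_eq_div]
  have hglob : ∀ h, ∃ t, Tendsto (s h) atTop (𝓝 t) := by
    intro h
    obtain ⟨N, hN⟩ := (hsmall h).exists
    obtain ⟨t, ht⟩ := hlocal _ hN
    refine ⟨(2 ^ N : ℝ) • t, (tendsto_add_atTop_iff_nat N).mp ?_⟩
    refine (ht.const_smul (2 ^ N : ℝ)).congr fun n => ?_
    simp only [hs, smul_smul, pow_add, mul_inv]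
    rw [mul_comm (2 ^ N : ℝ)]
  choose L hL using hglob
  have hLadd : ∀ h k, L (h + k) = L h + L k := by
    intro h k
    have hlim := (((hL (h + k)).sub (hL h)).sub (hL k)).norm
    set C := max ‖h‖ ‖k‖ with hC
    have hlim0 : Tendsto (fun n : ℕ => K * C ^ 2 / 2 ^ n) atTop (𝓝 0) :=
      tendsto_const_nhds.div_atTop (tendsto_pow_atTop_atTop_of_one_lt one_lt_two)
    have hle : ‖L (h + k) - L h - L k‖ ≤ 0 := by
      refine le_of_tendsto_of_tendsto hlim hlim0 ?_
      filter_upwards [hsmall h, hsmall k] with n hn1 hn2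
      rw [hnsc] at hn1 hn2
      have hCn : (2 ^ n : ℝ)⁻¹ * C ≤ r := by
        rw [hC, mul_max_of_nonneg _ _ (by positivity)]; exact max_le hn1 hn2
      have h1 := hadd (((2 ^ n)⁻¹ : ℝ) • h) (((2 ^ n)⁻¹ : ℝ) • k) _ hCn
        (by rw [hnsc]; exact mul_le_mul_of_nonneg_left (le_max_left _ _) (by positivity))
        (by rw [hnsc]; exact mul_le_mul_of_nonneg_left (le_max_right _ _) (by positivity))
      have e : s (h + k) n - s h n - s k n = (2 ^ n : ℝ) •
          (φ (((2 ^ n)⁻¹ : ℝ) • h + ((2 ^ n)⁻¹ : ℝ) • k) - φ (((2 ^ n)⁻¹ : ℝ) • h)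
            - φ (((2 ^ n)⁻¹ : ℝ) • k)) := by
        simp only [hs, smul_add, smul_sub]
      rw [e, norm_smul, Real.norm_of_nonneg (by positivity)]
      refine (mul_le_mul_of_nonneg_left h1 (by positivity)).trans (le_of_eq ?_)
      field_simp
    have := norm_le_zero_iff.mp hle
    rwa [sub_sub, sub_eq_zero] at this
  have hLn : ∀ h, ‖L h‖ ≤ M * ‖h‖ := by
    intro h
    refine le_of_tendsto (hL h).norm ?_
    filter_upwards [hsmall h] with n hn
    simp only [hs]
    rw [norm_smul, Real.norm_of_nonneg (by positivity)]
    refine (mul_le_mul_of_nonneg_left (hlip _ hn) (by positivity)).trans (le_of_eq ?_)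
    rw [hnsc]; field_simp
  let A : V →+ E := AddMonoidHom.mk' L hLadd
  refine ⟨A.toRealLinearMap (AddMonoidHomClass.continuous_of_bound A M hLn), fun h hh => ?_⟩
  have := dist_le_of_le_geometric_two_of_tendsto₀ (hstep h hh) (hL h)
  rw [dist_eq_norm] at this
  have e : s h 0 = φ h := by simp [hs]
  rw [e] at this
  exact this

end Analysis

/-! ### Fréchet derivatives in fixed norms -/

section Taylor

variable {V W : Type*} [NormedAddCommGroup V] [NormedSpace ℝ V] [PartialOrder V]
  [IsOrderedAddMonoid V] [IsOrderedModule ℝ V] [CompleteOrder V]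
  [NormedAddCommGroup W] [NormedSpace ℝ W] [PartialOrder W]
  [IsOrderedAddMonoid W] [IsOrderedModule ℝ W] [CompleteOrder W]

/-- Transfers the intrinsic estimate at `x` and `Φ x` to one fixed pair of norms; `c` and `d` are
the comparison constants, whence the factor `c² |d|`. -/
theorem IsTaylorMap.fderiv_spec {Φ : V → W} {x : V} {T : V →ₗ[ℝ] W} (hT : IsTaylorMap Φ x T) {e : V}
    {f : W} (he : IsUnitNorm e) (hf : IsUnitNorm f)
    (hx : IsUnitElt x) {c d : ℝ} (hc : 0 < c) (hec : e ≤ c • x) (hd : Φ x ≤ d • f) :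
    HasFDerivAt Φ (fderiv ℝ Φ x) x ∧ (∀ y, fderiv ℝ Φ x y = -T y) ∧
      ∀ k, c * ‖k‖ ≤ 1 / 4 →
        ‖Φ (x + k) - Φ x - fderiv ℝ Φ x k‖ ≤ 400 * c ^ 2 * |d| * ‖k‖ ^ 2 := by
  have hbd : ∀ k : V, OBound x (c * ‖k‖) k := fun k =>
    (he.obound (le_refl ‖k‖)).change hec (norm_nonneg k) hx.nonneg (le_of_eq (mul_comm _ _))
  have hd' : Φ x ≤ |d| • f :=
    hd.trans (smul_le_smul_of_nonneg_right (le_abs_self d) hf.unit.nonneg)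
  have hTn : ∀ k, ‖T k‖ ≤ c * |d| * ‖k‖ := by
    intro k
    have h1 : OBound (Φ x) (c * ‖k‖) (T k) := by
      obtain ⟨h1, h2⟩ := hbd k
      constructor
      · have := hT.map_nonneg _ (sub_nonneg.mpr h1)
        rw [map_sub, map_neg, _root_.map_smul, hT.map_self, sub_nonneg] at this
        exact this
      · have := hT.map_nonneg _ (sub_nonneg.mpr h2)
        rw [map_sub, _root_.map_smul, hT.map_self, sub_nonneg] at this
        exact this
    refine hf.norm_le (by positivity) (h1.change hd' (by positivity) hf.unit.nonneg ?_)
    apply le_of_eq; ring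
  set L : V →L[ℝ] W := T.mkContinuous _ hTn with hL
  have hest : ∀ k, c * ‖k‖ ≤ 1 / 4 →
      ‖Φ (x + k) - Φ x - (-L) k‖ ≤ 400 * c ^ 2 * |d| * ‖k‖ ^ 2 := by
    intro k hk
    have h1 := hT.estimate k (c * ‖k‖) (by positivity) hk (hbd k)
    have h2 := hf.norm_le (t := 400 * c ^ 2 * |d| * ‖k‖ ^ 2) (by positivity)
      (h1.change hd' (by positivity) hf.unit.nonneg (by apply le_of_eq; ring))
    rw [neg_apply, sub_neg_eq_add]
    exact h2
  have hder : HasFDerivAt Φ (-L) x := by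
    refine hasFDerivAt_of_quadratic (r := 1 / (4 * c)) (by positivity) fun k hk => hest k ?_
    rw [le_div_iff₀ (by positivity)] at hk
    linarith
  rw [hder.fderiv]
  exact ⟨hder, fun y => by rw [neg_apply]; rfl, hest⟩

namespace GaugeReversing

variable {Φ : V → W} {Ψ : W → V} {e : V} {f : W} {x : V}

theorem fderiv_spec (h : GaugeReversing Φ Ψ) (he : IsUnitNorm e) (hf : IsUnitNorm f)
    (hx : IsUnitElt x) {c d : ℝ} (hc : 0 < c) (hec : e ≤ c • x) (hd : Φ x ≤ d • f) :
    HasFDerivAt Φ (fderiv ℝ Φ x) x ∧ fderiv ℝ Φ x x = -Φ x ∧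
      (∀ y, 0 ≤ y → fderiv ℝ Φ x y ≤ 0) ∧
      ∀ k, c * ‖k‖ ≤ 1 / 4 →
        ‖Φ (x + k) - Φ x - fderiv ℝ Φ x k‖ ≤ 400 * c ^ 2 * |d| * ‖k‖ ^ 2 := by
  have hT := h.isTaylorMap_taylorMap hx
  obtain ⟨h1, h2, h3⟩ := hT.fderiv_spec he hf hx hc hec hd
  exact ⟨h1, by rw [h2, hT.map_self], fun y hy => by
    rw [h2]; exact neg_nonpos.mpr (hT.map_nonneg y hy), h3⟩

theorem fderiv_apply (h : GaugeReversing Φ Ψ) (he : IsUnitNorm e) (hf : IsUnitNorm f)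
    (hx : IsUnitElt x) (y : V) : fderiv ℝ Φ x y = -taylorMap Φ x y := by
  obtain ⟨c, hc, hec⟩ := hx e
  obtain ⟨d, hd, hfd⟩ := hf.unit (Φ x)
  exact ((h.isTaylorMap_taylorMap hx).fderiv_spec he hf hx hc hec hfd).2.1 y

theorem hasFDerivAt (h : GaugeReversing Φ Ψ) (he : IsUnitNorm e) (hf : IsUnitNorm f)
    (hx : IsUnitElt x) : HasFDerivAt Φ (fderiv ℝ Φ x) x := by
  obtain ⟨c, hc, hec⟩ := hx e
  obtain ⟨d, hd, hfd⟩ := hf.unit (Φ x)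
  exact (h.fderiv_spec he hf hx hc hec hfd).1

theorem fderiv_self (h : GaugeReversing Φ Ψ) (he : IsUnitNorm e) (hf : IsUnitNorm f)
    (hx : IsUnitElt x) : fderiv ℝ Φ x x = -Φ x := by
  obtain ⟨c, hc, hec⟩ := hx e
  obtain ⟨d, hd, hfd⟩ := hf.unit (Φ x)
  exact (h.fderiv_spec he hf hx hc hec hfd).2.1

theorem fderiv_nonpos (h : GaugeReversing Φ Ψ) (he : IsUnitNorm e) (hf : IsUnitNorm f)
    (hx : IsUnitElt x) {y : V} (hy : 0 ≤ y) : fderiv ℝ Φ x y ≤ 0 := by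
  obtain ⟨c, hc, hec⟩ := hx e
  obtain ⟨d, hd, hfd⟩ := hf.unit (Φ x)
  exact (h.fderiv_spec he hf hx hc hec hfd).2.2.1 y hy

end GaugeReversing

theorem IsUnitNorm.isUnitElt_of_norm_lt {e p : V} (he : IsUnitNorm e) {c : ℝ} (hc : c < 1)
    (hp : ‖p - e‖ ≤ c) : IsUnitElt p := by
  have h1 := (he.obound hp).1
  have h2 : (1 - c) • e ≤ p := by
    rw [sub_smul, one_smul]
    have := add_le_add_left h1 e
    rw [sub_add_cancel] at this
    rwa [sub_eq_neg_add]
  exact (he.unit.smul (by linarith)).of_le h2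

theorem IsUnitNorm.isOpen_units {e : V} (he : IsUnitNorm e) : IsOpen {p : V | IsUnitElt p} := by
  rw [Metric.isOpen_iff]
  intro p hp
  obtain ⟨c, hc, hec⟩ := hp e
  refine ⟨c⁻¹ / 2, by positivity, fun q hq => ?_⟩
  rw [Metric.mem_ball, dist_eq_norm] at hq
  have h1 := (he.obound hq.le).1
  have h2 : c⁻¹ • e ≤ p := by
    rw [← smul_le_smul_iff_pos hc, smul_smul, mul_inv_cancel₀ hc.ne', one_smul]; exact hec
  have h3 : (c⁻¹ / 2) • e ≤ q := by
    have := add_le_add h2 h1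
    have e1 : p + (q - p) = q := by abel
    rw [e1] at this
    refine le_trans (le_of_eq ?_) this
    module
  exact (he.unit.smul (by positivity)).of_le h3

end Taylor
end GaugeReversal

/-! ### Compositions, and involutivity near a fixed point -/

namespace GaugeReversal

namespace GaugeReversing

section Comp

variable {V W X : Type*} [AddCommGroup V] [PartialOrder V] [IsOrderedAddMonoid V] [Module ℝ V]
  [IsOrderedModule ℝ V] [CompleteOrder V] [AddCommGroup W] [PartialOrder W]
  [IsOrderedAddMonoid W] [Module ℝ W] [IsOrderedModule ℝ W] [CompleteOrder W]
  [AddCommGroup X] [PartialOrder X]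
  [IsOrderedAddMonoid X] [Module ℝ X] [IsOrderedModule ℝ X] [CompleteOrder X]

theorem comp_linear {Φ : V → W} {Ψ : W → V} (h : GaugeReversing Φ Ψ) (A : W →ₗ[ℝ] X)
    (B : X →ₗ[ℝ] W) (hAB : ∀ y, A (B y) = y) (hBA : ∀ y, B (A y) = y)
    (hA : ∀ y, 0 ≤ y → 0 ≤ A y) (hB : ∀ y, 0 ≤ y → 0 ≤ B y) :
    GaugeReversing (fun x => A (Φ x)) (fun y => Ψ (B y)) := by
  have hAm : ∀ {a b}, a ≤ b → A a ≤ A b := fun {a b} hab => by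
    have := hA _ (sub_nonneg.mpr hab); rwa [map_sub, sub_nonneg] at this
  have hBm : ∀ {a b}, a ≤ b → B a ≤ B b := fun {a b} hab => by
    have := hB _ (sub_nonneg.mpr hab); rwa [map_sub, sub_nonneg] at this
  have hAu : ∀ {w}, IsUnitElt w → IsUnitElt (A w) := fun {w} hw y => by
    obtain ⟨t, ht, hy⟩ := hw (B y)
    refine ⟨t, ht, ?_⟩
    have := hAm hy
    rwa [hAB, _root_.map_smul] at this
  have hBu : ∀ {w}, IsUnitElt w → IsUnitElt (B w) := fun {w} hw y => by
    obtain ⟨t, ht, hy⟩ := hw (A y)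
    refine ⟨t, ht, ?_⟩
    have := hBm hy
    rwa [hBA, _root_.map_smul] at this
  refine ⟨fun hx => hAu (h.map_unit hx), fun hy => h.inv_unit (hBu hy), fun hx => ?_, fun hy => ?_,
    fun {x y t} hx hy ht => ?_⟩
  · rw [hBA, h.left_inv hx]
  · rw [h.right_inv (hBu hy), hAB]
  · rw [← h.smul_le_iff hx hy ht, ← _root_.map_smul]
    refine ⟨fun H => ?_, hAm⟩
    have := hBm H
    rwa [hBA, hBA] at this

/-- Three gauge reversals make one; this supplies the odd iterates of `S`. -/
theorem comp_two {S S' : V → V} (h : GaugeReversing S S') {F F' : V → V}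
    (hF : GaugeReversing F F') :
    GaugeReversing (fun x => S (S (F x))) (fun y => F' (S' (S' y))) := by
  refine ⟨fun hx => h.map_unit (h.map_unit (hF.map_unit hx)),
    fun hy => hF.inv_unit (h.inv_unit (h.inv_unit hy)), fun hx => ?_, fun hy => ?_,
    fun {x y t} hx hy ht => ?_⟩
  · rw [h.left_inv (h.map_unit (hF.map_unit hx)), h.left_inv (hF.map_unit hx), hF.left_inv hx]
  · rw [hF.right_inv (h.inv_unit (h.inv_unit hy)), h.right_inv (h.inv_unit hy), h.right_inv hy]
  · have hx' := hF.map_unit hx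
    have hy' := hF.map_unit hy
    rw [h.smul_le_iff (h.map_unit hx') (h.map_unit hy') ht, h.smul_le_iff hy' hx' ht,
      hF.smul_le_iff hx hy ht]

end Comp

section Involution

variable {V : Type*} [NormedAddCommGroup V] [NormedSpace ℝ V] [PartialOrder V]
  [IsOrderedAddMonoid V] [IsOrderedModule ℝ V] [CompleteOrder V] {e b : V} {S S' : V → V}

/-- The constant depends on `S` only through its having a fixed point near `e`, so it serves all
iterates at once. Here `e ≤ 2 p` and `S p ≤ 3 e`, and `400 * 2² * 3 = 4800`. -/
theorem taylor_near (h : GaugeReversing S S') (he : IsUnitNorm e) (hSb : S b = b)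
    (hb : ‖b - e‖ ≤ 1 / 8) {p : V} (hp : ‖p - e‖ ≤ 1 / 8) {k : V} (hk : ‖k‖ ≤ 1 / 8) :
    ‖S (p + k) - S p - fderiv ℝ S p k‖ ≤ 4800 * ‖k‖ ^ 2 := by
  have e0 := he.unit.nonneg
  have hle : ∀ {s t : ℝ}, s ≤ t → s • e ≤ t • e := fun hst => smul_le_smul_of_nonneg_right hst e0
  have hpu := he.isUnitElt_of_norm_lt (by norm_num) hp
  have hbu := he.isUnitElt_of_norm_lt (by norm_num) hb
  have hp1 : (7 / 8 : ℝ) • e ≤ p := by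
    have := add_le_add_left (he.obound hp).1 e
    rw [sub_add_cancel] at this
    refine le_trans (le_of_eq ?_) this
    module
  have hb1 : b ≤ (9 / 8 : ℝ) • e := by
    have := (he.obound hb).2
    rw [sub_le_iff_le_add] at this
    refine this.trans (le_of_eq ?_)
    module
  have hep : e ≤ (2 : ℝ) • p := by
    refine le_trans ?_ (smul_le_smul_of_nonneg_left hp1 (by norm_num : (0 : ℝ) ≤ 2))
    rw [smul_smul]
    conv_lhs => rw [← one_smul ℝ e]
    exact hle (by norm_num)
  have hbp : (1 / 2 : ℝ) • b ≤ p := by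
    refine (smul_le_smul_of_nonneg_left hb1 (by norm_num)).trans (le_trans ?_ hp1)
    rw [smul_smul]; exact hle (by norm_num)
  have hSp : S p ≤ (3 : ℝ) • e := by
    have h1 := h.antitone (hbu.smul (by norm_num)) hbp
    rw [h.map_smul hbu (by norm_num), hSb] at h1
    refine h1.trans ((smul_le_smul_of_nonneg_left hb1 (by norm_num)).trans ?_)
    rw [smul_smul]; exact hle (by norm_num)
  have := (h.fderiv_spec he he hpu (by norm_num) hep hSp).2.2.2 k (by linarith)
  refine this.trans (le_of_eq ?_)
  rw [abs_of_pos (by norm_num : (0 : ℝ) < 3)]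
  norm_num

theorem fderiv_sub_le_near (h : GaugeReversing S S') (he : IsUnitNorm e) (hSb : S b = b)
    (hb : ‖b - e‖ ≤ 1 / 8) {p q : V} (hp : ‖p - e‖ ≤ 1 / 16) (hq : ‖q - e‖ ≤ 1 / 16)
    (hpq : ‖p - q‖ ≤ 1 / 16) : ‖fderiv ℝ S p - fderiv ℝ S q‖ ≤ 28800 * ‖p - q‖ := by
  have := norm_deriv_sub_le_of_quadratic (f := S) (f' := fderiv ℝ S) (x := e) (r := 1 / 8)
    (K := 4800) (by norm_num) (fun p hp k hk => h.taylor_near he hSb hb hp hk)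
    (p := p) (q := q) (by linarith) (by linarith) (by linarith)
  refine this.trans (le_of_eq ?_)
  norm_num

/-- The Taylor error at `q` contributes `4800 * 2r` and the variation of the derivative between `q`
and `b` contributes `28800 r`, so `S` is `-1` near `b` up to a small Lipschitz error. -/
theorem near_linear (h : GaugeReversing S S') (he : IsUnitNorm e) (hSb : S b = b)
    (hder : HasFDerivAt S (-ContinuousLinearMap.id ℝ V) b)
    (hb : ‖b - e‖ ≤ 1 / 32) {r : ℝ} (hr : r ≤ 1 / 32) {p q : V} (hp : ‖p - b‖ ≤ r)
    (hq : ‖q - b‖ ≤ r) : ‖S p - S q + (p - q)‖ ≤ 40000 * r * ‖p - q‖ := by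
  have hqe : ‖q - e‖ ≤ 1 / 16 := by
    calc ‖q - e‖ = ‖(q - b) + (b - e)‖ := by rw [sub_add_sub_cancel]
      _ ≤ _ := (norm_add_le _ _).trans (by linarith)
  have hpq : ‖p - q‖ ≤ 2 * r := by
    calc ‖p - q‖ = ‖(p - b) - (q - b)‖ := by rw [sub_sub_sub_cancel_right]
      _ ≤ _ := (norm_sub_le _ _).trans (by linarith)
  have h1 := h.taylor_near he hSb (by linarith) (p := q) (k := p - q) (by linarith) (by linarith)
  have h2 := h.fderiv_sub_le_near he hSb (by linarith) hqe (q := b) (by linarith) (by linarith)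
  rw [hder.fderiv] at h2
  rw [add_sub_cancel] at h1
  have e1 : S p - S q + (p - q) = (S p - S q - fderiv ℝ S q (p - q)) +
      (fderiv ℝ S q - -ContinuousLinearMap.id ℝ V) (p - q) := by
    simp
    abel
  rw [e1]
  refine (norm_add_le _ _).trans ?_
  have h3 := (fderiv ℝ S q - -ContinuousLinearMap.id ℝ V).le_opNorm (p - q)
  have h4 : ‖fderiv ℝ S q - -ContinuousLinearMap.id ℝ V‖ * ‖p - q‖ ≤ 28800 * r * ‖p - q‖ :=
    mul_le_mul_of_nonneg_right (h2.trans (by linarith)) (norm_nonneg _)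
  have h5 : ‖p - q‖ ^ 2 ≤ 2 * r * ‖p - q‖ := by
    rw [sq]; exact mul_le_mul_of_nonneg_right hpq (norm_nonneg _)
  have h6 : 0 ≤ r * ‖p - q‖ := mul_nonneg ((norm_nonneg _).trans hp) (norm_nonneg _)
  nlinarith

theorem odd_iterate (h : GaugeReversing S S') (m : ℕ) :
    GaugeReversing (S^[2 * m + 1]) (S'^[2 * m + 1]) := by
  induction m with
  | zero => simpa using h
  | succ m ih =>
    have := h.comp_two ih
    convert this using 1
    · funext x
      have : 2 * (m + 1) + 1 = (2 * m + 1) + 1 + 1 := by ring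
      rw [this, Function.iterate_succ_apply', Function.iterate_succ_apply']
    · funext x
      have : 2 * (m + 1) + 1 = (2 * m + 1) + 1 + 1 := by ring
      rw [this, Function.iterate_succ_apply, Function.iterate_succ_apply]

theorem hasFDerivAt_odd_iterate (hSb : S b = b)
    (hder : HasFDerivAt S (-ContinuousLinearMap.id ℝ V) b) (m : ℕ) :
    HasFDerivAt (S^[2 * m + 1]) (-ContinuousLinearMap.id ℝ V) b := by
  induction m with
  | zero => simpa using hder
  | succ m ih =>
    have e1 : 2 * (m + 1) + 1 = (2 * m + 1) + 1 + 1 := by ring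
    have hfix : ∀ n, S^[n] b = b := fun n => Function.iterate_fixed hSb n
    rw [e1, Function.iterate_succ', Function.iterate_succ']
    have h1 : HasFDerivAt (S ∘ S^[2 * m + 1])
        ((-ContinuousLinearMap.id ℝ V).comp (-ContinuousLinearMap.id ℝ V)) b :=
      HasFDerivAt.comp b (by rw [hfix]; exact hder) ih
    have h2 : HasFDerivAt (S ∘ (S ∘ S^[2 * m + 1])) ((-ContinuousLinearMap.id ℝ V).comp
        ((-ContinuousLinearMap.id ℝ V).comp (-ContinuousLinearMap.id ℝ V))) b :=
      HasFDerivAt.comp b (by rw [Function.comp_apply, hfix, hSb]; exact hder) h1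
    convert h2 using 1
    ext v; simp

/-- A gauge-reversing map with derivative `-1` at a fixed point is an involution nearby. -/
theorem involutive_near (h : GaugeReversing S S') (he : IsUnitNorm e) (hSb : S b = b)
    (hder : HasFDerivAt S (-ContinuousLinearMap.id ℝ V) b)
    (hb : ‖b - e‖ ≤ 1 / 32) {p : V} (hp : ‖p - b‖ ≤ 1 / 10 ^ 6) : S (S p) = p := by
  have hfix : ∀ n, S^[n] b = b := fun n => Function.iterate_fixed hSb n
  -- Uniformity in `m` is the point: `S^[2 * m + 1]` is itself gauge-reversing with derivative `-1`
  -- at `b`, so `near_linear` applies to it with the same constants.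
  have hsq : ∀ (m : ℕ) (p q : V), ‖p - b‖ ≤ 2 / 10 ^ 6 → ‖q - b‖ ≤ 2 / 10 ^ 6 →
      ‖S^[2 * m + 2] p - S^[2 * m + 2] q - (p - q)‖ ≤ 1 / 2 * ‖p - q‖ := by
    intro m p q hp hq
    have hF := h.odd_iterate m
    have hFb := hfix (2 * m + 1)
    have hFd := hasFDerivAt_odd_iterate hSb hder m
    have hs2 : ∀ z, S^[2 * m + 2] z = S (S^[2 * m + 1] z) := fun z => by
      rw [Function.iterate_succ_apply']
    rw [hs2 p, hs2 q]
    set F := S^[2 * m + 1] with hFdef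
    have hmul : ∀ q, ‖q - b‖ ≤ 2 / 10 ^ 6 → ‖F q - b‖ ≤ 4 / 10 ^ 6 := by
      intro q hq
      have h1 := hF.near_linear he hFb hFd hb (r := 2 / 10 ^ 6) (by norm_num) hq
        (q := b) (by rw [sub_self, norm_zero]; norm_num)
      rw [hFb] at h1
      have e1 : F q - b = (F q - b + (q - b)) - (q - b) := by abel
      rw [e1]
      refine (norm_sub_le _ _).trans ?_
      have := mul_le_mul_of_nonneg_left hq (by norm_num : (0 : ℝ) ≤ 40000 * (2 / 10 ^ 6))
      linarith
    have h1 := hF.near_linear he hFb hFd hb (r := 2 / 10 ^ 6) (by norm_num) hp hq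
    have h2 := h.near_linear he hSb hder hb (r := 4 / 10 ^ 6) (by norm_num) (hmul p hp) (hmul q hq)
    have e1 : S (F p) - S (F q) - (p - q) =
        (S (F p) - S (F q) + (F p - F q)) - (F p - F q + (p - q)) := by abel
    have e2 : F p - F q = (F p - F q + (p - q)) - (p - q) := by abel
    have h3 : ‖F p - F q‖ ≤ 2 * ‖p - q‖ := by
      rw [e2]
      refine (norm_sub_le _ _).trans ?_
      nlinarith [norm_nonneg (p - q)]
    rw [e1]
    refine (norm_sub_le _ _).trans ?_
    nlinarith [norm_nonneg (p - q)]
  -- Each squaring of the iterate multiplies the displacement of `p` by at least `2 - 1/2`. By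
  -- `hbound` the displacements stay bounded, so the first one is zero.
  have hgrow : ∀ k : ℕ, ‖S^[2] p - p‖ * (3 / 2) ^ k ≤ ‖S^[2 ^ (k + 1)] p - p‖ := by
    intro k
    induction k with
    | zero => simp
    | succ k ih =>
      obtain ⟨m, hm⟩ : ∃ m, 2 ^ (k + 1) = 2 * m + 2 :=
        ⟨2 ^ k - 1, by have := Nat.one_le_two_pow (n := k); rw [pow_succ]; omega⟩
      have hpow : 2 ^ (k + 1 + 1) = 2 ^ (k + 1) + 2 ^ (k + 1) := by rw [pow_succ]; ring
      rw [hpow, Function.iterate_add_apply, hm]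
      rw [hm] at ih
      set g := S^[2 * m + 2] with hg
      have h1 := hsq m p b (by linarith) (by rw [sub_self, norm_zero]; norm_num)
      rw [hfix] at h1
      have h2 : ‖g p - b‖ ≤ 2 / 10 ^ 6 := by
        have e1 : g p - b = (g p - b - (p - b)) + (p - b) := by abel
        rw [e1]
        exact (norm_add_le _ _).trans (by linarith)
      have h3 := hsq m (g p) p h2 (by linarith)
      have e2 : g (g p) - p = (2 : ℝ) • (g p - p) + (g (g p) - g p - (g p - p)) := by
        rw [two_smul]; abel
      have h4 : 2 * ‖g p - p‖ - 1 / 2 * ‖g p - p‖ ≤ ‖g (g p) - p‖ := by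
        rw [e2]
        have := norm_sub_le_norm_add ((2 : ℝ) • (g p - p)) (g (g p) - g p - (g p - p))
        rw [norm_smul, Real.norm_of_nonneg (by norm_num)] at this
        linarith
      rw [pow_succ]
      linarith
  have hbound : ∀ k : ℕ, ‖S^[2 ^ (k + 1)] p - p‖ ≤ 1 := by
    intro k
    obtain ⟨m, hm⟩ : ∃ m, 2 ^ (k + 1) = 2 * m + 2 :=
      ⟨2 ^ k - 1, by have := Nat.one_le_two_pow (n := k); rw [pow_succ]; omega⟩
    rw [hm]
    have h1 := hsq m p b (by linarith) (by rw [sub_self, norm_zero]; norm_num)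
    rw [hfix] at h1
    have e1 : S^[2 * m + 2] p - p = S^[2 * m + 2] p - b - (p - b) := by abel
    rw [e1]; linarith
  have hlim : Tendsto (fun k : ℕ => 1 / (3 / 2 : ℝ) ^ k) atTop (𝓝 0) :=
    tendsto_const_nhds.div_atTop (tendsto_pow_atTop_atTop_of_one_lt (by norm_num))
  have h0 : ‖S^[2] p - p‖ ≤ 0 := ge_of_tendsto' hlim fun k => by
    rw [le_div_iff₀ (by positivity)]
    exact (hgrow k).trans (hbound k)
  exact sub_eq_zero.mp (norm_le_zero_iff.mp h0)

end Involution
end GaugeReversing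
end GaugeReversal

/-! ### A criterion for `C¹` regularity -/

namespace GaugeReversal

section QuasiJensen

variable {V : Type*} [NormedAddCommGroup V] [NormedSpace ℝ V]
  {𝔸 : Type*} [NormedRing 𝔸] [NormedAlgebra ℝ 𝔸] [CompleteSpace 𝔸]

/-- With `A = P (p + h/2)` and `X = T (p - k)`, point reflections give `P (p + h + k) ≈ A X A`, `P
(p + h) ≈ A (T p) A` and `P (p + k) ≈ (P p) X (P p)`, each up to `O(ρ²)`. What remains is `A (X - T
p) A - P p (X - T p) P p`, a sum of terms with two small factors. -/
theorem second_difference_le {T P : V → 𝔸} {e : V} {r K : ℝ} (hK : 0 ≤ K)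
    (hT : ∀ p q, ‖p - e‖ ≤ r → ‖q - e‖ ≤ r → ‖T p - T q‖ ≤ K * ‖p - q‖)
    (hP : ∀ p q, ‖p - e‖ ≤ r → ‖q - e‖ ≤ r → ‖P p - P q‖ ≤ K * ‖p - q‖)
    (hPb : ∀ p, ‖p - e‖ ≤ r → ‖P p‖ ≤ K)
    (hPTP : ∀ p, ‖p - e‖ ≤ r → P p * T p * P p = P p)
    (hrefl : ∀ b q, ‖b - e‖ ≤ r → ‖q - e‖ ≤ r →
      ‖P ((2 : ℝ) • b - q) - P b * T q * P b‖ ≤ K * ‖b - q‖ ^ 2)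
    {p : V} (hp : ‖p - e‖ ≤ r / 4) {h k : V} {ρ : ℝ} (hρ : ρ ≤ r / 4) (hh : ‖h‖ ≤ ρ)
    (hk : ‖k‖ ≤ ρ) :
    ‖P (p + h + k) - P (p + h) - P (p + k) + P p‖ ≤ (K ^ 3 + 5 * K) * ρ ^ 2 := by
  have hρ0 : 0 ≤ ρ := (norm_nonneg _).trans hh
  have hr : 0 ≤ r := by linarith
  have hh2 : ‖(1 / 2 : ℝ) • h‖ ≤ ρ / 2 := by
    rw [norm_smul, Real.norm_of_nonneg (by norm_num)]; linarith
  have hp1 : ‖p - e‖ ≤ r := by linarith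
  have hA : ‖p + (1 / 2 : ℝ) • h - e‖ ≤ r := by
    rw [add_sub_right_comm]
    exact (norm_add_le _ _).trans (by linarith)
  have hX : ‖p - k - e‖ ≤ r := by
    rw [sub_right_comm]
    exact (norm_sub_le _ _).trans (by linarith)
  have hsq : ∀ {a : ℝ}, 0 ≤ a → a ≤ 3 / 2 * ρ → K * a ^ 2 ≤ K * (9 / 4 * ρ ^ 2) := fun h0 h1 =>
    mul_le_mul_of_nonneg_left (by nlinarith) hK
  have E1 := hrefl _ _ hA hX
  have E2 := hrefl _ _ hA hp1
  have E3 := hrefl _ _ hp1 hX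
  have E4 := hPTP p hp1
  rw [show (2 : ℝ) • (p + (1 / 2 : ℝ) • h) - (p - k) = p + h + k by module,
    show p + (1 / 2 : ℝ) • h - (p - k) = (1 / 2 : ℝ) • h + k by abel] at E1
  rw [show (2 : ℝ) • (p + (1 / 2 : ℝ) • h) - p = p + h by module, add_sub_cancel_left] at E2
  rw [show (2 : ℝ) • p - (p - k) = p + k by module, sub_sub_cancel] at E3
  have F1 := E1.trans (hsq (norm_nonneg _) ((norm_add_le _ _).trans (by linarith)))
  have F2 := E2.trans (mul_le_mul_of_nonneg_left (pow_le_pow_left₀ (norm_nonneg _)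
    (hh2.trans (by linarith : ρ / 2 ≤ ρ)) 2) hK)
  have F3 := E3.trans (mul_le_mul_of_nonneg_left (pow_le_pow_left₀ (norm_nonneg _) hk 2) hK)
  have hAB := hP _ _ hA hp1
  rw [add_sub_cancel_left] at hAB
  have hXY := hT _ _ hX hp1
  rw [sub_sub_cancel_left, norm_neg] at hXY
  have hAn := hPb _ hA
  have hBn := hPb _ hp1
  set A := P (p + (1 / 2 : ℝ) • h)
  set X := T (p - k)
  have hAB' : ‖A - P p‖ ≤ K * ρ / 2 := hAB.trans (by nlinarith)
  have hXY' : ‖X - T p‖ ≤ K * ρ := hXY.trans (mul_le_mul_of_nonneg_left hk hK)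
  have key : P (p + h + k) - P (p + h) - P (p + k) + P p =
      (P (p + h + k) - A * X * A) - (P (p + h) - A * T p * A) - (P (p + k) - P p * X * P p) +
        ((A - P p) * (X - T p) * A + P p * (X - T p) * (A - P p)) := by
    calc _ = P (p + h + k) - P (p + h) - P (p + k) + P p * T p * P p := by rw [E4]
      _ = _ := by noncomm_ring
  have hKρ : 0 ≤ K * ρ := mul_nonneg hK hρ0
  have G1 : ‖(A - P p) * (X - T p) * A‖ ≤ K * ρ / 2 * (K * ρ) * K :=
    (norm_mul_le _ _).trans (mul_le_mul ((norm_mul_le _ _).trans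
      (mul_le_mul hAB' hXY' (norm_nonneg _) (by linarith))) hAn (norm_nonneg _)
        (by positivity))
  have G2 : ‖P p * (X - T p) * (A - P p)‖ ≤ K * (K * ρ) * (K * ρ / 2) :=
    (norm_mul_le _ _).trans (mul_le_mul ((norm_mul_le _ _).trans
      (mul_le_mul hBn hXY' (norm_nonneg _) hK)) hAB' (norm_nonneg _)
        (by positivity))
  rw [key]
  refine (norm_add_le _ _).trans ((add_le_add ((norm_sub_le _ _).trans (add_le_add
    ((norm_sub_le _ _).trans (add_le_add F1 F2)) F3)) ((norm_add_le _ _).trans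
      (add_le_add G1 G2))).trans ?_)
  have : 0 ≤ K * ρ ^ 2 := by positivity
  nlinarith

/-- A quadratic second difference makes `h ↦ P (p + h) - P p` almost additive, hence almost linear.
Uniformity of the error in `p` makes the derivative Lipschitz. -/
theorem contDiffAt_one_of_quasi_jensen {T P : V → 𝔸} {e : V} {r K : ℝ} (hr : 0 < r) (hK : 0 ≤ K)
    (hT : ∀ p q, ‖p - e‖ ≤ r → ‖q - e‖ ≤ r → ‖T p - T q‖ ≤ K * ‖p - q‖)
    (hP : ∀ p q, ‖p - e‖ ≤ r → ‖q - e‖ ≤ r → ‖P p - P q‖ ≤ K * ‖p - q‖)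
    (hPb : ∀ p, ‖p - e‖ ≤ r → ‖P p‖ ≤ K)
    (hPTP : ∀ p, ‖p - e‖ ≤ r → P p * T p * P p = P p)
    (hrefl : ∀ b q, ‖b - e‖ ≤ r → ‖q - e‖ ≤ r →
      ‖P ((2 : ℝ) • b - q) - P b * T q * P b‖ ≤ K * ‖b - q‖ ^ 2) :
    ContDiffAt ℝ 1 P e := by
  have hex : ∀ p, ‖p - e‖ ≤ r / 4 → ∃ L : V →L[ℝ] 𝔸, ∀ h, ‖h‖ ≤ r / 4 →
      ‖P (p + h) - P p - L h‖ ≤ (K ^ 3 + 5 * K) * ‖h‖ ^ 2 := fun p hp =>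
    exists_linear_of_almost_additive (φ := fun h => P (p + h) - P p) (M := K) (by linarith)
      (by positivity) (fun h k ρ hρ hh hk => by
        have := second_difference_le hK hT hP hPb hPTP hrefl hp hρ hh hk
        refine le_trans (le_of_eq ?_) this
        congr 1
        rw [add_assoc]
        abel) (fun h hh => by
        have := hP (p + h) p (by
          rw [add_sub_right_comm]; exact (norm_add_le _ _).trans (by linarith)) (by linarith)
        rwa [add_sub_cancel_left] at this)
  choose! L hL using hex
  have hlip : ∀ p q, ‖p - e‖ ≤ r / 16 → ‖q - e‖ ≤ r / 16 →
      ‖L p - L q‖ ≤ 6 * (K ^ 3 + 5 * K) * ‖p - q‖ := fun p q hp hq =>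
    norm_deriv_sub_le_of_quadratic (by positivity) hL (r := r / 4) (x := e) (by linarith)
      (by linarith) (by
        have : ‖p - q‖ ≤ r / 16 + r / 16 := by
          rw [← sub_sub_sub_cancel_right p q e]
          exact (norm_sub_le _ _).trans (add_le_add hp hq)
        linarith)
  rw [contDiffAt_one_iff]
  refine ⟨L, Metric.closedBall e (r / 16), Metric.closedBall_mem_nhds _ (by linarith), ?_,
    fun p hp => ?_⟩
  · have : LipschitzOnWith (6 * (K ^ 3 + 5 * K)).toNNReal L (Metric.closedBall e (r / 16)) := by
      refine LipschitzOnWith.of_dist_le_mul fun p hp q hq => ?_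
      rw [mem_closedBall_iff_norm] at hp hq
      rw [dist_eq_norm, dist_eq_norm, Real.coe_toNNReal _ (by positivity)]
      exact hlip p q (by linarith) (by linarith)
    exact this.continuousOn
  · rw [mem_closedBall_iff_norm] at hp
    exact hasFDerivAt_of_quadratic (by linarith) (hL p (by linarith))

end QuasiJensen
end GaugeReversal

/-! ### The quadratic representation and the fundamental identity -/

namespace GaugeReversal

section QuadRep

variable {V : Type*} [NormedAddCommGroup V] [NormedSpace ℝ V]

/-- Minus the derivative of `S` at `p`. -/
def derivMap (S : V → V) (p : V) : V →L[ℝ] V := -fderiv ℝ S p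

/-- Near a fixed point at which `S` has derivative `-1`, `quadRep S p` is the inverse of
`derivMap S p`; it plays the role of the quadratic representation of a Jordan algebra. -/
def quadRep (S : V → V) (p : V) : V →L[ℝ] V := derivMap S (S p)

end QuadRep

namespace GaugeReversing

variable {V : Type*} [NormedAddCommGroup V] [NormedSpace ℝ V] [PartialOrder V]
  [IsOrderedAddMonoid V] [IsOrderedModule ℝ V] [CompleteOrder V] {e b p q : V} {S S' : V → V}

theorem hasFDerivAt_derivMap (h : GaugeReversing S S') (he : IsUnitNorm e) (hp : IsUnitElt p) :
    HasFDerivAt S (-derivMap S p) p := by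
  rw [derivMap, neg_neg]; exact h.hasFDerivAt he he hp

theorem derivMap_self (h : GaugeReversing S S') (he : IsUnitNorm e) (hp : IsUnitElt p) :
    derivMap S p p = S p := by
  rw [derivMap, neg_apply, h.fderiv_self he he hp, neg_neg]

theorem derivMap_nonneg (h : GaugeReversing S S') (he : IsUnitNorm e) (hp : IsUnitElt p) {y : V}
    (hy : 0 ≤ y) : 0 ≤ derivMap S p y := by
  rw [derivMap, neg_apply, neg_nonneg]; exact h.fderiv_nonpos he he hp hy

theorem quadRep_nonneg (h : GaugeReversing S S') (he : IsUnitNorm e) (hp : IsUnitElt p) {y : V}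
    (hy : 0 ≤ y) : 0 ≤ quadRep S p y :=
  h.derivMap_nonneg he (h.map_unit hp) hy

theorem norm_sub_le_near (h : GaugeReversing S S') (he : IsUnitNorm e) (hSb : S b = b)
    (hder : HasFDerivAt S (-ContinuousLinearMap.id ℝ V) b) (hb : ‖b - e‖ ≤ 1 / 32)
    (hp : ‖p - b‖ ≤ 1 / 10 ^ 6) (hq : ‖q - b‖ ≤ 1 / 10 ^ 6) : ‖S p - S q‖ ≤ 2 * ‖p - q‖ := by
  have h1 := h.near_linear he hSb hder hb (by norm_num) hp hq
  calc ‖S p - S q‖ = ‖(S p - S q + (p - q)) - (p - q)‖ := by rw [add_sub_cancel_right]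
    _ ≤ _ := (norm_sub_le _ _).trans (by linarith [norm_nonneg (p - q)])

theorem norm_map_sub_le (h : GaugeReversing S S') (he : IsUnitNorm e) (hSb : S b = b)
    (hder : HasFDerivAt S (-ContinuousLinearMap.id ℝ V) b) (hb : ‖b - e‖ ≤ 1 / 32)
    (hp : ‖p - b‖ ≤ 1 / 10 ^ 6) : ‖S p - b‖ ≤ 2 * ‖p - b‖ := by
  have := h.norm_sub_le_near he hSb hder hb hp (q := b) (by rw [sub_self, norm_zero]; norm_num)
  rwa [hSb] at this

section Base

variable (h : GaugeReversing S S') (he : IsUnitNorm e) (hSe : S e = e)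
  (hder : HasFDerivAt S (-ContinuousLinearMap.id ℝ V) e)

include h he hSe hder

theorem isUnitElt_near (hp : ‖p - e‖ ≤ 1 / 10 ^ 6) : IsUnitElt p :=
  he.isUnitElt_of_norm_lt (by norm_num) hp

theorem map_map_near (hp : ‖p - e‖ ≤ 1 / 10 ^ 6) : S (S p) = p :=
  h.involutive_near he hSe hder (by rw [sub_self, norm_zero]; norm_num) hp

theorem norm_sub_le_near_base (hp : ‖p - e‖ ≤ 1 / 10 ^ 6) (hq : ‖q - e‖ ≤ 1 / 10 ^ 6) :
    ‖S p - S q‖ ≤ 2 * ‖p - q‖ :=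
  h.norm_sub_le_near he hSe hder (by rw [sub_self, norm_zero]; norm_num) hp hq

theorem norm_map_sub_le_base (hp : ‖p - e‖ ≤ 1 / 10 ^ 6) : ‖S p - e‖ ≤ 2 * ‖p - e‖ :=
  h.norm_map_sub_le he hSe hder (by rw [sub_self, norm_zero]; norm_num) hp

theorem norm_derivMap_sub_le (hp : ‖p - e‖ ≤ 1 / 10 ^ 6) (hq : ‖q - e‖ ≤ 1 / 10 ^ 6) :
    ‖derivMap S p - derivMap S q‖ ≤ 28800 * ‖p - q‖ := by
  have hpq : ‖p - q‖ ≤ 2 / 10 ^ 6 := by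
    rw [← sub_sub_sub_cancel_right p q e]
    exact (norm_sub_le _ _).trans (by linarith)
  rw [derivMap, derivMap, neg_sub_neg, norm_sub_rev]
  exact h.fderiv_sub_le_near he hSe (by rw [sub_self, norm_zero]; norm_num) (by linarith)
    (by linarith) (by linarith)

theorem derivMap_base : derivMap S e = 1 := by
  rw [derivMap, hder.fderiv, neg_neg]; rfl

theorem norm_derivMap_le (hp : ‖p - e‖ ≤ 1 / 10 ^ 6) : ‖derivMap S p‖ ≤ 2 := by
  have h1 := h.norm_derivMap_sub_le he hSe hder hp (q := e) (by rw [sub_self, norm_zero]; norm_num)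
  rw [h.derivMap_base he hSe hder] at h1
  calc ‖derivMap S p‖ = ‖(derivMap S p - 1) + 1‖ := by rw [sub_add_cancel]
    _ ≤ 1 + 1 := (norm_add_le _ _).trans (add_le_add (by linarith) ContinuousLinearMap.norm_id_le)
    _ = 2 := by norm_num

theorem quadRep_base : quadRep S e = 1 := by
  rw [quadRep, hSe, h.derivMap_base he hSe hder]

theorem norm_quadRep_le (hp : ‖p - e‖ ≤ 1 / 10 ^ 7) : ‖quadRep S p‖ ≤ 2 := by
  have := h.norm_map_sub_le_base he hSe hder (p := p) (by linarith)
  exact h.norm_derivMap_le he hSe hder (by linarith)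

theorem norm_quadRep_sub_le (hp : ‖p - e‖ ≤ 1 / 10 ^ 7) (hq : ‖q - e‖ ≤ 1 / 10 ^ 7) :
    ‖quadRep S p - quadRep S q‖ ≤ 57600 * ‖p - q‖ := by
  have h1 := h.norm_map_sub_le_base he hSe hder (p := p) (by linarith)
  have h2 := h.norm_map_sub_le_base he hSe hder (p := q) (by linarith)
  have h3 := h.norm_sub_le_near_base he hSe hder (p := p) (q := q) (by linarith) (by linarith)
  have h4 := h.norm_derivMap_sub_le he hSe hder (p := S p) (q := S q) (by linarith) (by linarith)
  exact h4.trans (by linarith)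

/-- The chain rule for `S ∘ S = id` near `e`. -/
theorem quadRep_mul_derivMap (hp : ‖p - e‖ < 1 / 10 ^ 6) : quadRep S p * derivMap S p = 1 := by
  have hpu := h.isUnitElt_near he hSe hder hp.le
  have h1 : HasFDerivAt (S ∘ S) ((-quadRep S p).comp (-derivMap S p)) p :=
    HasFDerivAt.comp p (h.hasFDerivAt_derivMap he (h.map_unit hpu)) (h.hasFDerivAt_derivMap he hpu)
  have h2 : (S ∘ S) =ᶠ[𝓝 p] id := by
    filter_upwards [Metric.isOpen_ball.mem_nhds (mem_ball_iff_norm.mpr hp)] with y hy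
    exact h.map_map_near he hSe hder (mem_ball_iff_norm.mp hy).le
  have h3 := h1.unique ((hasFDerivAt_id p).congr_of_eventuallyEq h2)
  rw [ContinuousLinearMap.neg_comp, ContinuousLinearMap.comp_neg, neg_neg] at h3
  exact h3

theorem derivMap_mul_quadRep (hp : ‖p - e‖ ≤ 1 / 10 ^ 7) : derivMap S p * quadRep S p = 1 := by
  have h1 := h.norm_map_sub_le_base he hSe hder (p := p) (by linarith)
  have h2 := h.quadRep_mul_derivMap he hSe hder (p := S p) (by linarith)
  rwa [quadRep, h.map_map_near he hSe hder (by linarith)] at h2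

theorem quadRep_map (hp : ‖p - e‖ ≤ 1 / 10 ^ 6) : quadRep S p (S p) = p := by
  rw [quadRep, h.derivMap_self he (h.map_unit (h.isUnitElt_near he hSe hder hp)),
    h.map_map_near he hSe hder hp]

/-- The map `q ↦ P(b) (S q)` is the geodesic symmetry at `b` in the Jordan picture. It plays at `b`
the role that `S` plays at `e`, so the results on involutions apply to it. -/
theorem reflection_spec (hb : ‖b - e‖ ≤ 1 / 10 ^ 7) :
    GaugeReversing (fun q => quadRep S b (S q)) (fun q => S' (derivMap S b q)) ∧
      quadRep S b (S b) = b ∧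
      HasFDerivAt (fun q => quadRep S b (S q)) (-ContinuousLinearMap.id ℝ V) b := by
  have hbu := h.isUnitElt_near he hSe hder (p := b) (by linarith)
  have hPT := h.quadRep_mul_derivMap he hSe hder (p := b) (by linarith)
  refine ⟨?_, h.quadRep_map he hSe hder (by linarith), ?_⟩
  · refine h.comp_linear (quadRep S b).toLinearMap (derivMap S b).toLinearMap
      (fun y => ?_) (fun y => ?_) (fun y hy => h.quadRep_nonneg he hbu hy)
      (fun y hy => h.derivMap_nonneg he hbu hy)
    · exact DFunLike.congr_fun hPT y
    · exact DFunLike.congr_fun (h.derivMap_mul_quadRep he hSe hder hb) y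
  · have := (quadRep S b).hasFDerivAt.comp b (h.hasFDerivAt_derivMap he hbu)
    rw [ContinuousLinearMap.comp_neg] at this
    have e1 : (quadRep S b).comp (derivMap S b) = ContinuousLinearMap.id ℝ V := hPT
    rw [e1] at this
    exact this

theorem norm_reflection_sub_le (hb : ‖b - e‖ ≤ 1 / 10 ^ 7) (hq : ‖q - e‖ ≤ 1 / 10 ^ 7) :
    ‖quadRep S b (S q) - b‖ ≤ 2 * ‖q - b‖ := by
  obtain ⟨hσ, hσb, hσd⟩ := h.reflection_spec he hSe hder hb
  have hqb : ‖q - b‖ ≤ 2 / 10 ^ 7 := by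
    rw [← sub_sub_sub_cancel_right q b e]
    exact (norm_sub_le _ _).trans (by linarith)
  exact hσ.norm_map_sub_le he hσb hσd (by linarith) (by linarith)

theorem map_reflection (hb : ‖b - e‖ ≤ 1 / 10 ^ 7) (hq : ‖q - e‖ ≤ 1 / 10 ^ 7) :
    S (quadRep S b (S q)) = derivMap S b q := by
  obtain ⟨hσ, hσb, hσd⟩ := h.reflection_spec he hSe hder hb
  have hqb : ‖q - b‖ ≤ 2 / 10 ^ 7 := by
    rw [← sub_sub_sub_cancel_right q b e]
    exact (norm_sub_le _ _).trans (by linarith)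
  have h1 := hσ.involutive_near he hσb hσd (by linarith) (p := q) (by linarith)
  have h2 := DFunLike.congr_fun (h.derivMap_mul_quadRep he hSe hder hb) (S (quadRep S b (S q)))
  have h3 := congrArg (derivMap S b) h1
  exact h2.symm.trans h3

/-- Differentiate `map_reflection` in `q`, whose right-hand side is linear, and invert. Replacing
`q` by `S q` then yields the fundamental identity. -/
theorem quadRep_reflection (hb : ‖b - e‖ ≤ 1 / 10 ^ 8) (hq : ‖q - e‖ ≤ 1 / 10 ^ 8) :
    quadRep S (quadRep S b (S q)) = quadRep S b * derivMap S q * quadRep S b := by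
  have hqu := h.isUnitElt_near he hSe hder (p := q) (by linarith)
  have hbu := h.isUnitElt_near he hSe hder (p := b) (by linarith)
  obtain ⟨hσ, hσb, hσd⟩ := h.reflection_spec he hSe hder (b := b) (by linarith)
  have hσu : IsUnitElt (quadRep S b (S q)) := hσ.map_unit hqu
  have hqb : ‖q - b‖ ≤ 2 / 10 ^ 8 := by
    rw [← sub_sub_sub_cancel_right q b e]
    exact (norm_sub_le _ _).trans (by linarith)
  have hσn : ‖quadRep S b (S q) - e‖ ≤ 1 / 10 ^ 7 := by
    rw [← sub_add_sub_cancel _ b e]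
    have := h.norm_reflection_sub_le he hSe hder (b := b) (q := q) (by linarith) (by linarith)
    exact (norm_add_le _ _).trans (by linarith)
  have hin : HasFDerivAt (fun q => quadRep S b (S q)) ((quadRep S b).comp (-derivMap S q)) q :=
    (quadRep S b).hasFDerivAt.comp q (h.hasFDerivAt_derivMap he hqu)
  have h1 := HasFDerivAt.comp q (h.hasFDerivAt_derivMap he hσu) hin
  have h2 : S ∘ (fun q => quadRep S b (S q)) =ᶠ[𝓝 q] derivMap S b := by
    have : ‖q - e‖ < 1 / 10 ^ 7 := by linarith
    filter_upwards [Metric.isOpen_ball.mem_nhds (mem_ball_iff_norm.mpr this)] with y hy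
    exact h.map_reflection he hSe hder (by linarith) (mem_ball_iff_norm.mp hy).le
  have h3 := h1.unique ((derivMap S b).hasFDerivAt.congr_of_eventuallyEq h2)
  rw [ContinuousLinearMap.neg_comp, ContinuousLinearMap.comp_neg, ContinuousLinearMap.comp_neg,
    neg_neg] at h3
  have h4 : derivMap S (quadRep S b (S q)) * (quadRep S b * derivMap S q) = derivMap S b := h3
  have h5 := h.quadRep_mul_derivMap he hSe hder (p := quadRep S b (S q)) (by linarith)
  have h6 := h.derivMap_mul_quadRep he hSe hder (p := b) (by linarith)
  calc quadRep S (quadRep S b (S q))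
      = quadRep S (quadRep S b (S q)) * (derivMap S b * quadRep S b) := by rw [h6, mul_one]
    _ = (quadRep S (quadRep S b (S q)) * derivMap S (quadRep S b (S q))) *
          (quadRep S b * derivMap S q) * quadRep S b := by rw [← h4]; noncomm_ring
    _ = _ := by rw [h5, one_mul]

/-- The fundamental identity. -/
theorem quadRep_quadRep (hb : ‖b - e‖ ≤ 1 / 10 ^ 9) (hq : ‖q - e‖ ≤ 1 / 10 ^ 9) :
    quadRep S (quadRep S b q) = quadRep S b * quadRep S q * quadRep S b := by
  have h1 := h.norm_map_sub_le_base he hSe hder (p := q) (by linarith)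
  have h2 := h.quadRep_reflection he hSe hder (b := b) (q := S q) (by linarith) (by linarith)
  rwa [h.map_map_near he hSe hder (by linarith)] at h2

/-- The symmetry at `b` agrees with the point reflection `2b - q` up to `4800 ‖q - b‖²`, and
`quadRep S` has Lipschitz constant 57600; their product serves as `K`. -/
theorem contDiffAt_one_quadRep [CompleteSpace V] : ContDiffAt ℝ 1 (quadRep S) e := by
  refine contDiffAt_one_of_quasi_jensen (T := derivMap S) (r := 1 / 10 ^ 9)
    (K := 57600 * 4800) (by norm_num) (by norm_num)
    (fun p q hp hq => (h.norm_derivMap_sub_le he hSe hder (by linarith) (by linarith)).trans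
      (mul_le_mul_of_nonneg_right (by norm_num) (norm_nonneg _)))
    (fun p q hp hq => (h.norm_quadRep_sub_le he hSe hder (by linarith) (by linarith)).trans
      (mul_le_mul_of_nonneg_right (by norm_num) (norm_nonneg _)))
    (fun p hp => (h.norm_quadRep_le he hSe hder (by linarith)).trans (by norm_num))
    (fun p hp => by
      rw [h.quadRep_mul_derivMap he hSe hder (by linarith), one_mul])
    (fun b q hb hq => ?_)
  obtain ⟨hσ, hσb, hσd⟩ := h.reflection_spec he hSe hder (b := b) (by linarith)
  rw [← h.quadRep_reflection he hSe hder (by linarith) (by linarith)]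
  have hqb : ‖q - b‖ ≤ 2 / 10 ^ 9 := by
    rw [← sub_sub_sub_cancel_right q b e]
    exact (norm_sub_le _ _).trans (by linarith)
  have hbq : ‖b - q‖ ≤ 2 / 10 ^ 9 := by rwa [norm_sub_rev]
  have hσn : ‖quadRep S b (S q) - e‖ ≤ 1 / 10 ^ 7 := by
    rw [← sub_add_sub_cancel _ b e]
    have := h.norm_reflection_sub_le he hSe hder (b := b) (q := q) (by linarith) (by linarith)
    exact (norm_add_le _ _).trans (by linarith)
  have hrn : ‖(2 : ℝ) • b - q - e‖ ≤ 1 / 10 ^ 7 := by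
    rw [show (2 : ℝ) • b - q - e = (b - q) + (b - e) by rw [two_smul]; abel]
    exact (norm_add_le _ _).trans (by linarith)
  refine (h.norm_quadRep_sub_le he hSe hder hrn hσn).trans ?_
  have h1 := hσ.taylor_near he hσb (by linarith) (p := b) (by linarith) (k := q - b) (by linarith)
  rw [hσd.fderiv] at h1
  simp only [add_sub_cancel] at h1
  have e1 : (2 : ℝ) • b - q - quadRep S b (S q) = -(quadRep S b (S q) - quadRep S b (S b) -
      (-ContinuousLinearMap.id ℝ V) (q - b)) := by
    rw [hσb, neg_apply, ContinuousLinearMap.id_apply, two_smul]; abel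
  rw [e1, norm_neg, norm_sub_rev b q]
  linarith

end Base
end GaugeReversing
end GaugeReversal

/-! ### Smoothness of the quadratic representation -/

namespace GaugeReversal

section Bootstrap

variable {V : Type*} [NormedAddCommGroup V] [NormedSpace ℝ V] [CompleteSpace V]
  {P : V → V →L[ℝ] V} {e : V}

/-- Differentiate the fundamental identity in `q` at `e`, which involves no derivative of `P` in
`b`. The derivative of `P` at `P b e` becomes an algebraic expression in `P b`. -/
theorem fderiv_of_fundamental (h1 : ContDiffAt ℝ 1 P e) (hPe : P e = 1)
    (hfund : ∀ᶠ b in 𝓝 e, ∀ᶠ q in 𝓝 e, P (P b q) = P b * P q * P b) :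
    ∀ᶠ b in 𝓝 e, fderiv ℝ P (P b e) =
      ((ContinuousLinearMap.mulLeftRight ℝ (V →L[ℝ] V) (P b) (P b)).comp (fderiv ℝ P e)).comp
        (Ring.inverse (P b)) := by
  have hcont : ContinuousAt (fun b => P b e) e :=
    (h1.clm_apply contDiffAt_const).continuousAt
  have hRe : P e e = e := by rw [hPe]; rfl
  have hd : ∀ᶠ p in 𝓝 e, DifferentiableAt ℝ P p :=
    (h1.eventually (by simp)).mono fun p hp => hp.differentiableAt (by simp)
  have hd' : ∀ᶠ b in 𝓝 e, DifferentiableAt ℝ P (P b e) := by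
    have : Tendsto (fun b => P b e) (𝓝 e) (𝓝 e) := by
      have := hcont.tendsto; simp only [hRe] at this; exact this
    exact this.eventually hd
  have hunit : ∀ᶠ b in 𝓝 e, IsUnit (P b) :=
    h1.continuousAt.eventually (Units.isOpen.mem_nhds (by rw [hPe]; exact isUnit_one))
  filter_upwards [hfund, hd', hunit] with b hb hdb hu
  have e1 : HasFDerivAt (P ∘ P b) ((fderiv ℝ P (P b e)).comp (P b)) e :=
    hdb.hasFDerivAt.comp e (P b).hasFDerivAt
  have e2 : HasFDerivAt (fun q => P b * P q * P b)
      ((ContinuousLinearMap.mulLeftRight ℝ (V →L[ℝ] V) (P b) (P b)).comp (fderiv ℝ P e)) e := by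
    have := (ContinuousLinearMap.mulLeftRight ℝ (V →L[ℝ] V) (P b) (P b)).hasFDerivAt.comp e
      hd.self_of_nhds.hasFDerivAt
    exact this
  have e3 := e1.unique (e2.congr_of_eventuallyEq hb)
  have e4 : (P b).comp (Ring.inverse (P b)) = ContinuousLinearMap.id ℝ V :=
    Ring.mul_inverse_cancel _ hu
  rw [← e3, ContinuousLinearMap.comp_assoc, e4, ContinuousLinearMap.comp_id]

/-- By `hDP` the map `b ↦ P b e` has invertible derivative, twice the identity, at `e`. Its local
inverse `β` is as smooth as `P`, so `fderiv_of_fundamental` at `b = β p` shows that the derivative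
of `P` is as smooth as `P`. Each turn gains one order. -/
theorem contDiffAt_of_fundamental (h1 : ContDiffAt ℝ 1 P e) (hPe : P e = 1)
    (hDP : ∀ h, fderiv ℝ P e h e = (2 : ℝ) • h)
    (hfund : ∀ᶠ b in 𝓝 e, ∀ᶠ q in 𝓝 e, P (P b q) = P b * P q * P b) (n : ℕ) :
    ContDiffAt ℝ n P e := by
  have hG := fderiv_of_fundamental h1 hPe hfund
  have hRe : P e e = e := by rw [hPe]; rfl
  have hd : ∀ᶠ p in 𝓝 e, DifferentiableAt ℝ P p :=
    (h1.eventually (by simp)).mono fun p hp => hp.differentiableAt (by simp)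
  have hsucc : ∀ n : ℕ, ContDiffAt ℝ (n + 1 : ℕ) P e → ContDiffAt ℝ (n + 1 + 1 : ℕ) P e := by
    intro n hn
    have hR : ContDiffAt ℝ (n + 1 : ℕ) (fun b => P b e) e := hn.clm_apply contDiffAt_const
    set two : V ≃L[ℝ] V := ContinuousLinearEquiv.smulLeft (Units.mk0 (2 : ℝ) two_ne_zero)
    have hR' : HasFDerivAt (fun b => P b e) (two : V →L[ℝ] V) e := by
      have := hd.self_of_nhds.hasFDerivAt.clm_apply (hasFDerivAt_const e e)
      convert this using 1
      ext h
      simp [hDP, two, Units.smul_def]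
    have hn0 : ((n + 1 : ℕ) : WithTop ℕ∞) ≠ 0 := by
      exact_mod_cast Nat.succ_ne_zero n
    have hβ := hR.to_localInverse hR' hn0
    have hβe := hR.localInverse_apply_image hR' hn0
    have hβr := (hR.hasStrictFDerivAt' hR' hn0).eventually_right_inverse
    change ∀ᶠ y in 𝓝 (P e e), P (hR.localInverse hR' hn0 y) e = y at hβr
    set β := hR.localInverse hR' hn0
    simp only [hRe] at hβ hβe hβr
    have hβt : Tendsto β (𝓝 e) (𝓝 e) := by
      have := hβ.continuousAt.tendsto; rwa [hβe] at this
    have hPβ : ContDiffAt ℝ (n + 1 : ℕ) (fun p => P (β p)) e :=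
      ContDiffAt.comp e (by rw [hβe]; exact hn) hβ
    have hinv : ContDiffAt ℝ (n + 1 : ℕ) (fun p => Ring.inverse (P (β p))) e :=
      ContDiffAt.comp e (g := Ring.inverse) (by
        rw [hβe, hPe]; exact contDiffAt_ringInverse ℝ (1 : (V →L[ℝ] V)ˣ)) hPβ
    have hsm : ContDiffAt ℝ (n + 1 : ℕ) (fun p =>
        ((ContinuousLinearMap.mulLeftRight ℝ (V →L[ℝ] V) (P (β p)) (P (β p))).comp
          (fderiv ℝ P e)).comp (Ring.inverse (P (β p)))) e := by
      refine ContDiffAt.clm_comp (ContDiffAt.clm_comp (ContDiffAt.clm_apply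
        (ContDiffAt.clm_apply contDiffAt_const hPβ) hPβ) contDiffAt_const) hinv
    push_cast
    refine contDiffAt_succ_iff_hasFDerivAt.mpr ⟨_, ?_, hsm⟩
    rw [← Filter.eventually_iff_exists_mem]
    filter_upwards [hβt.eventually hG, hβr, hd] with p h2 h3 h4
    rw [h3] at h2
    rw [← h2]
    exact h4.hasFDerivAt
  have h1' : ∀ n : ℕ, ContDiffAt ℝ (n + 1 : ℕ) P e := fun n => by
    induction n with
    | zero => simpa using h1
    | succ n ih => exact hsucc n ih
  exact (h1' n).of_le (by exact_mod_cast Nat.le_succ n)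

end Bootstrap

namespace GaugeReversing

variable {V : Type*} [NormedAddCommGroup V] [NormedSpace ℝ V] [PartialOrder V]
  [IsOrderedAddMonoid V] [IsOrderedModule ℝ V] [CompleteOrder V] {e b p q : V} {S S' : V → V}

section Base

variable [CompleteSpace V] (h : GaugeReversing S S') (he : IsUnitNorm e) (hSe : S e = e)
  (hder : HasFDerivAt S (-ContinuousLinearMap.id ℝ V) e)

include h he hSe hder

theorem eventually_near (r : ℝ) (hr : 0 < r) : ∀ᶠ p in 𝓝 e, ‖p - e‖ ≤ r := by
  filter_upwards [Metric.closedBall_mem_nhds e hr] with p hp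
  exact mem_closedBall_iff_norm.mp hp

/-- Differentiate `P(p) (S p) = p` at `e`, where `S` contributes `-k`. -/
theorem fderiv_quadRep_base_apply (k : V) : fderiv ℝ (quadRep S) e k e = (2 : ℝ) • k := by
  have h1 := h.contDiffAt_one_quadRep he hSe hder
  have e1 := (h1.differentiableAt (by simp)).hasFDerivAt.clm_apply hder
  have e2 : (fun p => quadRep S p (S p)) =ᶠ[𝓝 e] id := by
    filter_upwards [h.eventually_near he hSe hder (1 / 10 ^ 6) (by norm_num)] with p hp
    exact h.quadRep_map he hSe hder hp
  have e3 := DFunLike.congr_fun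
    (e1.unique ((hasFDerivAt_id e).congr_of_eventuallyEq e2)) k
  rw [h.quadRep_base he hSe hder, hSe] at e3
  simp only [ContinuousLinearMap.comp_neg, ContinuousLinearMap.comp_id, add_apply, neg_apply,
    one_apply_eq_self, ContinuousLinearMap.flip_apply, ContinuousLinearMap.id_apply] at e3
  rw [neg_add_eq_iff_eq_add] at e3
  rw [e3, two_smul]

theorem contDiffAt_quadRep (n : ℕ) : ContDiffAt ℝ n (quadRep S) e := by
  have h1 := h.contDiffAt_one_quadRep he hSe hder
  refine contDiffAt_of_fundamental h1 (h.quadRep_base he hSe hder)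
    (h.fderiv_quadRep_base_apply he hSe hder) ?_ n
  have := h.eventually_near he hSe hder (1 / 10 ^ 9) (by norm_num)
  filter_upwards [this] with b hb
  filter_upwards [this] with q hq
  exact h.quadRep_quadRep he hSe hder hb hq

theorem contDiffAt_derivMap (n : ℕ) : ContDiffAt ℝ n (derivMap S) e := by
  have h1 : ContDiffAt ℝ n (fun p => Ring.inverse (quadRep S p)) e :=
    ContDiffAt.comp e (g := Ring.inverse) (by
      rw [h.quadRep_base he hSe hder]; exact contDiffAt_ringInverse ℝ (1 : (V →L[ℝ] V)ˣ))
        (h.contDiffAt_quadRep he hSe hder n)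
  refine h1.congr_of_eventuallyEq ?_
  filter_upwards [h.eventually_near he hSe hder (1 / 10 ^ 7) (by norm_num)] with p hp
  have h2 := h.quadRep_mul_derivMap he hSe hder (p := p) (by linarith)
  have h3 := h.derivMap_mul_quadRep he hSe hder hp
  have hu : IsUnit (quadRep S p) := ⟨⟨_, _, h2, h3⟩, rfl⟩
  rw [← mul_one (Ring.inverse _), ← h2, ← mul_assoc, Ring.inverse_mul_cancel _ hu, one_mul]

end Base
end GaugeReversing
end GaugeReversal

/-! ### Order derivations and vanishing of the third derivative -/

namespace GaugeReversal

theorem fderiv_mem_of_eventually_mem {V E : Type*} [NormedAddCommGroup V] [NormedSpace ℝ V]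
    [NormedAddCommGroup E] [NormedSpace ℝ E] {N : Submodule ℝ E} (hN : IsClosed (N : Set E))
    {f : V → E} {q : V} (hf : DifferentiableAt ℝ f q) (hmem : ∀ᶠ p in 𝓝 q, f p ∈ N) (a : V) :
    fderiv ℝ f q a ∈ N := by
  have h1 : HasDerivAt (fun t : ℝ => f (q + t • a)) (fderiv ℝ f q a) 0 :=
    hf.hasFDerivAt.hasLineDerivAt a
  have h2 := h1.tendsto_slope_zero
  refine hN.mem_of_tendsto h2 ?_
  have h3 : Tendsto (fun t : ℝ => q + t • a) (𝓝[≠] 0) (𝓝 q) := by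
    have : ContinuousAt (fun t : ℝ => q + t • a) 0 := by fun_prop
    have := this.tendsto
    simp only [zero_smul, add_zero] at this
    exact this.mono_left nhdsWithin_le_nhds
  filter_upwards [h3.eventually hmem] with t ht
  simp only [zero_add, zero_smul, add_zero]
  exact N.smul_mem _ (N.sub_mem ht hmem.self_of_nhds)

section OrderDerivation

variable {V : Type*} [NormedAddCommGroup V] [NormedSpace ℝ V] [PartialOrder V]
  [IsOrderedAddMonoid V] [IsOrderedModule ℝ V] [CompleteOrder V] {e : V}

/-- The operators `δ` for which `1 + t δ` is positive up to an error `o(t)`. -/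
def orderDerivations (e : V) (he0 : 0 ≤ e) : Submodule ℝ (V →L[ℝ] V) where
  carrier := {δ | ∀ η : ℝ, 0 < η → ∃ t₀ : ℝ, 0 < t₀ ∧ ∀ t : ℝ, |t| < t₀ → ∀ h : V, 0 ≤ h →
    -((η * |t| * ‖h‖) • e) ≤ h + t • δ h}
  zero_mem' := fun η hη => ⟨1, one_pos, fun t _ h hh => by
    rw [zero_apply, smul_zero, add_zero]
    exact (neg_nonpos.mpr (smul_nonneg (by positivity) he0)).trans hh⟩
  add_mem' := fun {δ₁ δ₂} h₁ h₂ η hη => by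
    obtain ⟨t₁, ht₁, H₁⟩ := h₁ (η / 2) (by linarith)
    obtain ⟨t₂, ht₂, H₂⟩ := h₂ (η / 2) (by linarith)
    refine ⟨min t₁ t₂ / 2, by positivity, fun t ht h hh => ?_⟩
    have h2t : |2 * t| < min t₁ t₂ := by rw [abs_mul, abs_two]; linarith
    have K₁ := H₁ (2 * t) (h2t.trans_le (min_le_left _ _)) h hh
    have K₂ := H₂ (2 * t) (h2t.trans_le (min_le_right _ _)) h hh
    have K := smul_le_smul_of_nonneg_left (add_le_add K₁ K₂) (by norm_num : (0 : ℝ) ≤ 1 / 2)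
    rw [abs_mul, abs_two] at K
    refine le_trans (le_of_eq ?_) (K.trans (le_of_eq ?_))
    · module
    · rw [add_apply]; module
  smul_mem' := fun c δ hδ η hη => by
    have hc : 0 < |c| + 1 := by positivity
    obtain ⟨t₀, ht₀, H⟩ := hδ (η / (|c| + 1)) (by positivity)
    refine ⟨t₀ / (|c| + 1), by positivity, fun t ht h hh => ?_⟩
    rw [lt_div_iff₀ hc] at ht
    have h1 : |t * c| < t₀ := by
      rw [abs_mul]; nlinarith [abs_nonneg t, abs_nonneg c]
    have K := H (t * c) h1 h hh
    rw [smul_apply, smul_smul]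
    refine le_trans (neg_le_neg (smul_le_smul_of_nonneg_right ?_ he0)) K
    refine mul_le_mul_of_nonneg_right ?_ (norm_nonneg _)
    rw [abs_mul, div_mul_eq_mul_div, div_le_iff₀ hc]
    have := mul_nonneg hη.le (abs_nonneg t)
    nlinarith

theorem mem_orderDerivations {he0 : 0 ≤ e} {δ : V →L[ℝ] V} :
    δ ∈ orderDerivations e he0 ↔ ∀ η : ℝ, 0 < η → ∃ t₀ : ℝ, 0 < t₀ ∧ ∀ t : ℝ, |t| < t₀ →
      ∀ h : V, 0 ≤ h → -((η * |t| * ‖h‖) • e) ≤ h + t • δ h := Iff.rfl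

theorem isClosed_orderDerivations (he : IsUnitNorm e) (he0 : 0 ≤ e) :
    IsClosed (orderDerivations e he0 : Set (V →L[ℝ] V)) := by
  refine isClosed_of_closure_subset fun δ hδ η hη => ?_
  obtain ⟨δ', hδ', hd⟩ := Metric.mem_closure_iff.mp hδ (η / 2) (by linarith)
  obtain ⟨t₀, ht₀, H⟩ := hδ' (η / 2) (by linarith)
  refine ⟨t₀, ht₀, fun t ht h hh => ?_⟩
  rw [dist_eq_norm] at hd
  have h1 : ‖t • (δ - δ') h‖ ≤ η / 2 * |t| * ‖h‖ := by
    rw [norm_smul, Real.norm_eq_abs]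
    have := (δ - δ').le_of_opNorm_le hd.le h
    have := mul_le_mul_of_nonneg_left this (abs_nonneg t)
    linarith
  have h2 := (he.obound h1).1
  have h3 := add_le_add (H t ht h hh) h2
  refine le_trans (le_of_eq ?_) (h3.trans (le_of_eq ?_))
  · module
  · rw [sub_apply]; module

/-- Apply almost positivity of `1 + t δ` to `‖h‖ e ± h ≥ 0`. Since `δ e = 0`, the unit is not moved
and a norm bound results. -/
theorem norm_add_smul_le_of_mem_orderDerivations (he : IsUnitNorm e) (he0 : 0 ≤ e)
    {δ : V →L[ℝ] V} (hδ : δ ∈ orderDerivations e he0) (hδe : δ e = 0) {η : ℝ} (hη : 0 < η) :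
    ∀ᶠ t in 𝓝[>] (0 : ℝ), ∀ h, ‖h + t • δ h‖ ≤ (1 + η * t) * ‖h‖ := by
  obtain ⟨t₀, ht₀, H⟩ := hδ (η / 2) (by linarith)
  filter_upwards [Ioo_mem_nhdsGT ht₀] with t ht h
  have ht' : |t| < t₀ := by rw [abs_of_pos ht.1]; exact ht.2
  have hb := he.obound (le_refl ‖h‖)
  have key : ∀ k : V, 0 ≤ k → ‖k‖ ≤ 2 * ‖h‖ → -((η * t * ‖h‖) • e) ≤ k + t • δ k := by
    intro k hk hkn
    refine le_trans (neg_le_neg (smul_le_smul_of_nonneg_right ?_ he0)) (H t ht' k hk)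
    rw [abs_of_pos ht.1]
    have := mul_le_mul_of_nonneg_left hkn (mul_nonneg hη.le ht.1.le)
    linarith
  have hen : ‖‖h‖ • e‖ ≤ ‖h‖ := by
    rw [norm_smul, norm_norm]
    exact mul_le_of_le_one_right (norm_nonneg _) he.norm_unit_le
  have k1 := key (‖h‖ • e + h) (by have := hb.1; rwa [neg_le_iff_add_nonneg'] at this)
    ((norm_add_le _ _).trans (by linarith))
  have k2 := key (‖h‖ • e - h) (sub_nonneg.mpr hb.2) ((norm_sub_le _ _).trans (by linarith))
  rw [map_add, _root_.map_smul, hδe, smul_zero, zero_add] at k1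
  rw [map_sub, _root_.map_smul, hδe, smul_zero, zero_sub] at k2
  refine (he.norm_le_iff _ _ (by have := ht.1; positivity)).mpr ⟨?_, ?_⟩
  · rw [← sub_nonneg] at k1 ⊢
    refine k1.trans (le_of_eq ?_)
    module
  · rw [← sub_nonneg] at k2 ⊢
    refine k2.trans (le_of_eq ?_)
    module

end OrderDerivation

namespace GaugeReversing

variable {V : Type*} [NormedAddCommGroup V] [NormedSpace ℝ V] [PartialOrder V]
  [IsOrderedAddMonoid V] [IsOrderedModule ℝ V] [CompleteOrder V] {e b p q : V} {S S' : V → V}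

theorem fderiv_smul_of_homogeneous {E : Type*} [NormedAddCommGroup E] [NormedSpace ℝ E]
    (he : IsUnitNorm e) {f : V → E} {s c : ℝ} (hs : s ≠ 0)
    (hf : ∀ p, IsUnitElt p → f (s • p) = c • f p) (hp : IsUnitElt p) :
    fderiv ℝ f (s • p) = (s⁻¹ * c) • fderiv ℝ f p := by
  have h1 : (fun x => f (s • x)) =ᶠ[𝓝 p] c • f := by
    filter_upwards [he.isOpen_units.mem_nhds hp] with y hy
    exact hf y hy
  have h2 := h1.fderiv_eq (𝕜 := ℝ)
  rw [fderiv_comp_smul, fderiv_const_smul_field] at h2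
  rw [mul_smul]
  have h3 : c • fderiv ℝ f p = s • fderiv ℝ f (s • p) := h2.symm
  rw [h3, smul_smul, inv_mul_cancel₀ hs, one_smul]

theorem quadRep_smul (h : GaugeReversing S S') (he : IsUnitNorm e) {s : ℝ} (hs : 0 < s)
    (hp : IsUnitElt p) : quadRep S (s • p) = (s * s) • quadRep S p := by
  rw [quadRep, h.map_smul hp hs, derivMap, fderiv_smul_of_homogeneous he (inv_ne_zero hs.ne')
    (fun q hq => by rw [h.map_smul hq (inv_pos.mpr hs)]) (h.map_unit hp), inv_inv, ← smul_neg]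
  rfl

section Base

variable [CompleteSpace V] (h : GaugeReversing S S') (he : IsUnitNorm e) (hSe : S e = e)
  (hder : HasFDerivAt S (-ContinuousLinearMap.id ℝ V) e)

include h he hSe hder

/-- The operator `P(p + t k) T(p)`, with `T(p) = P(p)⁻¹`, is positive for small `t` of either sign
and equals `1 + t DP(p)(k) T(p) + o(t)`. -/
theorem eventually_fderiv_quadRep_mul_mem :
    ∀ᶠ p in 𝓝 e, ∀ k, fderiv ℝ (quadRep S) p k * derivMap S p ∈
      orderDerivations e he.unit.nonneg := by
  have hd : ∀ᶠ p in 𝓝 e, DifferentiableAt ℝ (quadRep S) p :=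
    ((h.contDiffAt_quadRep he hSe hder 1).eventually (by simp)).mono
      fun p hp => hp.differentiableAt (by simp)
  filter_upwards [hd, h.eventually_near he hSe hder (1 / 10 ^ 7) (by norm_num)] with p hdp hp k
  rw [mem_orderDerivations]
  intro η hη
  have hpu := h.isUnitElt_near he hSe hder (p := p) (by linarith)
  have h1 : HasDerivAt (fun t : ℝ => quadRep S (p + t • k)) (fderiv ℝ (quadRep S) p k) 0 :=
    hdp.hasFDerivAt.hasLineDerivAt k
  have h2 := h1.isLittleO.def (c := η / 2) (by linarith)
  have hcont : ContinuousAt (fun t : ℝ => p + t • k) 0 := by fun_prop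
  have h3 : ∀ᶠ t : ℝ in 𝓝 0, IsUnitElt (p + t • k) :=
    hcont.eventually (he.isOpen_units.mem_nhds (by simpa using hpu))
  obtain ⟨t₀, ht₀, H⟩ := Metric.eventually_nhds_iff.mp (h2.and h3)
  refine ⟨t₀, ht₀, fun t ht v hv => ?_⟩
  obtain ⟨H1, H2⟩ := H (y := t) (by rwa [dist_zero_right])
  simp only [zero_smul, add_zero, sub_zero, Real.norm_eq_abs] at H1
  have hTp := h.norm_derivMap_le he hSe hder (p := p) (by linarith)
  set D := fderiv ℝ (quadRep S) p k
  have h4 : ‖(quadRep S (p + t • k) - quadRep S p - t • D) (derivMap S p v)‖ ≤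
      η * |t| * ‖v‖ := by
    have a1 := ContinuousLinearMap.le_of_opNorm_le _ H1 (derivMap S p v)
    have a2 := ContinuousLinearMap.le_of_opNorm_le _ hTp v
    have a3 := mul_le_mul_of_nonneg_left a2 (by positivity : 0 ≤ η / 2 * |t|)
    linarith
  have h5 := (he.obound h4).2
  have h6 := h.quadRep_nonneg he H2 (h.derivMap_nonneg he hpu hv)
  have h7 : quadRep S p (derivMap S p v) = v :=
    DFunLike.congr_fun (h.quadRep_mul_derivMap he hSe hder (p := p) (by linarith)) v
  rw [sub_apply, sub_apply, smul_apply, h7] at h5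
  rw [mul_apply_eq_comp, neg_le_iff_add_nonneg]
  refine h6.trans ?_
  rw [sub_sub, sub_le_iff_le_add] at h5
  exact h5.trans (le_of_eq (by abel))

/-- Differentiating `T P = 1` gives `DP(c) = -P DT(c) P`. As `T = -DS`, symmetry of the second
derivative swaps `DT(c)(P z)` and `DT(P z)(c)`, so the operator `c ↦ DP(c) z` acquires the form of
an order derivation. -/
theorem eventually_fderiv_quadRep_apply (z : V) :
    ∀ᶠ p in 𝓝 e, fderiv ℝ (fun p => quadRep S p z) p =
      fderiv ℝ (quadRep S) p (quadRep S p z) * derivMap S p := by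
  have hd : ∀ᶠ p in 𝓝 e, DifferentiableAt ℝ (quadRep S) p :=
    ((h.contDiffAt_quadRep he hSe hder 1).eventually (by simp)).mono
      fun p hp => hp.differentiableAt (by simp)
  have hdT : ∀ᶠ p in 𝓝 e, DifferentiableAt ℝ (derivMap S) p :=
    ((h.contDiffAt_derivMap he hSe hder 1).eventually (by simp)).mono
      fun p hp => hp.differentiableAt (by simp)
  have hTP : ∀ᶠ p in 𝓝 e, derivMap S p * quadRep S p = 1 := by
    filter_upwards [h.eventually_near he hSe hder (1 / 10 ^ 7) (by norm_num)] with p hp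
    exact h.derivMap_mul_quadRep he hSe hder hp
  filter_upwards [hd, hdT, hTP.eventually_nhds,
    h.eventually_near he hSe hder (1 / 10 ^ 7) (by norm_num)] with p hdp hdTp hTPp hp
  have hpu := h.isUnitElt_near he hSe hder (p := p) (by linarith)
  have hPT := h.quadRep_mul_derivMap he hSe hder (p := p) (by linarith)
  have hsymm : ∀ a c, fderiv ℝ (derivMap S) p a c = fderiv ℝ (derivMap S) p c a := by
    intro a c
    have hS : ∀ᶠ y in 𝓝 p, HasFDerivAt S (-derivMap S y) y := by
      filter_upwards [he.isOpen_units.mem_nhds hpu] with y hy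
      exact h.hasFDerivAt_derivMap he hy
    have := second_derivative_symmetric_of_eventually hS hdTp.hasFDerivAt.neg a c
    simpa using this
  have hprod : ∀ a, quadRep S p * (fderiv ℝ (derivMap S) p a) * quadRep S p +
      fderiv ℝ (quadRep S) p a = 0 := by
    intro a
    have e1 : HasFDerivAt (fun y => derivMap S y * quadRep S y) _ p :=
      hdTp.hasFDerivAt.mul' hdp.hasFDerivAt
    have e2 := DFunLike.congr_fun
      (e1.unique ((hasFDerivAt_const (1 : V →L[ℝ] V) p).congr_of_eventuallyEq hTPp)) a
    have e3 : derivMap S p * fderiv ℝ (quadRep S) p a +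
        fderiv ℝ (derivMap S) p a * quadRep S p = 0 := e2
    calc _ = quadRep S p * (derivMap S p * fderiv ℝ (quadRep S) p a +
          fderiv ℝ (derivMap S) p a * quadRep S p) := by
            rw [mul_add, ← mul_assoc, ← mul_assoc, hPT, one_mul, add_comm]
      _ = 0 := by rw [e3, mul_zero]
  have hR : HasFDerivAt (fun p => quadRep S p z) _ p :=
    hdp.hasFDerivAt.clm_apply (hasFDerivAt_const z p)
  rw [hR.fderiv]
  ext c
  have e1 := DFunLike.congr_fun (hprod c) z
  have e2 := DFunLike.congr_fun (hprod (quadRep S p z)) (derivMap S p c)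
  have e3 : quadRep S p (derivMap S p c) = c := DFunLike.congr_fun hPT c
  rw [add_apply, mul_apply_eq_comp, mul_apply_eq_comp] at e1 e2
  rw [e3, hsymm] at e2
  have e4 := add_left_cancel (e1.trans e2.symm)
  simpa using e4

/-- All derivatives of a map into a closed subspace stay in it; with symmetry of second derivatives,
every `D³R(a, k, ·)` is an order derivation, where `R(p) = P(p) z`. It kills `e` because `R` is
homogeneous of degree 2. So it generates contractions, and the infinitesimal Mazur–Ulam theorem
applies to the symmetric form `D³R(a, ·, ·)`. -/
theorem third_fderiv_quadRep_apply (z a k l : V) :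
    fderiv ℝ (fderiv ℝ (fun q => fderiv ℝ (fun p => quadRep S p z) q a)) e k l = 0 := by
  have he0 := he.unit.nonneg
  have hR : ContDiffAt ℝ 4 (fun p => quadRep S p z) e :=
    (h.contDiffAt_quadRep he hSe hder 4).clm_apply contDiffAt_const
  have hR1 : ContDiffAt ℝ 3 (fderiv ℝ (fun p => quadRep S p z)) e :=
    hR.fderiv_right (by norm_num)
  have hmem : ∀ᶠ p in 𝓝 e, fderiv ℝ (fun p => quadRep S p z) p ∈ orderDerivations e he0 := by
    filter_upwards [h.eventually_fderiv_quadRep_mul_mem he hSe hder,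
      h.eventually_fderiv_quadRep_apply he hSe hder z] with p h1 h2
    rw [h2]; exact h1 _
  have hcl := isClosed_orderDerivations he he0
  set g : V → V := fun q => fderiv ℝ (fun p => quadRep S p z) q a with hg
  have hgc : ContDiffAt ℝ 3 g e := hR1.clm_apply contDiffAt_const
  have hmem2 : ∀ᶠ q in 𝓝 e, fderiv ℝ g q ∈ orderDerivations e he0 := by
    filter_upwards [hR.eventually (by simp), hR1.eventually (by simp), hmem.eventually_nhds]
      with q h1 h2 h3
    have hdq : DifferentiableAt ℝ (fderiv ℝ (fun p => quadRep S p z)) q :=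
      h2.differentiableAt (by simp)
    have hsymm := h1.isSymmSndFDerivAt (by simp; norm_num)
    have : fderiv ℝ g q = fderiv ℝ (fderiv ℝ (fun p => quadRep S p z)) q a := by
      ext c
      have h4 : HasFDerivAt g _ q := hdq.hasFDerivAt.clm_apply (hasFDerivAt_const a q)
      rw [h4.fderiv]
      simpa using hsymm c a
    rw [this]
    exact fderiv_mem_of_eventually_mem hcl hdq h3 a
  have hg2 : DifferentiableAt ℝ (fderiv ℝ g) e :=
    (hgc.fderiv_right (m := 2) (by norm_num)).differentiableAt (by simp)
  have hsymm := hgc.isSymmSndFDerivAt (by simp; norm_num)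
  have hBmem : ∀ k, fderiv ℝ (fderiv ℝ g) e k ∈ orderDerivations e he0 := fun k =>
    fderiv_mem_of_eventually_mem hcl hg2 hmem2 k
  have hhom : ∀ s : ℝ, 0 < s → fderiv ℝ g (s • e) = fderiv ℝ g e := by
    intro s hs
    have h1 : ∀ p, IsUnitElt p → quadRep S (s • p) z = (s * s) • quadRep S p z := fun p hp => by
      rw [h.quadRep_smul he hs hp, smul_apply]
    have h2 : ∀ p, IsUnitElt p → g (s • p) = (s⁻¹ * (s * s)) • g p := fun p hp => by
      simp only [hg]
      rw [fderiv_smul_of_homogeneous he hs.ne' h1 hp, smul_apply]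
    rw [fderiv_smul_of_homogeneous he hs.ne' h2 he.unit, inv_mul_cancel_left₀ hs.ne',
      inv_mul_cancel₀ hs.ne', one_smul]
  have hBe : fderiv ℝ (fderiv ℝ g) e e = 0 := by
    have h1 : HasDerivAt (fun t : ℝ => fderiv ℝ g (e + t • e)) (fderiv ℝ (fderiv ℝ g) e e) 0 :=
      hg2.hasFDerivAt.hasLineDerivAt e
    refine h1.unique ((hasDerivAt_const (0 : ℝ) (fderiv ℝ g e)).congr_of_eventuallyEq ?_)
    filter_upwards [Ioi_mem_nhds (by norm_num : (-1 : ℝ) < 0)] with t ht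
    have : e + t • e = (1 + t) • e := by module
    rw [this, hhom _ (by have : -1 < t := ht; linarith)]
  refine bilin_eq_zero_of_exp_contraction (fderiv ℝ (fderiv ℝ g) e) (fun k l => hsymm k l)
    (fun k l => ?_) k l
  have hke : fderiv ℝ (fderiv ℝ g) e k e = 0 := by rw [hsymm k e, hBe, zero_apply]
  have := norm_exp_smul_apply_le (A := fderiv ℝ (fderiv ℝ g) e k) (h := l) (t := 1)
    (fun η hη => norm_add_smul_le_of_mem_orderDerivations he he0 (hBmem k) hke hη) zero_le_one
  rwa [one_smul] at this

end Base
end GaugeReversing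
end GaugeReversal

/-! ### Calculus of one real variable -/

namespace GaugeReversal

section Scalar

theorem eq_const_add_of_hasDerivAt {F H F' : ℝ → ℝ} {I : Set ℝ} (hI : IsOpen I)
    (hIc : Convex ℝ I) (hF : ∀ t ∈ I, HasDerivAt F (F' t) t) (hH : ∀ t ∈ I, HasDerivAt H (F' t) t)
    {t s : ℝ} (ht : t ∈ I) (hs : s ∈ I) : F t - H t = F s - H s := by
  have hd : ∀ t ∈ I, HasDerivAt (fun t => F t - H t) 0 t := fun t ht => by
    simpa using (hF t ht).fun_sub (hH t ht)
  exact hI.is_const_of_deriv_eq_zero hIc.isPreconnected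
    (fun t ht => (hd t ht).differentiableAt.differentiableWithinAt)
    (fun t ht => (hd t ht).deriv) ht hs

theorem contDiffAt_deriv {f : ℝ → ℝ} {t : ℝ} {m n : WithTop ℕ∞} (hf : ContDiffAt ℝ n f t)
    (hmn : m + 1 ≤ n) : ContDiffAt ℝ m (deriv f) t :=
  (hf.fderiv_right hmn).clm_apply (contDiffAt_const (c := (1 : ℝ)))

theorem exists_quadratic_of_third_deriv_eq_zero {f : ℝ → ℝ} {I : Set ℝ} (hI : IsOpen I)
    (hIc : Convex ℝ I) (h0 : (0 : ℝ) ∈ I) (hf : ∀ t ∈ I, ContDiffAt ℝ 3 f t)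
    (hf3 : ∀ t ∈ I, deriv (deriv (deriv f)) t = 0) :
    ∃ c : ℝ, ∀ t ∈ I, f t = f 0 + deriv f 0 * t + c * t ^ 2 := by
  have h1 : ∀ t ∈ I, HasDerivAt f (deriv f t) t := fun t ht =>
    ((hf t ht).differentiableAt (by simp)).hasDerivAt
  have c2 : ∀ t ∈ I, ContDiffAt ℝ 2 (deriv f) t := fun t ht => contDiffAt_deriv (hf t ht) (by norm_num)
  have h2 : ∀ t ∈ I, HasDerivAt (deriv f) (deriv (deriv f) t) t := fun t ht =>
    ((c2 t ht).differentiableAt (by simp)).hasDerivAt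
  have h3 : ∀ t ∈ I, HasDerivAt (deriv (deriv f)) 0 t := fun t ht => by
    have := (contDiffAt_deriv (m := 1) (c2 t ht) (by norm_num)).differentiableAt (by simp)
    rw [← hf3 t ht]
    exact this.hasDerivAt
  set d := deriv (deriv f) 0 with hd
  have k2 : ∀ t ∈ I, deriv (deriv f) t = d := fun t ht => by
    have := eq_const_add_of_hasDerivAt hI hIc h3 (H := fun _ => 0)
      (fun t _ => hasDerivAt_const t 0) ht h0
    simpa using this
  have k1 : ∀ t ∈ I, deriv f t = deriv f 0 + d * t := fun t ht => by
    have := eq_const_add_of_hasDerivAt hI hIc h2 (H := fun t => d * t)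
      (fun t ht => by rw [k2 t ht]; simpa using (hasDerivAt_id t).const_mul d) ht h0
    simp only [mul_zero, sub_zero] at this
    linarith
  refine ⟨d / 2, fun t ht => ?_⟩
  have := eq_const_add_of_hasDerivAt hI hIc h1 (H := fun t => deriv f 0 * t + d / 2 * t ^ 2)
    (fun t ht => by
      rw [k1 t ht]
      have := ((hasDerivAt_id t).const_mul (deriv f 0)).fun_add
        (((hasDerivAt_id t).pow 2).const_mul (d / 2))
      refine this.congr_deriv ?_
      norm_num
      ring) ht h0
  simp only [mul_zero, ne_eq, OfNat.ofNat_ne_zero, not_false_eq_true, zero_pow, add_zero,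
    sub_zero] at this
  linarith

end Scalar
end GaugeReversal

/-! ### Normalization at a base point, and third derivatives along lines -/

namespace GaugeReversal

section Line

variable {V E : Type*} [NormedAddCommGroup V] [NormedSpace ℝ V] [NormedAddCommGroup E]
  [NormedSpace ℝ E]

theorem tendsto_line (x q : V) (t₀ : ℝ) :
    Tendsto (fun t : ℝ => x + (t - t₀) • q) (𝓝 t₀) (𝓝 x) := by
  have : ContinuousAt (fun t : ℝ => x + (t - t₀) • q) t₀ := by fun_prop
  simpa using this.tendsto

theorem hasDerivAt_comp_line {F : V → E} {x q : V} {t t₀ : ℝ}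
    (hF : DifferentiableAt ℝ F (x + (t - t₀) • q)) (L : E →L[ℝ] ℝ) :
    HasDerivAt (fun t : ℝ => L (F (x + (t - t₀) • q))) (L (fderiv ℝ F (x + (t - t₀) • q) q)) t := by
  have h1 : HasDerivAt (fun t : ℝ => x + (t - t₀) • q) q t := by
    have := (((hasDerivAt_id t).sub_const t₀).smul_const q).const_add x
    simpa using this
  exact L.hasFDerivAt.comp_hasDerivAt t (hF.hasFDerivAt.comp_hasDerivAt t h1)

theorem eventually_deriv_comp_line {F : V → E} {x q : V} {t₀ : ℝ}
    (hF : ContDiffAt ℝ 1 F x) (L : E →L[ℝ] ℝ) :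
    deriv (fun t : ℝ => L (F (x + (t - t₀) • q))) =ᶠ[𝓝 t₀]
      fun t => L (fderiv ℝ F (x + (t - t₀) • q) q) := by
  have h1 : ∀ᶠ p in 𝓝 x, DifferentiableAt ℝ F p :=
    (hF.eventually (by simp)).mono fun p hp => hp.differentiableAt (by simp)
  filter_upwards [(tendsto_line x q t₀).eventually h1] with t ht
  exact (hasDerivAt_comp_line ht L).deriv

end Line

namespace GaugeReversing

section Normed

variable {V W : Type*} [NormedAddCommGroup V] [NormedSpace ℝ V] [PartialOrder V]
  [IsOrderedAddMonoid V] [IsOrderedModule ℝ V] [CompleteOrder V]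
  [NormedAddCommGroup W] [NormedSpace ℝ W] [PartialOrder W]
  [IsOrderedAddMonoid W] [IsOrderedModule ℝ W] [CompleteOrder W]
  {Φ : V → W} {Ψ : W → V} {e x : V} {f : W}

theorem taylorMap_taylorMap_of_norm (h : GaugeReversing Φ Ψ) (he : IsUnitNorm e)
    (hf : IsUnitNorm f) (hx : IsUnitElt x) (y : V) :
    taylorMap Ψ (Φ x) (taylorMap Φ x y) = y := by
  have hu := h.map_unit hx
  have h1 : HasFDerivAt (Ψ ∘ Φ) _ x :=
    HasFDerivAt.comp x (h.symm.hasFDerivAt hf he hu) (h.hasFDerivAt he hf hx)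
  have h2 : (Ψ ∘ Φ) =ᶠ[𝓝 x] id := by
    filter_upwards [he.isOpen_units.mem_nhds hx] with p hp
    exact h.left_inv hp
  have h3 := DFunLike.congr_fun (h1.unique ((hasFDerivAt_id x).congr_of_eventuallyEq h2)) y
  rw [ContinuousLinearMap.comp_apply, h.fderiv_apply he hf hx, h.symm.fderiv_apply hf he hu,
    map_neg, neg_neg] at h3
  exact h3

/-- Composing with the inverse derivative at `e` gives a self-map of `V` that fixes `e` and has
derivative `-1` there, so the local theory applies at every base point of every `Φ`. -/
theorem normalization_spec (h : GaugeReversing Φ Ψ) (he : IsUnitNorm e) (hf : IsUnitNorm f) :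
    GaugeReversing (fun p => taylorMap Ψ (Φ e) (Φ p)) (fun p => Ψ (taylorMap Φ e p)) ∧
      taylorMap Ψ (Φ e) (Φ e) = e ∧
      HasFDerivAt (fun p => taylorMap Ψ (Φ e) (Φ p)) (-ContinuousLinearMap.id ℝ V) e ∧
      ∀ p, IsUnitElt p → ∀ y, derivMap (fun p => taylorMap Ψ (Φ e) (Φ p)) p y =
        taylorMap Ψ (Φ e) (taylorMap Φ p y) := by
  have hu := h.map_unit he.unit
  have hTΦ := h.isTaylorMap_taylorMap he.unit
  have hTΨ := h.symm.isTaylorMap_taylorMap hu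
  have hd : ∀ p, IsUnitElt p → HasFDerivAt (fun p => taylorMap Ψ (Φ e) (Φ p))
      ((-fderiv ℝ Ψ (Φ e)).comp (fderiv ℝ Φ p)) p := fun p hp => by
    refine ((-fderiv ℝ Ψ (Φ e)).hasFDerivAt.comp p (h.hasFDerivAt he hf hp)).congr_of_eventuallyEq
      (Eventually.of_forall fun y => ?_)
    change _ = (-fderiv ℝ Ψ (Φ e)) (Φ y)
    rw [neg_apply, h.symm.fderiv_apply hf he hu, neg_neg]
  have hda : ∀ p, IsUnitElt p → ∀ y, ((-fderiv ℝ Ψ (Φ e)).comp (fderiv ℝ Φ p)) y =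
      -taylorMap Ψ (Φ e) (taylorMap Φ p y) := fun p hp y => by
    rw [ContinuousLinearMap.comp_apply, neg_apply, h.symm.fderiv_apply hf he hu, neg_neg,
      h.fderiv_apply he hf hp, map_neg]
  refine ⟨?_, ?_, ?_, fun p hp y => ?_⟩
  · refine h.comp_linear (taylorMap Ψ (Φ e)) (taylorMap Φ e)
      (h.taylorMap_taylorMap_of_norm he hf he.unit) (fun y => ?_) hTΨ.map_nonneg hTΦ.map_nonneg
    have := h.symm.taylorMap_taylorMap_of_norm hf he hu y
    rwa [h.left_inv he.unit] at this
  · rw [hTΨ.map_self, h.left_inv he.unit]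
  · convert hd e he.unit using 1
    ext y
    rw [hda e he.unit, h.taylorMap_taylorMap_of_norm he hf he.unit]
    rfl
  · rw [derivMap, (hd p hp).fderiv, neg_apply, hda p hp, neg_neg]

theorem eventually_taylorMap_eq_quadRep (h : GaugeReversing Φ Ψ) (he : IsUnitNorm e)
    (hf : IsUnitNorm f) (w : W) :
    ∀ᶠ p in 𝓝 e, taylorMap Ψ (Φ p) w =
      quadRep (fun p => taylorMap Ψ (Φ e) (Φ p)) p (taylorMap Ψ (Φ e) w) := by
  have := he.completeSpace
  obtain ⟨hS, hSe, hSd, hSt⟩ := h.normalization_spec he hf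
  filter_upwards [hS.eventually_near he hSe hSd (1 / 10 ^ 7) (by norm_num)] with p hp
  have hpu := hS.isUnitElt_near he hSe hSd (p := p) (by linarith)
  have h1 := DFunLike.congr_fun (hS.quadRep_mul_derivMap he hSe hSd (p := p) (by linarith))
    (taylorMap Ψ (Φ p) w)
  rw [mul_apply_eq_comp, hSt p hpu] at h1
  have h2 := h.symm.taylorMap_taylorMap_of_norm hf he (h.map_unit hpu) w
  rw [h.left_inv hpu] at h2
  rw [h2] at h1
  exact h1.symm

theorem cubic_of_norm (h : GaugeReversing Φ Ψ) (he : IsUnitNorm e) (hf : IsUnitNorm f)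
    (L : V →L[ℝ] ℝ) (q : V) (w : W) (t₀ : ℝ) :
    ContDiffAt ℝ 3 (fun t : ℝ => L (taylorMap Ψ (Φ (e + (t - t₀) • q)) w)) t₀ ∧
      deriv (deriv (deriv (fun t : ℝ => L (taylorMap Ψ (Φ (e + (t - t₀) • q)) w)))) t₀ = 0 ∧
      (w = Φ e →
        deriv (fun t : ℝ => L (taylorMap Ψ (Φ (e + (t - t₀) • q)) w)) t₀ = 2 * L q) := by
  have := he.completeSpace
  obtain ⟨hS, hSe, hSd, hSt⟩ := h.normalization_spec he hf
  have hev := h.eventually_taylorMap_eq_quadRep he hf w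
  set S : V → V := fun p => taylorMap Ψ (Φ e) (Φ p) with hSdef
  set z := taylorMap Ψ (Φ e) w with hz
  have hR : ContDiffAt ℝ 4 (fun p => quadRep S p z) e :=
    (hS.contDiffAt_quadRep he hSe hSd 4).clm_apply contDiffAt_const
  have hR1 : ContDiffAt ℝ 3 (fderiv ℝ (fun p => quadRep S p z)) e :=
    hR.fderiv_right (by norm_num)
  have hg : ContDiffAt ℝ 3 (fun p => fderiv ℝ (fun p => quadRep S p z) p q) e :=
    hR1.clm_apply contDiffAt_const
  have hg1 : ContDiffAt ℝ 2 (fderiv ℝ (fun p => fderiv ℝ (fun p => quadRep S p z) p q)) e :=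
    hg.fderiv_right (by norm_num)
  have hg2 : ContDiffAt ℝ 2
      (fun p => fderiv ℝ (fun p => fderiv ℝ (fun p => quadRep S p z) p q) p q) e :=
    hg1.clm_apply contDiffAt_const
  have e0 : (fun t : ℝ => L (taylorMap Ψ (Φ (e + (t - t₀) • q)) w)) =ᶠ[𝓝 t₀]
      fun t : ℝ => L (quadRep S (e + (t - t₀) • q) z) := by
    filter_upwards [(tendsto_line e q t₀).eventually hev] with t ht
    rw [ht]
  have e1 := e0.deriv.trans (eventually_deriv_comp_line (q := q) (t₀ := t₀)
    (hR.of_le (by norm_num)) L)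
  have e2 := e1.deriv.trans (eventually_deriv_comp_line (q := q) (t₀ := t₀)
    (hg.of_le (by norm_num)) L)
  have e3 := e2.deriv.trans (eventually_deriv_comp_line (q := q) (t₀ := t₀)
    (hg2.of_le (by norm_num)) L)
  refine ⟨ContDiffAt.congr_of_eventuallyEq ?_ e0, ?_, fun hw => ?_⟩
  · have h1 : ContDiffAt ℝ 3 (fun t : ℝ => e + (t - t₀) • q) t₀ := by fun_prop
    have h2 : ContDiffAt ℝ 3 (fun p => quadRep S p z) (e + (t₀ - t₀) • q) := by
      rw [sub_self, zero_smul, add_zero]; exact hR.of_le (by norm_num)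
    have h3 := ContDiffAt.comp (g := fun p => quadRep S p z) t₀ h2 h1
    exact ContDiffAt.comp (g := L) t₀ L.contDiff.contDiffAt h3
  · rw [e3.self_of_nhds]
    simp only [sub_self, zero_smul, add_zero]
    have h1 : HasFDerivAt
        (fun p => fderiv ℝ (fun p => fderiv ℝ (fun p => quadRep S p z) p q) p q) _ e :=
      (hg1.differentiableAt (by simp)).hasFDerivAt.clm_apply (hasFDerivAt_const q e)
    rw [h1.fderiv]
    have h2 := hS.third_fderiv_quadRep_apply he hSe hSd z q q q
    simp [h2]
  · rw [e1.self_of_nhds]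
    simp only [sub_self, zero_smul, add_zero]
    have hze : z = e := by rw [hz, hw]; exact hSe
    rw [hze]
    have h1 : HasFDerivAt (fun p => quadRep S p e) _ e :=
      ((hS.contDiffAt_quadRep he hSe hSd 1).differentiableAt (by simp)).hasFDerivAt.clm_apply
        (hasFDerivAt_const e e)
    rw [h1.fderiv]
    simp [hS.fderiv_quadRep_base_apply he hSe hSd q]

end Normed

variable {V W : Type*} [AddCommGroup V] [PartialOrder V] [IsOrderedAddMonoid V] [Module ℝ V]
  [IsOrderedModule ℝ V] [CompleteOrder V] [AddCommGroup W] [PartialOrder W]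
  [IsOrderedAddMonoid W] [Module ℝ W] [IsOrderedModule ℝ W] [CompleteOrder W]
  {Φ : V → W} {Ψ : W → V} {x : V}

theorem taylorMap_taylorMap (h : GaugeReversing Φ Ψ) (hx : IsUnitElt x) (y : V) :
    taylorMap Ψ (Φ x) (taylorMap Φ x y) = y := by
  have hu := h.map_unit hx
  have hxn := isUnitNorm_unitNormed x hx
  have hun := isUnitNorm_unitNormed (Φ x) hu
  let _ := unitNormed x hx
  let _ := unitNormedSpace x hx
  let _ := unitNormed (Φ x) hu
  let _ := unitNormedSpace (Φ x) hu
  exact h.taylorMap_taylorMap_of_norm hxn hun hx y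

/-- Linear functionals that are continuous for the order unit norms. -/
def _root_.GaugeReversal.IsBoundedFunctional (l : V →ₗ[ℝ] ℝ) : Prop :=
  ∃ u : V, IsUnitElt u ∧ ∃ C : ℝ, 0 ≤ C ∧ ∀ (t : ℝ) (k : V), 0 ≤ t → OBound u t k → |l k| ≤ C * t

/-- The conclusion concerns a real function only, so the norm may be chosen afresh at each point of
a line. A functional bounded for one order unit norm is bounded for all. The shift `t₀` makes the
base point correspond to parameter `t₀`. -/
theorem cubic (h : GaugeReversing Φ Ψ) (hx : IsUnitElt x) {l : V →ₗ[ℝ] ℝ}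
    (hl : IsBoundedFunctional l) (q : V) (w : W) (t₀ : ℝ) :
    ContDiffAt ℝ 3 (fun t : ℝ => l (taylorMap Ψ (Φ (x + (t - t₀) • q)) w)) t₀ ∧
      deriv (deriv (deriv (fun t : ℝ => l (taylorMap Ψ (Φ (x + (t - t₀) • q)) w)))) t₀ = 0 ∧
      (w = Φ x →
        deriv (fun t : ℝ => l (taylorMap Ψ (Φ (x + (t - t₀) • q)) w)) t₀ = 2 * l q) := by
  have hu := h.map_unit hx
  have hxn := isUnitNorm_unitNormed x hx
  have hun := isUnitNorm_unitNormed (Φ x) hu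
  let _ := unitNormed x hx
  let _ := unitNormedSpace x hx
  let _ := unitNormed (Φ x) hu
  let _ := unitNormedSpace (Φ x) hu
  obtain ⟨v, hv, C, hC, hb⟩ := hl
  obtain ⟨c, hc, hxc⟩ := hv x
  have hln : ∀ k, ‖l k‖ ≤ C * c * ‖k‖ := fun k => by
    have := hb (‖k‖ * c) k (by positivity)
      ((hxn.obound (le_refl ‖k‖)).change hxc (norm_nonneg k) hv.nonneg le_rfl)
    rw [Real.norm_eq_abs]
    linarith
  exact h.cubic_of_norm hxn hun (l.mkContinuous _ hln) q w t₀

end GaugeReversing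
end GaugeReversal

/-! ### The reflection identity -/

namespace GaugeReversal

theorem convex_units (V : Type*) [AddCommGroup V] [PartialOrder V] [IsOrderedAddMonoid V]
    [Module ℝ V] [IsOrderedModule ℝ V] [CompleteOrder V] : Convex ℝ {p : V | IsUnitElt p} := by
  intro p hp q hq a b ha hb hab
  have hp' : IsUnitElt p := hp
  have hq' : IsUnitElt q := hq
  rcases ha.eq_or_lt with rfl | ha'
  · have : b = 1 := by linarith
    subst this
    simpa using hq
  · exact (hp'.smul ha').of_le (le_add_of_nonneg_right (_root_.smul_nonneg hb hq'.nonneg))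

namespace GaugeReversing

section Normed

variable {V W : Type*} [NormedAddCommGroup V] [NormedSpace ℝ V] [PartialOrder V]
  [IsOrderedAddMonoid V] [IsOrderedModule ℝ V] [CompleteOrder V]
  [NormedAddCommGroup W] [NormedSpace ℝ W] [PartialOrder W]
  [IsOrderedAddMonoid W] [IsOrderedModule ℝ W] [CompleteOrder W]
  {Φ : V → W} {Ψ : W → V} {e x : V} {f : W}

theorem taylorMap_smul_of_norm (h : GaugeReversing Φ Ψ) (he : IsUnitNorm e)
    (hf : IsUnitNorm f) (hx : IsUnitElt x) {s : ℝ} (hs : 0 < s) (y : V) :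
    taylorMap Φ (s • x) y = (s⁻¹ * s⁻¹) • taylorMap Φ x y := by
  have h1 := DFunLike.congr_fun (fderiv_smul_of_homogeneous he hs.ne'
    (fun p hp => h.map_smul hp hs) hx) y
  rw [smul_apply, h.fderiv_apply he hf hx, h.fderiv_apply he hf (hx.smul hs), smul_neg,
    neg_inj] at h1
  exact h1

end Normed

variable {V W : Type*} [AddCommGroup V] [PartialOrder V] [IsOrderedAddMonoid V] [Module ℝ V]
  [IsOrderedModule ℝ V] [CompleteOrder V] [AddCommGroup W] [PartialOrder W]
  [IsOrderedAddMonoid W] [Module ℝ W] [IsOrderedModule ℝ W] [CompleteOrder W]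
  {Φ : V → W} {Ψ : W → V} {x : V} {q : W}

theorem taylorMap_smul (h : GaugeReversing Φ Ψ) (hx : IsUnitElt x) {s : ℝ} (hs : 0 < s) (y : V) :
    taylorMap Φ (s • x) y = (s⁻¹ * s⁻¹) • taylorMap Φ x y := by
  have hu := h.map_unit hx
  have hxn := isUnitNorm_unitNormed x hx
  have hun := isUnitNorm_unitNormed (Φ x) hu
  let _ := unitNormed x hx
  let _ := unitNormedSpace x hx
  let _ := unitNormed (Φ x) hu
  let _ := unitNormedSpace (Φ x) hu
  exact h.taylorMap_smul_of_norm hxn hun hx hs y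

/-- In Jordan terms, with `u = x⁻¹`, this expands `P(u - q) x` using `P(u) x = u`. The function `f`
is a quadratic polynomial on the whole interval `I`, which contains `-1`. Its value and slope at `0`
are known, and the leading coefficient comes from its behaviour at infinity. -/
theorem reflection_identity_apply (h : GaugeReversing Φ Ψ) (hx : IsUnitElt x) (hq : IsUnitElt q)
    (hxq : IsUnitElt (Φ x - q)) {l : W →ₗ[ℝ] ℝ} (hl : IsBoundedFunctional l) :
    l (taylorMap Φ (Ψ (Φ x - q)) x) = l (Φ x) - 2 * l q + l (taylorMap Φ (Ψ q) x) := by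
  have hu := h.map_unit hx
  have hun := isUnitNorm_unitNormed (Φ x) hu
  set u := Φ x with hudef
  set f : ℝ → ℝ := fun t => l (taylorMap Φ (Ψ (u + t • q)) x) with hf
  set I : Set ℝ := {t | IsUnitElt (u + t • q)} with hI
  have hIo : IsOpen I := by
    let _ := unitNormed u hu
    let _ := unitNormedSpace u hu
    exact hun.isOpen_units.preimage (f := fun t : ℝ => u + t • q) (by fun_prop)
  have hIc : Convex ℝ I := fun t ht s hs a b ha hb hab => by
    have := convex_units W (x := u + t • q) ht (y := u + s • q) hs ha hb hab
    have e1 : a • (u + t • q) + b • (u + s • q) = (a + b) • u + (a • t + b • s) • q := by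
      rw [smul_eq_mul, smul_eq_mul]; module
    rw [e1, hab, one_smul] at this
    exact this
  have h0 : (0 : ℝ) ∈ I := by
    change IsUnitElt (u + (0 : ℝ) • q); rwa [zero_smul, add_zero]
  have hm1 : (-1 : ℝ) ∈ I := by
    change IsUnitElt (u + (-1 : ℝ) • q); rwa [neg_one_smul, ← sub_eq_add_neg]
  have hpos : ∀ t : ℝ, 0 < t → t ∈ I := fun t ht =>
    hu.of_le (le_add_of_nonneg_right (_root_.smul_nonneg ht.le hq.nonneg))
  have hfs : ∀ t₀ : ℝ, (fun t : ℝ => l (taylorMap Φ (Ψ (u + t₀ • q + (t - t₀) • q)) x)) = f :=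
    fun t₀ => by
      funext t
      have : u + t₀ • q + (t - t₀) • q = u + t • q := by module
      simp only [hf, this]
  obtain ⟨c, hc⟩ := exists_quadratic_of_third_deriv_eq_zero hIo hIc h0
    (fun t ht => by
      have := (h.symm.cubic (x := u + t • q) ht hl q x t).1
      rwa [hfs t] at this)
    (fun t ht => by
      have := (h.symm.cubic (x := u + t • q) ht hl q x t).2.1
      rwa [hfs t] at this)
  have hf0 : f 0 = l u := by
    simp only [hf, zero_smul, add_zero]
    rw [hudef, h.left_inv hx, (h.isTaylorMap_taylorMap hx).map_self]
  have hf' : deriv f 0 = 2 * l q := by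
    have := (h.symm.cubic (x := u + (0 : ℝ) • q) h0 hl q x 0).2.2
    rw [hfs 0, zero_smul, add_zero] at this
    exact this (h.left_inv hx).symm
  -- By homogeneity `g s = s² f(s⁻¹)` for `s > 0`. Continuity of `g` at `0` identifies the
  -- coefficient `c` with `g 0`.
  set g : ℝ → ℝ := fun s => l (taylorMap Φ (Ψ (q + s • u)) x) with hg
  have hgc : ContinuousAt g 0 := by
    have := (h.symm.cubic hq hl u x 0).1.continuousAt
    simpa only [sub_zero] using this
  have hgs : ∀ s : ℝ, 0 < s → g s = f 0 * s ^ 2 + deriv f 0 * s + c := by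
    intro s hs
    have e1 : u + s⁻¹ • q = s⁻¹ • (q + s • u) := by
      rw [smul_add, smul_smul, inv_mul_cancel₀ hs.ne', one_smul, add_comm]
    have hqu : IsUnitElt (q + s • u) :=
      hq.of_le (le_add_of_nonneg_right (_root_.smul_nonneg hs.le hu.nonneg))
    have e2 : f s⁻¹ = s⁻¹ * s⁻¹ * g s := by
      simp only [hf, hg]
      rw [e1, h.symm.map_smul hqu (inv_pos.mpr hs), inv_inv, h.taylorMap_smul (h.inv_unit hqu) hs,
        _root_.map_smul, smul_eq_mul]
    have e3 := hc _ (hpos _ (inv_pos.mpr hs))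
    rw [e2] at e3
    field_simp at e3
    linarith
  have hcg : c = g 0 := by
    have t1 : Tendsto g (𝓝[>] 0) (𝓝 (g 0)) := hgc.tendsto.mono_left nhdsWithin_le_nhds
    have t2 : Tendsto (fun s : ℝ => f 0 * s ^ 2 + deriv f 0 * s + c) (𝓝[>] 0) (𝓝 c) := by
      have : Continuous fun s : ℝ => f 0 * s ^ 2 + deriv f 0 * s + c := by fun_prop
      have := (this.tendsto 0).mono_left (nhdsWithin_le_nhds (s := Set.Ioi 0))
      simpa using this
    refine tendsto_nhds_unique (t2.congr' ?_) t1
    filter_upwards [self_mem_nhdsWithin] with s hs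
    exact (hgs s hs).symm
  have hfin := hc _ hm1
  have e1 : f (-1) = l (taylorMap Φ (Ψ (u - q)) x) := by
    simp only [hf, neg_one_smul, sub_eq_add_neg]
  have e2 : g 0 = l (taylorMap Φ (Ψ q) x) := by simp only [hg, zero_smul, add_zero]
  rw [← e1, ← e2, hfin, hf0, hf', hcg]
  ring

theorem reflection_identity (h : GaugeReversing Φ Ψ) (hx : IsUnitElt x) (hq : IsUnitElt q)
    (hxq : IsUnitElt (Φ x - q)) :
    taylorMap Φ (Ψ (Φ x - q)) x = Φ x - (2 : ℝ) • q + taylorMap Φ (Ψ q) x := by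
  have hu := h.map_unit hx
  have hun := isUnitNorm_unitNormed (Φ x) hu
  have key := fun l hl => h.reflection_identity_apply hx hq hxq (l := l) hl
  set u := Φ x
  let _ := unitNormed u hu
  let _ := unitNormedSpace u hu
  rw [← sub_eq_zero]
  set d := taylorMap Φ (Ψ (u - q)) x - (u - (2 : ℝ) • q + taylorMap Φ (Ψ q) x) with hd
  obtain ⟨g, -, hg⟩ := exists_dual_vector'' ℝ d
  have hb : IsBoundedFunctional g.toLinearMap :=
    ⟨u, hu, ‖g‖, norm_nonneg _, fun t k ht hk => by
      have := g.le_opNorm k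
      rw [Real.norm_eq_abs] at this
      exact this.trans (mul_le_mul_of_nonneg_left (hun.norm_le ht hk) (norm_nonneg _))⟩
  have h1 := key _ hb
  have h2 : g d = 0 := by
    rw [hd, map_sub, map_add, map_sub, _root_.map_smul, smul_eq_mul]
    rw [sub_eq_zero]
    exact h1
  rw [h2] at hg
  exact norm_eq_zero.mp (by exact_mod_cast hg.symm)

end GaugeReversing
end GaugeReversal

/-! ### Hua's identity and the sharp estimate -/

namespace GaugeReversal

namespace GaugeReversing

section Plain

variable {V W : Type*} [AddCommGroup V] [PartialOrder V] [IsOrderedAddMonoid V] [Module ℝ V]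
  [IsOrderedModule ℝ V] [CompleteOrder V] [AddCommGroup W] [PartialOrder W]
  [IsOrderedAddMonoid W] [Module ℝ W] [IsOrderedModule ℝ W] [CompleteOrder W]
  {Φ : V → W} {Ψ : W → V} {x y : V} {q : W}

theorem isUnitElt_map_sub_map_add (h : GaugeReversing Φ Ψ) (hx : IsUnitElt x)
    (hy : IsUnitElt y) : IsUnitElt (Φ x - Φ (x + y)) := by
  obtain ⟨s, hs, hxy⟩ := hy x
  have hs' : 0 < s⁻¹ := inv_pos.mpr hs
  have h1 : (1 + s⁻¹) • x ≤ x + y := by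
    rw [add_smul, one_smul]
    refine add_le_add_right ?_ x
    rwa [← smul_le_smul_iff_pos hs, smul_smul, mul_inv_cancel₀ hs.ne', one_smul]
  have h2 := h.antitone (hx.smul (by linarith)) h1
  rw [h.map_smul hx (by linarith)] at h2
  have h3 : (1 - (1 + s⁻¹)⁻¹) • Φ x ≤ Φ x - Φ (x + y) := by
    rw [sub_smul, one_smul]; exact sub_le_sub_left h2 _
  refine ((h.map_unit hx).smul ?_).of_le h3
  have : (1 + s⁻¹)⁻¹ < 1 := inv_lt_one_of_one_lt₀ (by linarith)
  linarith

theorem isUnitElt_inv_sub (h : GaugeReversing Φ Ψ) (hx : IsUnitElt x) (hy : IsUnitElt y) :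
    IsUnitElt (Ψ (Φ x - Φ (x + y)) - x) := by
  have := h.symm.isUnitElt_map_sub_map_add (h.isUnitElt_map_sub_map_add hx hy)
    (h.map_unit (hx.add hy.nonneg))
  rwa [sub_add_cancel, h.left_inv hx] at this

theorem isUnitElt_taylorMap (h : GaugeReversing Φ Ψ) (hx : IsUnitElt x) (hy : IsUnitElt y) :
    IsUnitElt (taylorMap Φ x y) := by
  obtain ⟨s, hs, hxy⟩ := hy x
  have hT := h.isTaylorMap_taylorMap hx
  have := hT.map_nonneg _ (sub_nonneg.mpr hxy)
  rw [map_sub, _root_.map_smul, hT.map_self, sub_nonneg] at this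
  exact (h.map_unit hx).mono hs this

/-- This is `reflection_identity` at `q = Φ (x + t y)`, rewritten so that the derivative of `F` in
the proof of Hua's identity cancels. -/
theorem smul_taylorMap_add_smul (h : GaugeReversing Φ Ψ) (hx : IsUnitElt x) (hy : IsUnitElt y)
    {t : ℝ} (ht : 0 < t) :
    t • taylorMap Φ (x + t • y) y =
      taylorMap Φ (Ψ (Φ x - Φ (x + t • y))) (Ψ (Φ x - Φ (x + t • y)) - x) := by
  have hty := hy.smul ht
  have hp : IsUnitElt (x + t • y) := hx.add hty.nonneg
  have hd := h.isUnitElt_map_sub_map_add hx hty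
  have h1 := h.reflection_identity hx (h.map_unit hp) hd
  rw [h.left_inv hp] at h1
  have h2 := (h.isTaylorMap_taylorMap hp).map_self
  rw [map_add, _root_.map_smul] at h2
  have h3 := (h.isTaylorMap_taylorMap (h.inv_unit hd)).map_self
  rw [h.right_inv hd] at h3
  rw [map_sub, h3, h1, ← h2]
  module

end Plain

section Normed

variable {V W : Type*} [NormedAddCommGroup V] [NormedSpace ℝ V] [PartialOrder V]
  [IsOrderedAddMonoid V] [IsOrderedModule ℝ V] [CompleteOrder V]
  [NormedAddCommGroup W] [NormedSpace ℝ W] [PartialOrder W]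
  [IsOrderedAddMonoid W] [IsOrderedModule ℝ W] [CompleteOrder W]
  {Φ : V → W} {Ψ : W → V} {e x y : V} {f : W}

theorem hasDerivAt_line (h : GaugeReversing Φ Ψ) (he : IsUnitNorm e) (hf : IsUnitNorm f) {t : ℝ}
    (hp : IsUnitElt (x + t • y)) :
    HasDerivAt (fun t : ℝ => Φ (x + t • y)) (-taylorMap Φ (x + t • y) y) t := by
  have h1 : HasDerivAt (fun t : ℝ => x + t • y) y t := by
    simpa using ((hasDerivAt_id t).smul_const y).const_add x
  have := (h.hasFDerivAt he hf hp).comp_hasDerivAt t h1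
  rwa [h.fderiv_apply he hf hp] at this

theorem hasDerivAt_comp (h : GaugeReversing Φ Ψ) (he : IsUnitNorm e) (hf : IsUnitNorm f) {t : ℝ}
    {c : ℝ → V} {c' : V} (hc : HasDerivAt c c' t) (hp : IsUnitElt (c t)) :
    HasDerivAt (fun t : ℝ => Φ (c t)) (-taylorMap Φ (c t) c') t := by
  have := (h.hasFDerivAt he hf hp).comp_hasDerivAt t hc
  rwa [h.fderiv_apply he hf hp] at this

theorem map_inv_sub_eq_taylorMap_of_norm (h : GaugeReversing Φ Ψ) (he : IsUnitNorm e)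
    (hf : IsUnitNorm f) (hx : IsUnitElt x) (hy : IsUnitElt y) :
    Φ (Ψ (Φ x - Φ (x + y)) - x) = taylorMap Φ x y := by
  set F : ℝ → W := fun t => t⁻¹ • Φ (Ψ (Φ x - Φ (x + t • y)) - x) with hF
  have hline : ∀ t : ℝ, HasDerivAt (fun t : ℝ => x + t • y) y t := fun t => by
    simpa using ((hasDerivAt_id t).smul_const y).const_add x
  have hder : ∀ t : ℝ, 0 < t → HasDerivAt F 0 t := by
    intro t ht
    have hty := hy.smul ht
    have hp : IsUnitElt (x + t • y) := hx.add hty.nonneg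
    have hd := h.isUnitElt_map_sub_map_add hx hty
    have hb := h.isUnitElt_inv_sub hx hty
    have d1 := (h.hasDerivAt_comp he hf (hline t) hp).const_sub (Φ x)
    have d2 := (h.symm.hasDerivAt_comp hf he d1 hd).sub_const x
    have d3 := h.hasDerivAt_comp he hf d2 hb
    have d4 := (hasDerivAt_inv ht.ne').fun_smul d3
    refine d4.congr_deriv ?_
    have k1 := h.smul_taylorMap_add_smul hx hy ht
    have k2 := h.taylorMap_taylorMap (h.inv_unit hd) (Ψ (Φ x - Φ (x + t • y)) - x)
    rw [← k1, h.right_inv hd] at k2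
    have k3 := (h.isTaylorMap_taylorMap hb).map_self
    simp only [map_neg, neg_neg]
    have k4 : Φ (Ψ (Φ x - Φ (x + t • y)) - x) =
        t • taylorMap Φ (Ψ (Φ x - Φ (x + t • y)) - x) (taylorMap Ψ (Φ x - Φ (x + t • y))
          (taylorMap Φ (x + t • y) y)) := by
      rw [← _root_.map_smul, ← _root_.map_smul, k2, k3]
    rw [k4, smul_smul, ← add_smul]
    have : t⁻¹ + -(t ^ 2)⁻¹ * t = 0 := by field_simp; ring
    rw [this, zero_smul]
  have hconst : ∀ t : ℝ, 0 < t → F t = F 1 := fun t ht =>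
    isOpen_Ioi.is_const_of_deriv_eq_zero (convex_Ioi (0 : ℝ)).isPreconnected
      (fun s hs => (hder s hs).differentiableAt.differentiableWithinAt)
      (fun s hs => (hder s hs).deriv) (Set.mem_Ioi.mpr ht) (Set.mem_Ioi.mpr one_pos)
  have hTy := h.isUnitElt_taylorMap hx hy
  have hslope : Tendsto (fun t : ℝ => t⁻¹ • (Φ x - Φ (x + t • y))) (𝓝[>] 0)
      (𝓝 (taylorMap Φ x y)) := by
    have d1 := h.hasDerivAt_comp he hf (hline 0) (by rwa [zero_smul, add_zero])
    have d2 := d1.tendsto_slope_zero.mono_left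
      (nhdsWithin_mono (0 : ℝ) (fun t (ht : (0 : ℝ) < t) => ht.ne'))
    have d3 := d2.neg
    simp only [zero_add, zero_smul, add_zero, neg_neg, ← smul_neg, neg_sub] at d3
    exact d3
  -- By homogeneity this is `F t` again, now with a difference quotient inside `Ψ`. The limit at `0`
  -- is `Φ (Ψ (T y)) = T y`, and `F` is constant.
  have hlim : Tendsto (fun t : ℝ => Φ (Ψ (t⁻¹ • (Φ x - Φ (x + t • y))) - t • x)) (𝓝[>] 0)
      (𝓝 (taylorMap Φ x y)) := by
    have c1 : Tendsto (fun t : ℝ => Ψ (t⁻¹ • (Φ x - Φ (x + t • y)))) (𝓝[>] 0)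
        (𝓝 (Ψ (taylorMap Φ x y))) :=
      ((h.symm.hasFDerivAt hf he hTy).continuousAt.tendsto).comp hslope
    have c2 : Tendsto (fun t : ℝ => t • x) (𝓝[>] 0) (𝓝 0) := by
      have : Continuous fun t : ℝ => t • x := by fun_prop
      have := (this.tendsto 0).mono_left (nhdsWithin_le_nhds (s := Set.Ioi 0))
      rwa [zero_smul] at this
    have c3 := c1.sub c2
    rw [sub_zero] at c3
    have c4 := ((h.hasFDerivAt he hf (h.inv_unit hTy)).continuousAt.tendsto).comp c3
    rwa [h.right_inv hTy] at c4
  have heq : ∀ t : ℝ, 0 < t → Φ (Ψ (t⁻¹ • (Φ x - Φ (x + t • y))) - t • x) = F 1 := by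
    intro t ht
    have hty := hy.smul ht
    rw [h.symm.map_smul (h.isUnitElt_map_sub_map_add hx hty) (inv_pos.mpr ht), inv_inv,
      ← smul_sub, h.map_smul (h.isUnitElt_inv_sub hx hty) ht]
    exact hconst t ht
  have : F 1 = taylorMap Φ x y := by
    refine tendsto_nhds_unique (tendsto_const_nhds.congr' ?_) hlim
    filter_upwards [self_mem_nhdsWithin] with t ht
    exact (heq t ht).symm
  simpa only [hF, inv_one, one_smul] using this

end Normed

variable {V W : Type*} [AddCommGroup V] [PartialOrder V] [IsOrderedAddMonoid V] [Module ℝ V]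
  [IsOrderedModule ℝ V] [CompleteOrder V] [AddCommGroup W] [PartialOrder W]
  [IsOrderedAddMonoid W] [Module ℝ W] [IsOrderedModule ℝ W] [CompleteOrder W]
  {Φ : V → W} {Ψ : W → V} {x y : V} {q : W}

theorem map_inv_sub_eq_taylorMap (h : GaugeReversing Φ Ψ) (hx : IsUnitElt x) (hy : IsUnitElt y) :
    Φ (Ψ (Φ x - Φ (x + y)) - x) = taylorMap Φ x y := by
  have hu := h.map_unit hx
  have hxn := isUnitNorm_unitNormed x hx
  have hun := isUnitNorm_unitNormed (Φ x) hu
  let _ := unitNormed x hx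
  let _ := unitNormedSpace x hx
  let _ := unitNormed (Φ x) hu
  let _ := unitNormedSpace (Φ x) hu
  exact h.map_inv_sub_eq_taylorMap_of_norm hxn hun hx hy

/-- By Hua's identity the error is `Φ r - Φ (x + r)`. As `x + r ≤ (1 + s) r`, it is at most `(1 - (1
+ s)⁻¹) Φ r ≤ s Φ r = s T y ≤ s² Φ x`. -/
theorem obound_taylor_of_unit (h : GaugeReversing Φ Ψ) (hx : IsUnitElt x) (hy : IsUnitElt y)
    {s : ℝ} (hs : 0 < s) (hys : y ≤ s • x) :
    OBound (Φ x) (s ^ 2) (Φ (x + y) - Φ x + taylorMap Φ x y) := by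
  have hT := h.isTaylorMap_taylorMap hx
  have hd := h.isUnitElt_map_sub_map_add hx hy
  have hr := h.isUnitElt_inv_sub hx hy
  have key := h.map_inv_sub_eq_taylorMap hx hy
  set r := Ψ (Φ x - Φ (x + y)) - x with hrdef
  have hxr : Φ (x + r) = Φ x - Φ (x + y) := by
    rw [hrdef, add_sub_cancel, h.right_inv hd]
  have hTy : taylorMap Φ x y ≤ s • Φ x := by
    have := hT.map_nonneg _ (sub_nonneg.mpr hys)
    rwa [map_sub, _root_.map_smul, hT.map_self, sub_nonneg] at this
  have hsi := inv_pos.mpr hs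
  have hx_le : s⁻¹ • x ≤ r := by
    rw [← h.smul_le_iff hx hr hsi, key, ← smul_le_smul_iff_pos hs, smul_smul,
      mul_inv_cancel₀ hs.ne', one_smul]
    exact hTy
  have hxr_le : x + r ≤ (1 + s) • r := by
    rw [add_smul, one_smul, add_comm]
    refine add_le_add_right ?_ _
    rwa [← smul_le_smul_iff_pos hsi, smul_smul, inv_mul_cancel₀ hs.ne', one_smul]
  have h1s : 0 < 1 + s := by linarith
  have hxru : IsUnitElt (x + r) := hx.add hr.nonneg
  have e1 : Φ (x + y) - Φ x + taylorMap Φ x y = Φ r - Φ (x + r) := by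
    rw [key, hxr]; abel
  rw [e1]
  refine OBound.of_nonneg (sub_nonneg.mpr (h.antitone hr (le_add_of_nonneg_left hx.nonneg))) ?_
  have h1 := h.antitone hxru hxr_le
  rw [h.map_smul hr h1s] at h1
  have h2 : Φ r - Φ (x + r) ≤ (1 - (1 + s)⁻¹) • Φ r := by
    rw [sub_smul, one_smul]; exact sub_le_sub_left h1 _
  have h3 : 1 - (1 + s)⁻¹ ≤ s := by
    rw [sub_le_iff_le_add, ← sub_nonneg]
    have : s + (1 + s)⁻¹ - 1 = s ^ 2 / (1 + s) := by field_simp; ring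
    rw [this]; positivity
  refine h2.trans ((smul_le_smul_of_nonneg_right h3 (h.map_unit hr).nonneg).trans ?_)
  rw [key, sq, mul_smul]
  exact smul_le_smul_of_nonneg_left hTy hs.le

/-- A positive `y` need not be an order unit; `y + ε x` is one, and `ε` tends to `0`. -/
theorem obound_taylor (h : GaugeReversing Φ Ψ) (hx : IsUnitElt x) (hy : 0 ≤ y) {s : ℝ}
    (hs : 0 ≤ s) (hys : y ≤ s • x) :
    OBound (Φ x) (s ^ 2) (Φ (x + y) - Φ x + taylorMap Φ x y) := by
  have hu := h.map_unit hx
  have key : ∀ ε : ℝ, 0 < ε → OBound (Φ x) ((s + ε) ^ 2)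
      (Φ (x + y + ε • x) - Φ x + (taylorMap Φ x y + ε • Φ x)) := fun ε hε => by
    have hyε : IsUnitElt (y + ε • x) := (hx.smul hε).of_le (le_add_of_nonneg_left hy)
    have := h.obound_taylor_of_unit hx hyε (s := s + ε) (by linarith) (by
      rw [add_smul]; exact add_le_add_left hys _)
    rwa [map_add, _root_.map_smul, (h.isTaylorMap_taylorMap hx).map_self, ← add_assoc x y] at this
  have hxn := isUnitNorm_unitNormed x hx
  have hun := isUnitNorm_unitNormed (Φ x) hu
  let _ := unitNormed x hx
  let _ := unitNormedSpace x hx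
  let _ := unitNormed (Φ x) hu
  let _ := unitNormedSpace (Φ x) hu
  refine hun.obound (le_of_tendsto_of_tendsto (b := 𝓝[>] (0 : ℝ))
    (f := fun ε => ‖Φ (x + y + ε • x) - Φ x + (taylorMap Φ x y + ε • Φ x)‖)
    (g := fun ε => (s + ε) ^ 2) ?_ ?_ ?_)
  · have c0 : ContinuousAt (fun ε : ℝ => Φ (x + y + ε • x)) 0 := by
      have := (h.hasDerivAt_line hxn hun (x := x + y) (y := x) (t := 0) (by
        rw [zero_smul, add_zero]; exact hx.add hy)).continuousAt
      exact this
    have c1 : ContinuousAt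
        (fun ε : ℝ => ‖Φ (x + y + ε • x) - Φ x + (taylorMap Φ x y + ε • Φ x)‖) 0 :=
      ((c0.sub continuousAt_const).add (by fun_prop)).norm
    have := c1.tendsto.mono_left (nhdsWithin_le_nhds (s := Set.Ioi 0))
    simpa using this
  · have : Continuous fun ε : ℝ => (s + ε) ^ 2 := by fun_prop
    have := (this.tendsto 0).mono_left (nhdsWithin_le_nhds (s := Set.Ioi 0))
    simpa using this
  · filter_upwards [self_mem_nhdsWithin] with ε hε
    exact hun.norm_le (by positivity) (key ε hε)

end GaugeReversing
end GaugeReversal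

/-! ### Translation from the gauge function and the open cones -/

namespace GaugeReversal
open OrderUnit

section Bridge

variable {V : Type*} [AddCommGroup V] [PartialOrder V] [IsOrderedAddMonoid V] [Module ℝ V]
  [IsOrderedModule ℝ V]

theorem isUnitElt_of_isOrderUnitSpace {v : V} (hv : IsOrderUnitSpace v) : IsUnitElt v :=
  hv.exists_le_smul

theorem mem_openCone_iff {v : V} (hv : IsUnitElt v) {x : V} : x ∈ openCone v ↔ IsUnitElt x := by
  constructor
  · rintro ⟨ε, hε, h⟩
    exact (hv.smul hε).of_le h
  · intro hx
    obtain ⟨t, ht, h⟩ := hx v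
    refine ⟨t⁻¹, inv_pos.mpr ht, ?_⟩
    rwa [← smul_le_smul_iff_pos ht, smul_smul, mul_inv_cancel₀ ht.ne', one_smul]

theorem orderUnitNorm_le_mul {x y : V} (hx : IsUnitElt x) (hy : 0 ≤ y) {c : ℝ} (hc : 0 < c)
    (hxy : x ≤ c • y) (h : V) : orderUnitNorm y h ≤ c * orderUnitNorm x h := by
  rw [← div_le_iff₀' hc]
  refine le_csInf ?_ fun t ⟨ht, hb⟩ => ?_
  · obtain ⟨t, ht, hb⟩ := hx.exists_bound h
    exact ⟨t, ht, hb⟩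
  · rw [div_le_iff₀' hc]
    refine csInf_le ⟨0, fun s hs => hs.1.le⟩ ⟨by positivity, ?_⟩
    exact OBound.change (x := x) hb hxy ht.le hy (le_of_eq (mul_comm _ _))

theorem completeOrder_of_isOrderUnitSpace {v : V} (hv : IsOrderUnitSpace v)
    (hc : IsCompleteFor v) : CompleteOrder V where
  archimedean := hv.archimedean
  complete := fun x hx u hu => by
    have hvu := isUnitElt_of_isOrderUnitSpace hv
    obtain ⟨c, hc0, hxc⟩ := hvu x
    obtain ⟨d, hd0, hvd⟩ := hx v
    obtain ⟨a, ha⟩ := hc u fun ε hε => by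
      obtain ⟨N, hN⟩ := hu (ε / c) (by positivity)
      refine ⟨N, fun i j hi hj => ?_⟩
      have h1 := orderUnitNorm_le_mul hx hvu.nonneg hc0 hxc (u i - u j)
      have h2 := hN i j hi hj
      rw [lt_div_iff₀' hc0] at h2
      exact h1.trans_lt h2
    refine ⟨a, squeeze_zero (g := fun n => d * orderUnitNorm v (u n - a))
      (fun n => Real.sInf_nonneg fun _ ht => ht.1.le)
      (fun n => orderUnitNorm_le_mul hvu hx.nonneg hd0 hvd _) ?_⟩
    simpa using ha.const_mul d

/-- The supremum is attained by the archimedean property. In the zero space the set of admissible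
`t` is unbounded and `sSup` takes its default value 0, hence `Nontrivial`. -/
theorem le_mGauge_iff [Nontrivial V] [CompleteOrder V] {x y : V} (hx : IsUnitElt x)
    (hy : IsUnitElt y) {t : ℝ} (ht : 0 < t) : t ≤ mGauge x y ↔ t • y ≤ x := by
  have hbdd : BddAbove {t : ℝ | 0 < t ∧ t • y ≤ x} := by
    obtain ⟨s, hs, hxs⟩ := hy x
    refine ⟨s, fun r ⟨_, hr⟩ => ?_⟩
    by_contra! hlt
    have h1 : (r - s) • y ≤ 0 := by
      rw [sub_smul, sub_nonpos]; exact hr.trans hxs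
    have h2 : y ≤ 0 := by
      rwa [← smul_le_smul_iff_pos (sub_pos.mpr hlt), smul_zero]
    have h0 : ∀ z : V, z ≤ 0 := fun z => by
      obtain ⟨t, ht, hz⟩ := hy z
      exact hz.trans ((smul_le_smul_of_nonneg_left h2 ht.le).trans (smul_zero t).le)
    obtain ⟨z, hz⟩ := exists_ne (0 : V)
    exact hz (le_antisymm (h0 z) (neg_nonpos.mp (h0 (-z))))
  constructor
  · intro H
    obtain ⟨c, hc, hyc⟩ := hx y
    have hne : {t : ℝ | 0 < t ∧ t • y ≤ x}.Nonempty :=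
      ⟨c⁻¹, inv_pos.mpr hc, by
        rwa [← smul_le_smul_iff_pos hc, smul_smul, mul_inv_cancel₀ hc.ne', one_smul]⟩
    refine hy.le_of_forall fun ε hε => ?_
    obtain ⟨s, hs, hlt⟩ := exists_lt_of_lt_csSup hne
      (show t - ε < sSup {t : ℝ | 0 < t ∧ t • y ≤ x} from by
        have : t ≤ sSup {t : ℝ | 0 < t ∧ t • y ≤ x} := H
        linarith)
    calc t • y ≤ (s + ε) • y := smul_le_smul_of_nonneg_right (by linarith) hy.nonneg
      _ = s • y + ε • y := add_smul _ _ _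
      _ ≤ x + ε • y := add_le_add_left hs.2 _
  · intro H
    exact le_csSup hbdd ⟨ht, H⟩

end Bridge

/-! ### Uniqueness, the Gateaux derivative and the theorem -/

section Main

variable {V W : Type*} [AddCommGroup V] [PartialOrder V] [IsOrderedAddMonoid V] [Module ℝ V]
  [IsOrderedModule ℝ V] [AddCommGroup W] [PartialOrder W]
  [IsOrderedAddMonoid W] [Module ℝ W] [IsOrderedModule ℝ W]

theorem subsingleton_of_injOn_units {Φ : V → W} (hinj : Set.InjOn Φ {x | IsUnitElt x})
    [Subsingleton W] {v : V} (hv : IsUnitElt v) : Subsingleton V := by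
  have h1 : v = (2 : ℝ) • v := hinj hv (hv.smul two_pos) (Subsingleton.elim _ _)
  have h2 : v = 0 := by rwa [two_smul, left_eq_add] at h1
  refine ⟨fun a b => ?_⟩
  have key : ∀ z : V, z ≤ 0 := fun z => by
    obtain ⟨t, -, hz⟩ := hv z
    rwa [h2, smul_zero] at hz
  have key2 : ∀ z : V, z = 0 := fun z => le_antisymm (key z) (neg_nonpos.mp (key (-z)))
  rw [key2 a, key2 b]

variable [CompleteOrder V] [CompleteOrder W]

theorem gaugeReversing_invFunOn {v : V} {w : W} (hv : IsUnitElt v) (hw : IsUnitElt w) {Φ : V → W}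
    (hΦ : IsGaugeReversingBijection Φ (openCone v) (openCone w)) :
    GaugeReversing Φ (Function.invFunOn Φ {x | IsUnitElt x}) := by
  have hC : openCone v = {x | IsUnitElt x} := Set.ext fun x => mem_openCone_iff hv
  have hD : openCone w = {x | IsUnitElt x} := Set.ext fun x => mem_openCone_iff hw
  have hb := hΦ.bijOn
  have hm := hΦ.gauge_map
  rw [hC, hD] at hb
  rw [hC] at hm
  have hinv := hb.invOn_invFunOn
  have hmap : ∀ {x : V}, IsUnitElt x → IsUnitElt (Φ x) := fun hx => hb.mapsTo hx
  refine ⟨hmap, fun hy => hb.surjOn.mapsTo_invFunOn hy, fun hx => hinv.1 hx, fun hy => hinv.2 hy,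
    fun {x y t} hx hy ht => ?_⟩
  -- The zero space is treated apart, since `mGauge` carries no information there. Injectivity on
  -- `v` and `2 v` shows that one space is zero only if the other is.
  rcases subsingleton_or_nontrivial V with hV | hV
  · have hi : Set.InjOn (Function.invFunOn Φ {x | IsUnitElt x}) {y : W | IsUnitElt y} :=
      fun a ha b hb' hab => by
        have h1 := hinv.2 ha
        have h2 := hinv.2 hb'
        rw [← h1, ← h2, hab]
    have hW := subsingleton_of_injOn_units hi hw
    exact ⟨fun _ => (Subsingleton.elim _ _).le, fun _ => (Subsingleton.elim _ _).le⟩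
  · have hW : Nontrivial W := by
      by_contra hW
      have := not_nontrivial_iff_subsingleton.mp hW
      have := subsingleton_of_injOn_units hb.injOn hv
      exact not_nontrivial V hV
    rw [← le_mGauge_iff (hmap hx) (hmap hy) ht, hm x hx y hy, le_mGauge_iff hy hx ht]

variable {Φ : V → W} {Ψ : W → V} {x : V}

theorem GaugeReversing.taylorMap_inv (h : GaugeReversing Φ Ψ) (hx : IsUnitElt x) (z : W) :
    taylorMap Φ x (taylorMap Ψ (Φ x) z) = z := by
  have := h.symm.taylorMap_taylorMap (h.map_unit hx) z
  rwa [h.left_inv hx] at this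

/-- Minus the derivative of a gauge-reversing bijection, as a linear equivalence. -/
def GaugeReversing.taylorEquiv (h : GaugeReversing Φ Ψ) (hx : IsUnitElt x) : V ≃ₗ[ℝ] W :=
  LinearEquiv.ofLinearMap (taylorMap Φ x) (taylorMap Ψ (Φ x))
    (LinearMap.ext fun z => h.taylorMap_inv hx z)
    (LinearMap.ext fun y => h.taylorMap_taylorMap hx y)

theorem GaugeReversing.isOrderUnitIso_taylorEquiv (h : GaugeReversing Φ Ψ) (hx : IsUnitElt x) :
    IsOrderUnitIso (h.taylorEquiv hx) x (Φ x) where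
  map_nonneg_iff := fun y => by
    refine ⟨fun hy => ?_, (h.isTaylorMap_taylorMap hx).map_nonneg y⟩
    have := (h.symm.isTaylorMap_taylorMap (h.map_unit hx)).map_nonneg _ hy
    rwa [show h.taylorEquiv hx y = taylorMap Φ x y from rfl, h.taylorMap_taylorMap hx] at this
  map_unit := (h.isTaylorMap_taylorMap hx).map_self

theorem GaugeReversing.norm_taylorEquiv_le (h : GaugeReversing Φ Ψ) (hx : IsUnitElt x) {y : V}
    (hy : 0 ≤ y) : orderUnitNorm (Φ x) (Φ (x + y) - Φ x - (-h.taylorEquiv hx y)) ≤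
      orderUnitNorm x y ^ 2 := by
  rw [orderUnitNorm_le_iff (h.map_unit hx) (sq_nonneg _), sub_neg_eq_add]
  exact h.obound_taylor hx hy (orderUnitNorm_nonneg x y) (obound_orderUnitNorm hx y).2

theorem orderUnitNorm_smul_pos_le {u : W} (hx : IsUnitElt x) (hu : IsUnitElt u) {T : V ≃ₗ[ℝ] W}
    (hT : ∀ y : V, 0 ≤ y →
      orderUnitNorm u (Φ (x + y) - Φ x - (-T y)) ≤ orderUnitNorm x y ^ 2)
    {y : V} (hy : 0 ≤ y) {t : ℝ} (ht : 0 < t) :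
    OBound u (t ^ 2 * orderUnitNorm x y ^ 2) (Φ (x + t • y) - Φ x + t • T y) := by
  have h1 := hT (t • y) (smul_nonneg ht.le hy)
  rw [orderUnitNorm_smul hx, abs_of_pos ht, mul_pow, map_smul, sub_neg_eq_add,
    orderUnitNorm_le_iff hu (by positivity)] at h1
  exact h1

/-- Replacing `y` by `t y` and dividing by `t` bounds `T y - T' y` by `2 t ‖y‖²` for every `t > 0`.
The cone spans, since `y + s x ≥ 0` for large `s`. -/
theorem eq_of_taylor_estimate {u : W} (hx : IsUnitElt x) (hu : IsUnitElt u) {T T' : V ≃ₗ[ℝ] W}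
    (hT : ∀ y : V, 0 ≤ y →
      orderUnitNorm u (Φ (x + y) - Φ x - (-T y)) ≤ orderUnitNorm x y ^ 2)
    (hT' : ∀ y : V, 0 ≤ y →
      orderUnitNorm u (Φ (x + y) - Φ x - (-T' y)) ≤ orderUnitNorm x y ^ 2) : T = T' := by
  have key : ∀ y : V, 0 ≤ y → T y = T' y := by
    intro y hy
    set N := orderUnitNorm x y with hN
    refine eq_of_forall_obound hu fun ε hε => ?_
    set t := ε / (2 * N ^ 2 + 1) with htdef
    have ht : 0 < t := by positivity
    have h1 := (orderUnitNorm_smul_pos_le hx hu hT hy ht).sub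
      (orderUnitNorm_smul_pos_le hx hu hT' hy ht)
    rw [add_sub_add_left_eq_sub, ← smul_sub] at h1
    have h2 := h1.smul_nonneg (inv_pos.mpr ht).le
    rw [smul_smul, inv_mul_cancel₀ ht.ne', one_smul] at h2
    refine h2.mono hu.nonneg ?_
    have h3 : t * (2 * N ^ 2 + 1) = ε := div_mul_cancel₀ _ (by positivity)
    have h4 : t⁻¹ * (t ^ 2 * N ^ 2 + t ^ 2 * N ^ 2) = t * (2 * N ^ 2) := by
      field_simp; ring
    rw [h4]; linarith
  refine LinearEquiv.ext fun y => ?_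
  obtain ⟨s, hs, hb⟩ := hx.exists_bound y
  have h1 := key (y + s • x) (by
    have := hb.1; rwa [neg_le_iff_add_nonneg] at this)
  rwa [map_add, map_add, map_smul, map_smul, key x hx.nonneg, add_left_inj] at h1

theorem hasGateauxDerivAt_of_taylor_estimate {v : V} {w u : W} (hv : IsUnitElt v)
    (hw : IsUnitElt w) (hx : IsUnitElt x) (hu : IsUnitElt u) {T : V ≃ₗ[ℝ] W}
    (hT : ∀ y : V, 0 ≤ y →
      orderUnitNorm u (Φ (x + y) - Φ x - (-T y)) ≤ orderUnitNorm x y ^ 2) {y : V} (hy : 0 ≤ y) :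
    HasGateauxDerivAt w Φ (openCone v) x y (-T y) := by
  obtain ⟨c, hc, huc⟩ := hw u
  set N := orderUnitNorm x y with hN
  constructor
  · filter_upwards [self_mem_nhdsWithin] with t ht
    exact (mem_openCone_iff hv).mpr (hx.add (smul_nonneg (le_of_lt ht) hy))
  · have hlim : Tendsto (fun t : ℝ => t * (N ^ 2 * c)) (𝓝[>] 0) (𝓝 0) := by
      have : Continuous fun t : ℝ => t * (N ^ 2 * c) := by fun_prop
      have := (this.tendsto 0).mono_left (nhdsWithin_le_nhds (s := Set.Ioi 0))
      simpa using this
    refine tendsto_of_tendsto_of_tendsto_of_le_of_le' tendsto_const_nhds hlim ?_ ?_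
    · filter_upwards [self_mem_nhdsWithin] with t ht
      exact mul_nonneg (inv_nonneg.mpr (le_of_lt ht)) (orderUnitNorm_nonneg _ _)
    · filter_upwards [self_mem_nhdsWithin] with t ht
      have ht' : 0 < t := ht
      have h1 := (orderUnitNorm_smul_pos_le hx hu hT hy ht').change huc (by positivity) hw.nonneg
        le_rfl
      rw [← orderUnitNorm_le_iff hw (by positivity)] at h1
      rw [smul_neg, sub_neg_eq_add]
      refine (mul_le_mul_of_nonneg_left h1 (inv_nonneg.mpr ht'.le)).trans (le_of_eq ?_)
      rw [← hN]
      field_simp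

end Main
end GaugeReversal

end

theorem mainTheorem7 {V W : Type*}
    [AddCommGroup V] [PartialOrder V] [IsOrderedAddMonoid V] [Module ℝ V] [IsOrderedModule ℝ V]
    [AddCommGroup W] [PartialOrder W] [IsOrderedAddMonoid W] [Module ℝ W] [IsOrderedModule ℝ W]
    (v : V) (w : W)
    (hv : OrderUnit.IsOrderUnitSpace v) (hVc : OrderUnit.IsCompleteFor v)
    (hw : OrderUnit.IsOrderUnitSpace w) (hWc : OrderUnit.IsCompleteFor w)
    (Φ : V → W)
    (hΦ : OrderUnit.IsGaugeReversingBijection Φ (OrderUnit.openCone v) (OrderUnit.openCone w))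
    (x : V) (hx : x ∈ OrderUnit.openCone v) :
    ∃ T : V ≃ₗ[ℝ] W,
      -- `T = -DΦ(x)` is an isomorphism of order unit spaces satisfying the estimate
      (OrderUnit.IsOrderUnitIso T x (Φ x) ∧
        ∀ y : V, 0 ≤ y →
          OrderUnit.orderUnitNorm (Φ x) (Φ (x + y) - Φ x - (-T y))
            ≤ OrderUnit.orderUnitNorm x y ^ 2) ∧
      -- it is the only such isomorphism
      (∀ T' : V ≃ₗ[ℝ] W,
        (OrderUnit.IsOrderUnitIso T' x (Φ x) ∧
          ∀ y : V, 0 ≤ y →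
            OrderUnit.orderUnitNorm (Φ x) (Φ (x + y) - Φ x - (-T' y))
              ≤ OrderUnit.orderUnitNorm x y ^ 2) → T' = T) ∧
      -- `DΦ(x) = -T` is the one-sided Gateaux derivative of `Φ` in all positive directions
      (∀ y : V, 0 ≤ y →
        OrderUnit.HasGateauxDerivAt w Φ (OrderUnit.openCone v) x y (-T y)) := by
  have hvu := GaugeReversal.isUnitElt_of_isOrderUnitSpace hv
  have hwu := GaugeReversal.isUnitElt_of_isOrderUnitSpace hw
  have := GaugeReversal.completeOrder_of_isOrderUnitSpace hv hVc
  have := GaugeReversal.completeOrder_of_isOrderUnitSpace hw hWc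
  have h := GaugeReversal.gaugeReversing_invFunOn hvu hwu hΦ
  have hxu := (GaugeReversal.mem_openCone_iff hvu).mp hx
  have hu := h.map_unit hxu
  have hest := fun (y : V) (hy : 0 ≤ y) => h.norm_taylorEquiv_le hxu hy
  exact ⟨h.taylorEquiv hxu, ⟨h.isOrderUnitIso_taylorEquiv hxu, hest⟩,
    fun T' hT' => GaugeReversal.eq_of_taylor_estimate hxu hu hT'.2 hest,
    fun y hy => GaugeReversal.hasGateauxDerivAt_of_taylor_estimate hvu hwu hxu hu hest hy⟩
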